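/- **Notation.** Let $p>3$ be prime, $\zeta_p=e^{2\pi i/p}$, $q=e^{2\pi i z}$ with $\operatorname{Im} z>0$, and $s_p=\frac{p^2-1}{24}$. The crank of a partition is its largest part if it has no ones ($0$ for the empty partition), and otherwise the number of parts larger than the number $\omega$ of ones, minus $\omega$. Let $M(m,n)$ be the number of partitions of $n$ with crank $m$, with the usual convention $M(0,1)=-1$, $M(\pm1,1)=1$ and $M(m,1)=0$ otherwise, so that $\sum_{n\ge0}\sum_m M(m,n)x^mq^n=\prod_{n\ge1}\frac{1-q^n}{(1-xq^n)(1-x^{-1}q^n)}$. Let $M(k,p,n)=\sum_{m\equiv k\,(p)}M(m,n)$. For $0\le m\le p-1$ put $$\mathcal K^{(C)}_{p,m}(\zeta_p,z)=q^{m/p}\prod_{n\ge1}(1-q^{pn})\sum_{pn+m\ge s_p}\Big(\sum_{k=0}^{p-1}M(k,p,pn+m-s_p)\,\zeta_p^{k}\Big)q^n .$$ For $\vec n=(n_0,\dots,n_{(p-1)/2})\in\mathbb Z^{(p+1)/2}$ let $$j(p,\vec n,z)=\eta(pz)^{n_0}\prod_{k=1}^{(p-1)/2}f_{p,k}(z)^{n_k},\qquad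 f_{p,k}(z)=q^{(p-2k)^2/(8p)}\prod_{r\ge0}(1-q^{k+pr})(1-q^{p-k+pr})(1-q^{p+pr}),$$ where $\eta$ is the Dedekind eta function. For $1\le a\le p-1$ let $\pi_a(\vec n)$ be the vector with entries $\pi_a(\vec n)_0=n_0$ and $\pi_a(\vec n)_i=n_{i'}$ for $1\le i\le\frac{p-1}2$, where $1\le i'\le\frac{p-1}2$ and $a\,i'\equiv\pm i\pmod p$. An *eta identity* for $\mathcal K^{(C)}_{p,m}$ is an identity $$\mathcal K^{(C)}_{p,m}(\zeta_p,z)=\sum_{i=1}^t c_i(\zeta_p)\,j(p,\vec n_i,z)\qquad(\operatorname{Im}z>0)$$ with $t\ge0$, $\vec n_i\in\mathbb Z^{(p+1)/2}$ and $c_i\in\mathbb Q[X]$. **Statement.** Let $0\le m^+,m^-\le p-1$ with $\left(\frac{m^+}{p}\right)=1$ and $\left(\frac{m^-}{p}\right)=-1$. Then the eta identities for all $\mathcal K^{(C)}_{p,m}(\zeta_p,z)$, $0\le m\le p-1$, are completely determined by those for the three elements with $m\in\{0,m^+,m^-\}$, in the following explicit sense. For every $0\le m\le p-1$ there are $m_0\in\{0,m^+,m^-\}$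 and $1\le a\le p-1$ with $m\equiv m_0a^2\pmod p$. For all such $m_0$ and $a$, the substitution $$\vec n_i\mapsto\pi_a(\vec n_i),\qquad c_i(\zeta_p)\mapsto(-1)^{a+1}\,\frac{\sin(\pi/p)}{\sin(a\pi/p)}\,(-1)^{\sum_{k=1}^{(p-1)/2}\left((a+1)k+\lfloor ak/p\rfloor\right)n_{i,k}}\;c_i(\zeta_p^{a}),$$ where $\vec n_i=(n_{i,0},n_{i,1},\dots)$, is a bijection from the set of all finite families $(\vec n_i,c_i(\zeta_p))_{1\le i\le t}$ with $\vec n_i\in\mathbb Z^{(p+1)/2}$ and $c_i(\zeta_p)\in\mathbb Q(\zeta_p)$ to itself, and a family gives an eta identity for $\mathcal K^{(C)}_{p,m_0}(\zeta_p,z)$ if and only if its image gives an eta identity for $\mathcal K^{(C)}_{p,m}(\zeta_p,z)$. -/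

import Mathlib

open scoped UpperHalfPlane Polynomial

namespace CrankDissection

/-- The Andrews--Garvan crank of a partition: the largest part if there are no ones
(`0` for the empty partition), and otherwise the number of parts larger than the number of ones,
minus the number of ones. -/
def crank {n : ℕ} (P : n.Partition) : ℤ :=
  if P.parts.count 1 = 0 then (P.parts.sup : ℤ)
  else (P.parts.countP (fun x => P.parts.count 1 < x) : ℤ) - (P.parts.count 1 : ℤ)

/-- `M(m, n)`: the number of partitions of `n` with crank `m`, with the usual convention
`M(0, 1) = -1`, `M(1, 1) = M(-1, 1) = 1` for `n = 1`. With it, `M(m, n)` is for every `n` the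
coefficient of `z ^ m * q ^ n` in `C(z, q) = ∏ (1 - q ^ n) / ((1 - z q ^ n) (1 - z⁻¹ q ^ n))`. -/
def crankCount (m : ℤ) (n : ℕ) : ℤ :=
  if n = 1 then (if m = 0 then -1 else if m = 1 ∨ m = -1 then 1 else 0)
  else ((Finset.univ.filter (fun P : n.Partition => crank P = m)).card : ℤ)

/-- `M(r, t, n)`: the sum of `M(m, n)` over all `m ≡ r` modulo `t`
(the crank of a partition of `n` lies between `-n` and `n`). -/
noncomputable def crankCountMod (r t n : ℕ) : ℤ :=
  ∑ m ∈ (Finset.Icc (-(n : ℤ)) (n : ℤ)).filter (fun m => m ≡ (r : ℤ) [ZMOD (t : ℤ)]),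
    crankCount m n

/-- `ζ_p = exp (2 π i / p)`. -/
noncomputable def zeta (p : ℕ) : ℂ := Complex.exp (2 * Real.pi * Complex.I / p)

/-- `q = exp (2 π i z)`. -/
noncomputable def nome (z : ℍ) : ℂ := Complex.exp (2 * Real.pi * Complex.I * z)

/-- The dissection element `K_{p,m}^{(C)}(ζ_p ^ l, z)`, with `s_p = (p ^ 2 - 1) / 24`
(an integer for primes `p > 3`):
`q ^ (m / p) * ∏_{n ≥ 1} (1 - q ^ (p n)) * ∑_n (∑_k M(k, p, p n + m - s_p) ζ_p ^ (k l)) q ^ n`,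
over all `n` with `p n + m - s_p ≥ 0`. For `m < p` all such `n` are nonnegative. -/
noncomputable def dissection (p m l : ℕ) (z : ℍ) : ℂ :=
  Complex.exp (2 * Real.pi * Complex.I * m * z / p) *
    (∏' n : ℕ, (1 - nome z ^ (p * (n + 1)))) *
    ∑' n : ℕ,
      if (p ^ 2 - 1) / 24 ≤ p * n + m then
        (∑ k ∈ Finset.range p,
          (crankCountMod k p (p * n + m - (p ^ 2 - 1) / 24) : ℂ) * zeta p ^ (k * l)) * nome z ^ n
      else 0

/-- Biagioli's theta function
`f_{N,ρ}(z) = (-1) ^ ⌊ρ / N⌋ q ^ ((N - 2ρ)² / (8N)) (q ^ ρ, q ^ (N - ρ), q ^ N; q ^ N)_∞`. -/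
noncomputable def biagioli (N : ℕ) (ρ : ℤ) (z : ℍ) : ℂ :=
  (-1) ^ (ρ / (N : ℤ)) *
    Complex.exp (2 * Real.pi * Complex.I * z * (((N : ℂ) - 2 * ρ) ^ 2 / (8 * N))) *
    ((∏' k : ℕ, (1 - nome z ^ (ρ + (N : ℤ) * k))) *
      (∏' k : ℕ, (1 - nome z ^ ((N : ℤ) - ρ + (N : ℤ) * k))) *
      (∏' k : ℕ, (1 - nome z ^ ((N : ℤ) + (N : ℤ) * k))))

/-- Exponent vectors `(n_0, n_1, …, n_{(p-1)/2})` (for odd `p`, `p / 2 = (p - 1) / 2`). -/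
abbrev ExpVec (p : ℕ) : Type := Fin (p / 2 + 1) → ℤ

/-- The generalized eta product
`j(p, n, z) = η(p z) ^ n_0 * ∏_{k = 1}^{(p-1)/2} f_{p,k}(z) ^ n_k`. -/
noncomputable def etaProduct (p : ℕ) (n : ExpVec p) (z : ℍ) : ℂ :=
  ModularForm.eta ((p : ℂ) * z) ^ n 0 *
    ∏ k : Fin (p / 2), biagioli p ((k : ℤ) + 1) z ^ n k.succ

/-- The index `r' ∈ {0, …, (p-1)/2}` with `r' ≡ ± x` modulo `p`. -/
def foldIndex (p : ℕ) [NeZero p] (x : ZMod p) : Fin (p / 2 + 1) :=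
  ⟨x.valMinAbs.natAbs, Nat.lt_succ_of_le (ZMod.natAbs_valMinAbs_le x)⟩

/-- The vector `π_r(n)`, whose entry at `i` is `n_{i'}`, where `r i' ≡ ± i` modulo `p`
(so `0` is fixed). For `r` prime to `p`, the index of `f_{p,k}` is moved to `± r k`. -/
def permVec (p : ℕ) [NeZero p] (r : ℕ) (n : ExpVec p) : ExpVec p :=
  fun i => n (foldIndex p ((r : ZMod p)⁻¹ * ((i : ℕ) : ZMod p)))

/-- The sign `(-1) ^ ∑_k ((a + 1) k + ⌊a k / p⌋) n_k`, the sum over `1 ≤ k ≤ (p - 1) / 2`. -/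
noncomputable def transferSign (p a : ℕ) (n : ExpVec p) : ℂ :=
  (-1) ^ (∑ k : Fin (p / 2),
    (((a : ℤ) + 1) * ((k : ℤ) + 1) + ((a : ℤ) * ((k : ℤ) + 1)) / (p : ℤ)) * n k.succ)

/-- The family `(n_i, c_i(ζ_p))` is an identity for `K_{p,m}^{(C)}(ζ_p, z)` in terms of generalized
eta products: `K_{p,m}^{(C)}(ζ_p, z) = ∑_i c_i(ζ_p) j(p, n_i, z)` for all `z` in the upper
half-plane. -/
def IsEtaIdentity (p m : ℕ) {t : ℕ} (n : Fin t → ExpVec p) (c : Fin t → ℚ[X]) : Prop :=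
  ∀ z : ℍ, dissection p m 1 z =
    ∑ i, Polynomial.aeval (zeta p) (c i) * etaProduct p (n i) z

/-- The family `(n'_i, c'_i(ζ_p))` is obtained from `(n_i, c_i(ζ_p))` by the substitution attached
to `a`: `n'_i = π_a(n_i)` and
`c'_i(ζ_p) = (-1) ^ (a + 1) * sin (π / p) / sin (a π / p) * (sign of n_i) * c_i(ζ_p ^ a)`. -/
def IsTransfer (p : ℕ) [NeZero p] (a : ℕ) {t : ℕ} (n : Fin t → ExpVec p) (c : Fin t → ℚ[X])
    (n' : Fin t → ExpVec p) (c' : Fin t → ℚ[X]) : Prop :=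
  ∀ i, n' i = permVec p a (n i) ∧
    Polynomial.aeval (zeta p) (c' i) =
      (-1) ^ (a + 1) * ((Real.sin (Real.pi / p) / Real.sin (a * Real.pi / p) : ℝ) : ℂ) *
        transferSign p a (n i) * Polynomial.aeval (zeta p ^ a) (c i)

end CrankDissection

/-! The transfer is the action of one modular matrix on both sides of an identity, combined with the
Galois conjugation ζ_p ↦ ζ_p^a. Take A = (α β; γ δ) in SL₂(ℤ) with α ≡ a mod p, diagonal entries 1
mod 24, and β, γ divisible by 24p³ (`TransferMatrix`). Write z' = Az and F = η(pz')/η(pz), so that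
F² = γz + δ.

Eta products: by the Jacobi triple product, f_{p,k}(z) is, up to sign, η(pz)³ times the Klein form
of characteristic (k/p, 0) at pz. The matrix replaces k by αk. As a function of k the Klein form is
odd and changes sign under k ↦ k + p, so αk folds back to an index between 1 and (p-1)/2 at the cost
of a sign. Hence j(p, n, z') is j(p, π_a(n), z) times the transfer sign and a power of F
(`TransferMatrix.Maps.etaProduct`).

Dissection elements: the crank generating function at a root of unity ω is (q)_∞ / ((ωq)_∞ (ω⁻¹q)_∞)
(`hasSum_crank`, `hasSum_crankCountMod`). Multiplied by q^{s_p} (q^{p²})_∞ it becomes, for ω = ζ_p^l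
with 0 < l < p, a sine constant times η(p²w)/η(w) over the Klein form of characteristic (0, l/p)
(`crankForm_zeta`). The element K_{p,m} is a finite Fourier sum of this function over the points w =
(z + 24j)/p (`dissection_eq_sum`). Moving A past these shifts replaces j by δ²j and the
characteristic a/p by 1/p. So K_{p,m₀}(ζ_p^a, z') is F² times a sine quotient times K_{p,m}(ζ_p, z)
whenever m ≡ m₀a² (`TransferMatrix.Maps.dissection`).

Two points remain. The eta products of an identity need not have equal weights, so the powers of F
do not simply cancel. But all functions involved have period 24p in z while F does not, and
comparing infinitely many translates removes F (`sum_eq_zero_of_infinite_zpow`,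
`TransferMatrix.identity_iff`). Moreover the matrix relates K at ζ_p^a to K at ζ_p, so an identity
at ζ_p must first be conjugated. In q^{1/(24p)} eta products have integral coefficients and the
dissection elements have coefficients polynomial in ζ_p, so an identity is a list of polynomial
relations in ζ_p over ℚ, valid at every conjugate (`identity_conj`).

Finally, m and m₀ differ by a nonzero square mod p exactly when their Legendre symbols agree, which
leaves the three classes (`exists_sq_mul`), and the sine quotient lies in ℚ(ζ_p), which makes the
substitution well defined on coefficients. -/

namespace CrankDissection

/-! ### Convergent evaluation of formal power series -/

open PowerSeries in
/-- The power series `F` converges at `x` with sum `v`. -/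
def EvalsTo (F : PowerSeries ℂ) (x v : ℂ) : Prop :=
  HasSum (fun n => F.coeff n * x ^ n) v

namespace EvalsTo

open PowerSeries

variable {F G : PowerSeries ℂ} {x v w : ℂ}

lemma unique (h : EvalsTo F x v) (h' : EvalsTo F x w) : v = w := HasSum.unique h h'

lemma add (h : EvalsTo F x v) (h' : EvalsTo G x w) : EvalsTo (F + G) x (v + w) := by
  unfold EvalsTo at *
  simpa [add_mul] using h.add h'

lemma sub (h : EvalsTo F x v) (h' : EvalsTo G x w) : EvalsTo (F - G) x (v - w) := by
  unfold EvalsTo at *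
  simpa [sub_mul] using h.sub h'

lemma const (c x : ℂ) : EvalsTo (C c) x c := by
  unfold EvalsTo
  convert hasSum_single 0 _ using 1
  · simp
  · intro n hn
    simp [coeff_C, hn]

lemma one (x : ℂ) : EvalsTo 1 x 1 := by
  simpa using const 1 x

lemma X_pow (k : ℕ) (x : ℂ) : EvalsTo (X ^ k) x (x ^ k) := by
  unfold EvalsTo
  convert hasSum_single k _ using 1
  · simp
  · intro n hn
    simp [coeff_X_pow, hn]

lemma mul (h : EvalsTo F x v) (h' : EvalsTo G x w) : EvalsTo (F * G) x (v * w) := by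
  have hf : Summable fun n => ‖F.coeff n * x ^ n‖ := h.summable.norm
  have hg : Summable fun n => ‖G.coeff n * x ^ n‖ := h'.summable.norm
  have key := tsum_mul_tsum_eq_tsum_sum_antidiagonal_of_summable_norm hf hg
  have hs := (summable_norm_sum_mul_antidiagonal_of_summable_norm hf hg).of_norm
  have e : ∀ n, ∑ kl ∈ Finset.HasAntidiagonal.antidiagonal n, F.coeff kl.1 * x ^ kl.1 * (G.coeff kl.2 * x ^ kl.2)
      = (F * G).coeff n * x ^ n := by
    intro n
    rw [coeff_mul, Finset.sum_mul]
    refine Finset.sum_congr rfl fun kl hkl => ?_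
    rw [← Finset.HasAntidiagonal.mem_antidiagonal.mp hkl, pow_add]
    ring
  simp_rw [e] at key hs
  unfold EvalsTo at *
  rw [h.tsum_eq, h'.tsum_eq] at key
  rw [key]
  exact hs.hasSum

lemma sum {ι : Type*} (s : Finset ι) {F : ι → PowerSeries ℂ} {v : ι → ℂ}
    (h : ∀ i ∈ s, EvalsTo (F i) x (v i)) : EvalsTo (∑ i ∈ s, F i) x (∑ i ∈ s, v i) := by
  classical
  induction s using Finset.induction_on with
  | empty => simpa using const 0 x
  | insert a s ha ih =>
    rw [Finset.sum_insert ha, Finset.sum_insert ha]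
    exact (h a (by simp)).add (ih fun i hi => h i (by simp [hi]))

lemma prod {ι : Type*} (s : Finset ι) {F : ι → PowerSeries ℂ} {v : ι → ℂ}
    (h : ∀ i ∈ s, EvalsTo (F i) x (v i)) : EvalsTo (∏ i ∈ s, F i) x (∏ i ∈ s, v i) := by
  classical
  induction s using Finset.induction_on with
  | empty => simpa using one x
  | insert a s ha ih =>
    rw [Finset.prod_insert ha, Finset.prod_insert ha]
    exact (h a (by simp)).mul (ih fun i hi => h i (by simp [hi]))

lemma pow (h : EvalsTo F x v) (k : ℕ) : EvalsTo (F ^ k) x (v ^ k) := by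
  simpa using prod (Finset.range k) fun _ _ => h

end EvalsTo

/-! ### Analytic generating functions of multiplicative weights on partitions -/

section PartitionSums

open PowerSeries Nat.Partition
open scoped PowerSeries.WithPiTopology

lemma norm_coeff_genFun_le (w : ℕ → ℕ → ℂ) (hw : ∀ i c, ‖w i c‖ ≤ 1) (n : ℕ) :
    ‖(genFun w).coeff n‖ ≤ Fintype.card n.Partition := by
  rw [coeff_genFun]
  refine (norm_sum_le _ _).trans ?_
  rw [← Finset.card_univ, ← nsmul_one, ← Finset.sum_const]
  refine Finset.sum_le_sum fun P _ => ?_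
  rw [Finsupp.prod, norm_prod]
  exact Finset.prod_le_one (fun _ _ => norm_nonneg _) fun _ _ => hw _ _

/-- The weight `w` restricted to parts of size at most `K`. -/
def truncWeight (w : ℕ → ℕ → ℂ) (K i c : ℕ) : ℂ := if i ≤ K then w i c else 0

lemma coeff_genFun_truncWeight (w : ℕ → ℕ → ℂ) {K n : ℕ} (h : n ≤ K) :
    (genFun (truncWeight w K)).coeff n = (genFun w).coeff n := by
  rw [coeff_genFun, coeff_genFun]
  refine Finset.sum_congr rfl fun P _ => Finset.prod_congr rfl fun i hi => ?_
  have : i ≤ n := by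
    have := Multiset.le_sum_of_mem (Multiset.mem_toFinset.mp (by simpa using hi) : i ∈ P.parts)
    rwa [P.parts_sum] at this
  simp [truncWeight, this.trans h]

lemma genFun_truncWeight (w : ℕ → ℕ → ℂ) (K : ℕ) :
    genFun (truncWeight w K) =
      ∏ i ∈ Finset.range K, (1 + ∑' j, w (i + 1) (j + 1) • (X : ℂ⟦X⟧) ^ ((i + 1) * (j + 1))) := by
  refine (hasProd_genFun (truncWeight w K)).unique ?_
  convert hasProd_prod_of_ne_finset_one (s := Finset.range K) _ using 1
  · refine Finset.prod_congr rfl fun i hi => ?_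
    have : i + 1 ≤ K := Finset.mem_range.mp hi
    simp [truncWeight, this]
  · intro i hi
    have : ¬ i + 1 ≤ K := by simpa using hi
    simp [truncWeight, this]
  · infer_instance

lemma evalsTo_factor (w : ℕ → ℕ → ℂ) (hw : ∀ i c, ‖w i c‖ ≤ 1) (i : ℕ) {q : ℂ} (hq : ‖q‖ < 1) :
    EvalsTo (1 + ∑' j, w (i + 1) (j + 1) • (X : ℂ⟦X⟧) ^ ((i + 1) * (j + 1))) q
      (1 + ∑' j, w (i + 1) (j + 1) * q ^ ((i + 1) * (j + 1))) := by
  refine (EvalsTo.one q).add ?_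
  have hc : ∀ n, (∑' j, w (i + 1) (j + 1) • (X : ℂ⟦X⟧) ^ ((i + 1) * (j + 1))).coeff n =
      ∑' j, if n = (i + 1) * (j + 1) then w (i + 1) (j + 1) else 0 := by
    intro n
    rw [(summable_genFun_term w i).map_tsum _ (WithPiTopology.continuous_coeff ℂ n)]
    simp [coeff_X_pow]
  have hinj : Function.Injective fun j : ℕ => (i + 1) * (j + 1) := fun a b h => by
    simpa using h
  unfold EvalsTo
  rw [← hinj.hasSum_iff]
  · have : (fun n => (∑' j, w (i + 1) (j + 1) • (X : ℂ⟦X⟧) ^ ((i + 1) * (j + 1))).coeff n * q ^ n) ∘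
        (fun j : ℕ => (i + 1) * (j + 1)) = fun j => w (i + 1) (j + 1) * q ^ ((i + 1) * (j + 1)) := by
      funext k
      simp only [Function.comp, hc]
      rw [tsum_eq_single k]
      · simp
      · intro j hj
        rw [if_neg]
        exact fun h => hj (hinj h).symm
    rw [this]
    refine Summable.hasSum (Summable.of_norm_bounded (g := fun j => ‖q‖ ^ j)
      (summable_geometric_of_lt_one (norm_nonneg _) hq) fun j => ?_)
    rw [norm_mul, norm_pow]
    calc _ ≤ 1 * ‖q‖ ^ ((i + 1) * (j + 1)) := by gcongr; exact hw _ _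
      _ ≤ ‖q‖ ^ j := by
        rw [one_mul]
        exact pow_le_pow_of_le_one (norm_nonneg _) hq.le (by nlinarith)
  · intro n hn
    have : ∀ j, (if n = (i + 1) * (j + 1) then w (i + 1) (j + 1) else 0) = 0 := fun j => by
      rw [if_neg]
      exact fun h => hn ⟨j, h.symm⟩
    simp_rw [hc, this, tsum_zero, zero_mul]

lemma evalsTo_genFun_truncWeight (w : ℕ → ℕ → ℂ) (hw : ∀ i c, ‖w i c‖ ≤ 1) (K : ℕ) {q : ℂ}
    (hq : ‖q‖ < 1) :
    EvalsTo (genFun (truncWeight w K)) q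
      (∏ i ∈ Finset.range K, (1 + ∑' j, w (i + 1) (j + 1) * q ^ ((i + 1) * (j + 1)))) := by
  rw [genFun_truncWeight]
  exact EvalsTo.prod _ fun i _ => evalsTo_factor w hw i hq

lemma hasSum_pow_succ_mul {x : ℂ} (hx : ‖x‖ < 1) : 1 + ∑' j : ℕ, x ^ (j + 1) = (1 - x)⁻¹ := by
  rw [← tsum_geometric_of_norm_lt_one hx,
    (summable_geometric_of_norm_lt_one hx).tsum_eq_zero_add, pow_zero]

lemma norm_pow_succ_lt_one {q : ℂ} (hq : ‖q‖ < 1) (i : ℕ) : ‖q ^ (i + 1)‖ < 1 := by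
  rw [norm_pow]
  exact pow_lt_one₀ (norm_nonneg _) hq (by simp)

/-- The first K terms are bounded by the generating function of partitions into parts at most K,
which is 1/∏_{i ≤ K} (1 - r^i). These products converge to a nonzero limit, so the bound is uniform
in K. This series dominates all later sums over partitions. -/
lemma summable_card_partition {r : ℝ} (h0 : 0 ≤ r) (h1 : r < 1) :
    Summable fun n : ℕ => (Fintype.card n.Partition : ℝ) * r ^ n := by
  have hq : ‖(r : ℂ)‖ < 1 := by simpa [abs_of_nonneg h0]
  have hs : Summable fun i : ℕ => ‖-(r : ℂ) ^ (i + 1)‖ := by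
    simpa [abs_of_nonneg h0] using (summable_nat_add_iff 1).mpr (summable_geometric_of_lt_one h0 h1)
  have hm : Multipliable fun i : ℕ => (1 + -(r : ℂ) ^ (i + 1)) :=
    multipliable_one_add_of_summable hs
  have hne : ∏' i : ℕ, (1 + -(r : ℂ) ^ (i + 1)) ≠ 0 := by
    refine tprod_one_add_ne_zero_of_summable (fun i h => ?_) hs
    have h2 := norm_pow_succ_lt_one hq i
    rw [← sub_eq_add_neg, sub_eq_zero] at h
    rw [← h, norm_one] at h2
    exact lt_irrefl _ h2
  have ht := (hm.hasProd.tendsto_prod_nat.inv₀ hne).norm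
  obtain ⟨B, hB⟩ := ht.bddAbove_range
  refine summable_of_sum_range_le (c := B) (fun n => by positivity) fun K => ?_
  refine le_trans ?_ (hB ⟨K, rfl⟩)
  have hev := evalsTo_genFun_truncWeight (fun _ _ => 1) (by simp) K hq
  have hprod : (∏ i ∈ Finset.range K, (1 + ∑' j : ℕ, (1 : ℂ) * (r : ℂ) ^ ((i + 1) * (j + 1)))) =
      (∏ i ∈ Finset.range K, (1 + -(r : ℂ) ^ (i + 1)))⁻¹ := by
    rw [← Finset.prod_inv_distrib]
    refine Finset.prod_congr rfl fun i _ => ?_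
    rw [← sub_eq_add_neg, ← hasSum_pow_succ_mul (norm_pow_succ_lt_one hq i)]
    simp [pow_mul]
  rw [hprod] at hev
  have hcoef : ∀ n, ((genFun (truncWeight (fun _ _ => 1) K)).coeff n * (r : ℂ) ^ n) =
      (((∑ P : n.Partition, ∏ i ∈ P.parts.toFinset, if i ≤ K then (1 : ℝ) else 0) * r ^ n : ℝ) : ℂ) := by
    intro n
    rw [coeff_genFun]
    push_cast
    congr 1
    refine Finset.sum_congr rfl fun P _ => ?_
    rw [Finsupp.prod]
    simp only [truncWeight, Multiset.toFinsupp_support]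
    exact Finset.prod_congr rfl fun i _ => by split_ifs <;> simp
  unfold EvalsTo at hev
  simp_rw [hcoef] at hev
  have hre := Complex.hasSum_re hev
  simp only [Complex.ofReal_re] at hre
  have hpos : ∀ n, 0 ≤ (∑ P : n.Partition, ∏ i ∈ P.parts.toFinset, if i ≤ K then (1 : ℝ) else 0) *
      r ^ n := fun n => mul_nonneg (Finset.sum_nonneg fun P _ => Finset.prod_nonneg fun i _ => by
        split_ifs <;> norm_num) (by positivity)
  calc ∑ n ∈ Finset.range K, (Fintype.card n.Partition : ℝ) * r ^ n
      = ∑ n ∈ Finset.range K, (∑ P : n.Partition, ∏ i ∈ P.parts.toFinset,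
          if i ≤ K then (1 : ℝ) else 0) * r ^ n := by
        refine Finset.sum_congr rfl fun n hn => ?_
        congr 1
        rw [← Finset.card_univ, ← nsmul_one, ← Finset.sum_const]
        refine Finset.sum_congr rfl fun P _ => (Finset.prod_eq_one fun i hi => ?_).symm
        have := Multiset.le_sum_of_mem (Multiset.mem_toFinset.mp hi)
        rw [P.parts_sum] at this
        rw [if_pos (this.trans (Finset.mem_range.mp hn).le)]
    _ ≤ _ := sum_le_hasSum _ (fun n _ => hpos n) hre
    _ ≤ _ := (Complex.re_le_norm _)
    _ = _ := by rw [norm_inv]; simp [norm_inv]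

/-- Generating function of a multiplicative weight on partitions. -/
theorem hasProd_evalsTo_genFun (w : ℕ → ℕ → ℂ) (hw : ∀ i c, ‖w i c‖ ≤ 1) {q v : ℂ} (hq : ‖q‖ < 1)
    (hv : Filter.Tendsto (fun K => ∏ i ∈ Finset.range K,
      (1 + ∑' j, w (i + 1) (j + 1) * q ^ ((i + 1) * (j + 1)))) Filter.atTop (nhds v)) :
    EvalsTo (genFun w) q v := by
  have hsum := summable_card_partition (norm_nonneg q) hq
  have hb : ∀ (w' : ℕ → ℕ → ℂ), (∀ i c, ‖w' i c‖ ≤ 1) → ∀ n,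
      ‖(genFun w').coeff n * q ^ n‖ ≤ (Fintype.card n.Partition : ℝ) * ‖q‖ ^ n := by
    intro w' hw' n
    rw [norm_mul, norm_pow]
    gcongr
    exact norm_coeff_genFun_le w' hw' n
  have htr : ∀ K i c, ‖truncWeight w K i c‖ ≤ 1 := by
    intro K i c
    unfold truncWeight
    split_ifs
    · exact hw i c
    · simp
  -- The n-th coefficient no longer changes once K ≥ n, and every truncation is dominated by the
  -- partition series, so the limit in K passes through the sum.
  have hlim := tendsto_tsum_of_dominated_convergence (𝓕 := Filter.atTop)
    (f := fun (K n : ℕ) => (genFun (truncWeight w K)).coeff n * q ^ n)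
    (g := fun n => (genFun w).coeff n * q ^ n) hsum (fun n => by
      refine tendsto_const_nhds.congr' ?_
      filter_upwards [Filter.eventually_ge_atTop n] with K hK
      rw [coeff_genFun_truncWeight w hK]) (Filter.Eventually.of_forall fun K n => hb _ (htr K) n)
  have heq : ∀ K, ∑' n, (genFun (truncWeight w K)).coeff n * q ^ n = _ := fun K =>
    (evalsTo_genFun_truncWeight w hw K hq).tsum_eq
  simp_rw [heq] at hlim
  have := tendsto_nhds_unique hlim hv
  unfold EvalsTo
  rw [← this]
  exact (Summable.of_norm_bounded hsum (hb w hw)).hasSum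

end PartitionSums

/-! ### q-Pochhammer symbols and the q-binomial theorem -/

section Pochhammer

/-- The infinite `q`-Pochhammer symbol `(a; q)_∞`. -/
noncomputable def qinf (a q : ℂ) : ℂ := ∏' n : ℕ, (1 - a * q ^ n)

/-- The finite `q`-Pochhammer symbol `(a; q)_n`. -/
noncomputable def qfin (a q : ℂ) (n : ℕ) : ℂ := ∏ i ∈ Finset.range n, (1 - a * q ^ i)

variable {q : ℂ}

lemma qfin_zero (a q : ℂ) : qfin a q 0 = 1 := by simp [qfin]

lemma qfin_succ (a q : ℂ) (n : ℕ) : qfin a q (n + 1) = qfin a q n * (1 - a * q ^ n) :=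
  Finset.prod_range_succ _ _

lemma qfin_succ' (a q : ℂ) (n : ℕ) : qfin a q (n + 1) = (1 - a) * qfin (a * q) q n := by
  simp only [qfin, Finset.prod_range_succ', pow_zero, mul_one, pow_succ']
  rw [mul_comm]
  simp [mul_assoc]

lemma summable_norm_mul_pow (a : ℂ) (hq : ‖q‖ < 1) : Summable fun n : ℕ => ‖-(a * q ^ n)‖ := by
  simpa using (summable_geometric_of_lt_one (norm_nonneg _) hq).mul_left ‖a‖

lemma multipliable_qinf (a : ℂ) (hq : ‖q‖ < 1) : Multipliable fun n : ℕ => 1 - a * q ^ n := by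
  simpa [sub_eq_add_neg] using multipliable_one_add_of_summable (summable_norm_mul_pow a hq)

lemma tendsto_qfin (a : ℂ) (hq : ‖q‖ < 1) :
    Filter.Tendsto (qfin a q) Filter.atTop (nhds (qinf a q)) :=
  (multipliable_qinf a hq).hasProd.tendsto_prod_nat

lemma qinf_ne_zero {a : ℂ} (hq : ‖q‖ < 1) (h : ∀ n : ℕ, a * q ^ n ≠ 1) : qinf a q ≠ 0 := by
  have := tprod_one_add_ne_zero_of_summable (f := fun n : ℕ => -(a * q ^ n))
    (fun n hn => h n ?_) (summable_norm_mul_pow a hq)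
  · simpa [qinf, sub_eq_add_neg] using this
  · rw [← sub_eq_add_neg, sub_eq_zero] at hn
    exact hn.symm

lemma qinf_ne_zero_of_norm_lt {a : ℂ} (hq : ‖q‖ < 1) (ha : ‖a‖ < 1) : qinf a q ≠ 0 := by
  refine qinf_ne_zero hq fun n h => ?_
  have : ‖a * q ^ n‖ < 1 := by
    rw [norm_mul, norm_pow]
    calc _ ≤ ‖a‖ * 1 := by gcongr; exact pow_le_one₀ (norm_nonneg _) hq.le
      _ < 1 := by simpa
  rw [h, norm_one] at this
  exact lt_irrefl _ this

lemma qfin_ne_zero_of_norm_lt {a : ℂ} (hq : ‖q‖ < 1) (ha : ‖a‖ < 1) (n : ℕ) : qfin a q n ≠ 0 := by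
  refine Finset.prod_ne_zero_iff.mpr fun i _ h => ?_
  have : ‖a * q ^ i‖ < 1 := by
    rw [norm_mul, norm_pow]
    calc _ ≤ ‖a‖ * 1 := by gcongr; exact pow_le_one₀ (norm_nonneg _) hq.le
      _ < 1 := by simpa
  rw [sub_eq_zero] at h
  rw [← h, norm_one] at this
  exact lt_irrefl _ this

lemma qinf_eq_qfin_mul (a : ℂ) (hq : ‖q‖ < 1) (n : ℕ) :
    qinf a q = qfin a q n * qinf (a * q ^ n) q := by
  have h1 := (tendsto_qfin (a * q ^ n) hq).const_mul (qfin a q n)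
  have h2 := (tendsto_qfin a hq).comp (Filter.tendsto_add_atTop_nat n)
  refine tendsto_nhds_unique h2 (h1.congr fun k => ?_)
  simp only [Function.comp, qfin]
  rw [add_comm k n, Finset.prod_range_add]
  simp [pow_add, mul_assoc]

lemma qinf_succ (a : ℂ) (hq : ‖q‖ < 1) : qinf a q = (1 - a) * qinf (a * q) q := by
  simpa [qfin] using qinf_eq_qfin_mul a hq 1

lemma exists_norm_qfin_le (a : ℂ) (hq : ‖q‖ < 1) : ∃ B, ∀ n, ‖qfin a q n‖ ≤ B := by
  obtain ⟨B, hB⟩ := (tendsto_qfin a hq).norm.bddAbove_range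
  exact ⟨B, fun n => hB ⟨n, rfl⟩⟩

lemma exists_norm_inv_qfin_le {a : ℂ} (hq : ‖q‖ < 1) (ha : ‖a‖ < 1) :
    ∃ B, ∀ n, ‖(qfin a q n)⁻¹‖ ≤ B := by
  obtain ⟨B, hB⟩ := ((tendsto_qfin a hq).inv₀ (qinf_ne_zero_of_norm_lt hq ha)).norm.bddAbove_range
  exact ⟨B, fun n => hB ⟨n, rfl⟩⟩

/-- The `q`-binomial theorem. -/
theorem hasSum_qBinomial (a : ℂ) {t : ℂ} (hq : ‖q‖ < 1) (ht : ‖t‖ < 1) :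
    HasSum (fun n => qfin a q n / qfin q q n * t ^ n) (qinf (a * t) q / qinf t q) := by
  obtain ⟨B₁, hB₁⟩ := exists_norm_qfin_le a hq
  obtain ⟨B₂, hB₂⟩ := exists_norm_inv_qfin_le hq hq
  set c : ℕ → ℂ := fun n => qfin a q n / qfin q q n with hc
  have hB : ∀ n, ‖c n‖ ≤ B₁ * B₂ := fun n => by
    rw [hc]
    simp only [div_eq_mul_inv, norm_mul]
    exact mul_le_mul (hB₁ n) (hB₂ n) (norm_nonneg _) ((norm_nonneg _).trans (hB₁ 0))
  have hle : ∀ s : ℂ, ‖s‖ ≤ ‖t‖ → ∀ n, ‖c n * s ^ n‖ ≤ B₁ * B₂ * ‖t‖ ^ n := fun s hs n => by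
    rw [norm_mul, norm_pow]
    exact mul_le_mul (hB n) (pow_le_pow_left₀ (norm_nonneg _) hs n) (by positivity)
      ((norm_nonneg _).trans (hB 0))
  have hbs : Summable fun n => B₁ * B₂ * ‖t‖ ^ n :=
    (summable_geometric_of_lt_one (norm_nonneg _) ht).mul_left _
  have hS : ∀ s : ℂ, ‖s‖ ≤ ‖t‖ → Summable fun n => c n * s ^ n := fun s hs =>
    Summable.of_norm_bounded hbs (hle s hs)
  set S : ℂ → ℂ := fun s => ∑' n, c n * s ^ n with hSdef
  have hqn : ∀ n, ‖t * q ^ n‖ ≤ ‖t‖ := fun n => by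
    rw [norm_mul, norm_pow]
    exact mul_le_of_le_one_right (norm_nonneg _) (pow_le_one₀ (norm_nonneg _) hq.le)
  have hrec : ∀ n, c (n + 1) * (1 - q ^ (n + 1)) = c n * (1 - a * q ^ n) := fun n => by
    simp only [hc]
    have h1 := qfin_ne_zero_of_norm_lt hq hq n
    have h2 := qfin_ne_zero_of_norm_lt hq hq (n + 1)
    have h3 : (1 - q ^ (n + 1)) ≠ 0 := by
      rw [qfin_succ] at h2
      rw [pow_succ']
      exact right_ne_zero_of_mul h2
    rw [qfin_succ, qfin_succ q q, ← pow_succ']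
    field_simp
  -- The coefficient recursion is equivalent to this functional equation. Iterated n times it moves
  -- the argument to t q^n, where S tends to S(0) = 1.
  have hfe : ∀ s : ℂ, ‖s‖ ≤ ‖t‖ → (1 - s) * S s = (1 - a * s) * S (s * q) := fun s hs => by
    have hsq : ‖s * q‖ ≤ ‖t‖ := by
      rw [norm_mul]
      exact (mul_le_of_le_one_right (norm_nonneg _) hq.le).trans hs
    have h1 := (hS s hs).hasSum.sub (hS _ hsq).hasSum
    have h2 : HasSum (fun n => c (n + 1) * s ^ (n + 1) - c (n + 1) * (s * q) ^ (n + 1))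
        (S s - S (s * q)) := by
      have := (hasSum_nat_add_iff' 1).mpr h1
      simpa using this
    have h3 := ((hS s hs).hasSum.mul_left s).sub ((hS _ hsq).hasSum.mul_left (a * s))
    have h4 := h2.unique (h3.congr_fun ?_)
    · linear_combination h4
    · intro n
      have := hrec n
      rw [mul_pow, mul_pow]
      linear_combination s ^ (n + 1) * this
  have hit : ∀ n, qfin t q n * S t = qfin (a * t) q n * S (t * q ^ n) := fun n => by
    induction n with
    | zero => simp [qfin_zero]
    | succ n ih =>
      have h := hfe _ (hqn n)
      rw [qfin_succ, qfin_succ, pow_succ, ← mul_assoc t]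
      linear_combination (1 - t * q ^ n) * ih + qfin (a * t) q n * h
  have hlim : Filter.Tendsto (fun n => S (t * q ^ n)) Filter.atTop (nhds 1) := by
    have h0 : ∑' n, c n * (0 : ℂ) ^ n = 1 := by
      rw [tsum_eq_single 0]
      · simp [hc, qfin_zero]
      · intro n hn
        simp [hn]
    rw [← h0]
    refine tendsto_tsum_of_dominated_convergence hbs (fun k => ?_)
      (Filter.Eventually.of_forall fun n k => hle _ (hqn n) k)
    have : Filter.Tendsto (fun n => t * q ^ n) Filter.atTop (nhds 0) := by
      simpa using (tendsto_pow_atTop_nhds_zero_of_norm_lt_one hq).const_mul t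
    exact (this.pow k).const_mul _
  have hfin := tendsto_nhds_unique ((tendsto_qfin t hq).mul_const (S t))
    (((tendsto_qfin (a * t) hq).mul hlim).congr fun n => (hit n).symm)
  have : qinf (a * t) q / qinf t q = S t := by
    rw [div_eq_iff (qinf_ne_zero_of_norm_lt hq ht)]
    linear_combination -hfin
  rw [this]
  exact (hS t le_rfl).hasSum

end Pochhammer

/-! ### Summing over partitions by a statistic -/

section Fiber

lemma hasSum_of_eq {f g : ℕ → ℂ} {a b : ℂ} (h : HasSum f a) (hfg : ∀ n, g n = f n) (hab : b = a) :
    HasSum g b := by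
  rw [hab]
  exact h.congr_fun hfg

/-- The sum over all partitions of all integers converges absolutely, so it may be grouped by size
or by the value of κ. The common value is left existential: in each use it is identified afterwards
by summing T. -/
lemma hasSum_partition_fiber (κ : ∀ N : ℕ, N.Partition → ℕ) (f : ∀ N : ℕ, N.Partition → ℂ)
    (hf : ∀ N P, ‖f N P‖ ≤ 1) {q : ℂ} (hq : ‖q‖ < 1) (T : ℕ → ℂ)
    (hT : ∀ k, HasSum (fun N => (∑ P : N.Partition with κ N P = k, f N P) * q ^ N) (T k)) :
    ∃ v, HasSum T v ∧ HasSum (fun N => (∑ P : N.Partition, f N P) * q ^ N) v := by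
  have hc := summable_card_partition (norm_nonneg q) hq
  have key : ∀ g : (∀ N : ℕ, N.Partition → ℂ), (∀ N P, ‖g N P‖ ≤ 1) →
      Summable fun s : Σ N : ℕ, N.Partition => g s.1 s.2 * q ^ s.1 := by
    intro g hg
    refine Summable.of_norm ?_
    rw [summable_sigma_of_nonneg fun _ => norm_nonneg _]
    refine ⟨fun N => (hasSum_fintype _).summable, ?_⟩
    refine Summable.of_nonneg_of_le (fun N => tsum_nonneg fun _ => norm_nonneg _) (fun N => ?_) hc
    rw [tsum_fintype, ← Finset.card_univ, ← nsmul_one, ← Finset.sum_const, Finset.sum_mul]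
    refine Finset.sum_le_sum fun P _ => ?_
    rw [norm_mul, norm_pow]
    gcongr
    exact hg N P
  have key2 : ∀ g : (∀ N : ℕ, N.Partition → ℂ), (∀ N P, ‖g N P‖ ≤ 1) →
      HasSum (fun N => (∑ P : N.Partition, g N P) * q ^ N)
        (∑' s : Σ N : ℕ, N.Partition, g s.1 s.2 * q ^ s.1) := by
    intro g hg
    refine ((key g hg).hasSum.sigma fun N => hasSum_fintype _).congr_fun fun N => ?_
    rw [Finset.sum_mul]
  refine ⟨_, ?_, key2 f hf⟩
  have h1 := (key f hf).hasSum.tsum_fiberwise (fun s => κ s.1 s.2)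
  refine h1.congr_fun fun k => ?_
  have h2 := key2 (fun N P => if κ N P = k then f N P else 0) (fun N P => by
    split_ifs
    · exact hf N P
    · simp)
  simp_rw [← Finset.sum_filter] at h2
  rw [(hT k).unique h2, ← tsum_subtype_eq_of_support_subset (s := (fun s => κ s.1 s.2) ⁻¹' {k})]
  · refine tsum_congr fun s => ?_
    have : κ s.1.1 s.1.2 = k := s.2
    rw [if_pos this]
  · intro s hs
    by_contra h
    have h' : κ s.1 s.2 ≠ k := h
    simp [h'] at hs

end Fiber

/-! ### The crank generating function -/

section CrankGF

open PowerSeries Nat.Partition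

/-- The weight of a partition whose parts `i ≥ 2` have weight `u i` each and whose parts `1`
are weighted by their multiplicity. -/
def onesWeight (w₁ : ℕ → ℂ) (u : ℕ → ℂ) (i c : ℕ) : ℂ := if i = 1 then w₁ c else u i ^ c

lemma evalsTo_onesWeight {w₁ u : ℕ → ℂ} (hw₁ : ∀ c, ‖w₁ c‖ ≤ 1) (hu : ∀ i, ‖u i‖ ≤ 1) {q v : ℂ}
    (hq : ‖q‖ < 1) (hv : v ≠ 0)
    (h : Filter.Tendsto (fun K => ∏ i ∈ Finset.range K, (1 - u (i + 2) * q ^ (i + 2)))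
      Filter.atTop (nhds v)) :
    EvalsTo (genFun (onesWeight w₁ u)) q ((1 + ∑' c, w₁ (c + 1) * q ^ (c + 1)) / v) := by
  refine hasProd_evalsTo_genFun _ (fun i c => ?_) hq ?_
  · unfold onesWeight
    split_ifs
    · exact hw₁ c
    · rw [norm_pow]
      exact pow_le_one₀ (norm_nonneg _) (hu i)
  · rw [← Filter.tendsto_add_atTop_iff_nat 1]
    refine ((h.inv₀ hv).const_mul (1 + ∑' c, w₁ (c + 1) * q ^ (c + 1))).congr fun K => ?_
    rw [Finset.prod_range_succ', mul_comm]
    congr 1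
    · rw [← Finset.prod_inv_distrib]
      refine Finset.prod_congr rfl fun i _ => ?_
      rw [← hasSum_pow_succ_mul]
      · simp [onesWeight, mul_pow, pow_mul]
      · rw [norm_mul]
        calc _ ≤ 1 * ‖q ^ (i + 2)‖ := by gcongr; exact hu _
          _ < 1 := by rw [one_mul]; exact norm_pow_succ_lt_one hq (i + 1)
    · simp [onesWeight]

lemma prod_ite_eq_pow_countP (x : ℂ) (j : ℕ) (s : Multiset ℕ) :
    ∏ i ∈ s.toFinset, (if i ≤ j then (1 : ℂ) else x) ^ s.count i =
      x ^ s.countP (fun i => j < i) := by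
  rw [← Finset.prod_multiset_map_count]
  induction s using Multiset.induction_on with
  | empty => simp
  | cons a s ih =>
    rw [Multiset.map_cons, Multiset.prod_cons, ih]
    by_cases h : j < a
    · rw [if_neg (not_le.mpr h), Multiset.countP_cons_of_pos _ h, pow_succ']
    · rw [if_pos (not_lt.mp h), Multiset.countP_cons_of_neg _ h, one_mul]

/-- A multiplicative weight sees only parts that occur, so it cannot exclude partitions without
ones; they survive with a weight independent of b. Subtracting the case b = 0 from b = 1 isolates
the partitions with exactly j ones. -/
lemma prod_onesWeight_ones {n : ℕ} (P : n.Partition) (x b : ℂ) {j : ℕ} (hj : 1 ≤ j) :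
    P.parts.toFinsupp.prod
      (onesWeight (fun c => if c = j then b else 0) (fun i => if i ≤ j then 1 else x)) =
    if P.parts.count 1 = j then b * x ^ P.parts.countP (fun i => j < i)
    else if P.parts.count 1 = 0 then x ^ P.parts.countP (fun i => j < i) else 0 := by
  rw [Finsupp.prod, ← prod_ite_eq_pow_countP]
  simp only [Multiset.toFinsupp_support, Multiset.toFinsupp_apply]
  by_cases h1 : 1 ∈ P.parts
  · have h1' : 1 ∈ P.parts.toFinset := Multiset.mem_toFinset.mpr h1
    have h0 : P.parts.count 1 ≠ 0 := Multiset.count_ne_zero.mpr h1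
    rw [← Finset.mul_prod_erase _ _ h1', ← Finset.mul_prod_erase _ (fun i => (if i ≤ j then (1 : ℂ)
      else x) ^ P.parts.count i) h1', if_neg h0]
    rw [Finset.prod_congr (g := fun i => (if i ≤ j then (1 : ℂ) else x) ^ P.parts.count i) rfl]
    · simp only [onesWeight, if_true, if_pos hj, one_pow, one_mul]
      split_ifs <;> simp
    · intro i hi
      simp [onesWeight, Finset.ne_of_mem_erase hi]
  · have h0 : P.parts.count 1 = 0 := Multiset.count_eq_zero.mpr h1
    rw [if_neg (by omega), if_pos h0]
    refine Finset.prod_congr rfl fun i hi => ?_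
    have : i ≠ 1 := fun h => h1 (h ▸ Multiset.mem_toFinset.mp hi)
    simp [onesWeight, this]

lemma prod_onesWeight_bounded {n : ℕ} (P : n.Partition) (L : ℕ) :
    P.parts.toFinsupp.prod (onesWeight (fun _ => 0) (fun i => if i ≤ L then 1 else 0)) =
    if P.parts.count 1 = 0 ∧ P.parts.sup ≤ L then 1 else 0 := by
  rw [Finsupp.prod]
  simp only [Multiset.toFinsupp_support, Multiset.toFinsupp_apply]
  split_ifs with h
  · refine Finset.prod_eq_one fun i hi => ?_
    have hi' := Multiset.mem_toFinset.mp hi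
    have h1 : i ≠ 1 := fun h' => Multiset.count_ne_zero.mpr (h' ▸ hi') h.1
    have h2 : i ≤ L := Multiset.sup_le.mp h.2 i hi'
    simp [onesWeight, h1, h2]
  · rw [not_and_or] at h
    rcases h with h | h
    · refine Finset.prod_eq_zero (i := 1) (Multiset.mem_toFinset.mpr
        (Multiset.count_ne_zero.mp h)) (by simp [onesWeight])
    · rw [Multiset.sup_le] at h
      push Not at h
      obtain ⟨i, hi, hL⟩ := h
      refine Finset.prod_eq_zero (Multiset.mem_toFinset.mpr hi) ?_
      have : P.parts.count i ≠ 0 := Multiset.count_ne_zero.mpr hi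
      simp [onesWeight, not_le.mpr hL, this]

variable {q x : ℂ}

/-- Partitions with exactly `j ≥ 1` ones. -/
lemma hasSum_crank_ones (hq : ‖q‖ < 1) (hx : ‖x‖ = 1) {j : ℕ} (hj : 1 ≤ j) :
    HasSum (fun N => (∑ P : N.Partition with P.parts.count 1 = j, x ^ crank P) * q ^ N)
      ((x⁻¹ * q) ^ j / (qfin (q ^ 2) q (j - 1) * qinf (x * q ^ (j + 1)) q)) := by
  have hx0 : x ≠ 0 := by
    rintro rfl
    simp at hx
  set u : ℕ → ℂ := fun i => if i ≤ j then 1 else x with hu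
  have hu1 : ∀ i, ‖u i‖ ≤ 1 := fun i => by
    rw [hu]
    dsimp only
    split_ifs
    · simp
    · exact hx.le
  have hxq : ‖x * q ^ (j + 1)‖ < 1 := by
    rw [norm_mul, hx, one_mul]
    exact norm_pow_succ_lt_one hq j
  have hv : qfin (q ^ 2) q (j - 1) * qinf (x * q ^ (j + 1)) q ≠ 0 :=
    mul_ne_zero (qfin_ne_zero_of_norm_lt hq (norm_pow_succ_lt_one hq 1) _)
      (qinf_ne_zero_of_norm_lt hq hxq)
  have hlim : Filter.Tendsto (fun K => ∏ i ∈ Finset.range K, (1 - u (i + 2) * q ^ (i + 2)))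
      Filter.atTop (nhds (qfin (q ^ 2) q (j - 1) * qinf (x * q ^ (j + 1)) q)) := by
    rw [← Filter.tendsto_add_atTop_iff_nat (j - 1)]
    refine ((tendsto_qfin (x * q ^ (j + 1)) hq).const_mul _).congr fun K => ?_
    rw [add_comm K, Finset.prod_range_add]
    congr 1
    · refine Finset.prod_congr rfl fun i hi => ?_
      have : i + 2 ≤ j := by have := Finset.mem_range.mp hi; omega
      simp only [hu, if_pos this]
      ring
    · refine Finset.prod_congr rfl fun i hi => ?_
      have : ¬ (j - 1 + i + 2 ≤ j) := by omega
      have h2 : j - 1 + i + 2 = j + 1 + i := by omega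
      simp only [hu, if_neg this]
      rw [h2]
      ring
  have hE : ∀ b : ℂ, ‖b‖ ≤ 1 → EvalsTo (genFun (onesWeight (fun c => if c = j then b else 0) u)) q
      ((1 + b * q ^ j) / (qfin (q ^ 2) q (j - 1) * qinf (x * q ^ (j + 1)) q)) := fun b hb => by
    have := evalsTo_onesWeight (w₁ := fun c => if c = j then b else 0) (u := u) (fun c => by
      split_ifs
      · exact hb
      · simp) hu1 hq hv hlim
    have h2 : ∑' c, (if c + 1 = j then b else 0) * q ^ (c + 1) = b * q ^ j := by
      rw [tsum_eq_single (j - 1)]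
      · rw [if_pos (by omega), Nat.sub_add_cancel hj]
      · intro c hc
        rw [if_neg (by omega), zero_mul]
    rwa [h2] at this
  have hd := ((hE 1 (by simp)).sub (hE 0 (by simp)))
  have hd2 := HasSum.mul_left (x⁻¹ ^ j) hd
  refine hasSum_of_eq hd2 (fun N => ?_) ?_
  · rw [map_sub, coeff_genFun, coeff_genFun, ← Finset.sum_sub_distrib, Finset.sum_filter, ← mul_assoc,
      Finset.mul_sum]
    congr 1
    refine Finset.sum_congr rfl fun P _ => ?_
    rw [prod_onesWeight_ones P x 1 hj, prod_onesWeight_ones P x 0 hj]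
    split_ifs with h1 h2
    · rw [crank, if_neg (by omega), h1, zpow_sub₀ hx0]
      simp only [zpow_natCast]
      rw [one_mul, zero_mul, sub_zero, inv_pow]
      field_simp
    · simp
    · simp
  · rw [mul_pow]
    ring

/-- Partitions without ones. -/
lemma hasSum_crank_no_ones (hq : ‖q‖ < 1) (hx : ‖x‖ = 1) :
    HasSum (fun N => (∑ P : N.Partition with P.parts.count 1 = 0, x ^ crank P) * q ^ N)
      ((1 - q) / qinf (x * q) q + q - x * q) := by
  have hxq : ‖x * q‖ < 1 := by rwa [norm_mul, hx, one_mul]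
  have hx0 : x ≠ 0 := by
    rintro rfl
    simp at hx
  have hq2 : ∀ n, qfin (q ^ 2) q n ≠ 0 := qfin_ne_zero_of_norm_lt hq (norm_pow_succ_lt_one hq 1)
  have hlim : ∀ L : ℕ, Filter.Tendsto (fun K => ∏ i ∈ Finset.range K,
      (1 - (if i + 2 ≤ L then 1 else 0) * q ^ (i + 2)))
      Filter.atTop (nhds (qfin (q ^ 2) q (L - 1))) := fun L => by
    refine tendsto_const_nhds.congr' ?_
    filter_upwards [Filter.eventually_ge_atTop (L - 1)] with K hK
    obtain ⟨M, rfl⟩ := Nat.exists_eq_add_of_le hK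
    rw [Finset.prod_range_add]
    symm
    convert mul_one _ using 2
    · refine Finset.prod_eq_one fun i _ => ?_
      rw [if_neg (by omega)]
      simp
    · refine Finset.prod_congr rfl fun i hi => ?_
      have : i + 2 ≤ L := by have := Finset.mem_range.mp hi; omega
      simp only [if_pos this]
      ring
  have hE : ∀ L : ℕ, EvalsTo (genFun (onesWeight (fun _ => 0) (fun i => if i ≤ L then 1 else 0))) q
      (1 / qfin (q ^ 2) q (L - 1)) := fun L => by
    have := evalsTo_onesWeight (w₁ := fun _ => 0) (u := fun i => if i ≤ L then 1 else 0)
      (fun c => by simp) (fun i => by split_ifs <;> simp) hq (hq2 _) (hlim L)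
    simpa using this
  set G : ℕ → PowerSeries ℂ := fun L =>
    genFun (onesWeight (fun _ => 0) (fun i => if i ≤ L then 1 else 0)) with hG
  -- Here the crank is the largest part L, so its contribution is a difference of generating
  -- functions for parts bounded by L and by L - 1. Truncated subtraction gives T 1 = 0, as it must:
  -- without ones the largest part is never 1.
  set T : ℕ → ℂ := fun L => if L = 0 then 1 else
    x ^ L * (1 / qfin (q ^ 2) q (L - 1) - 1 / qfin (q ^ 2) q (L - 2)) with hTdef
  have hGc : ∀ L N, (G L).coeff N = ∑ P : N.Partition,
      if P.parts.count 1 = 0 ∧ P.parts.sup ≤ L then (1 : ℂ) else 0 := fun L N => by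
    rw [hG, coeff_genFun]
    exact Finset.sum_congr rfl fun P _ => prod_onesWeight_bounded P L
  have hT : ∀ L, HasSum (fun N => (∑ P : N.Partition with P.parts.sup = L,
      if P.parts.count 1 = 0 then x ^ crank P else 0) * q ^ N) (T L) := by
    intro L
    rcases L with _ | L
    · have h0 := hE 0
      simp only [Nat.zero_sub, qfin_zero, div_one] at h0
      simp only [hTdef, if_true]
      refine HasSum.congr_fun h0 fun N => ?_
      rw [hGc, Finset.sum_filter]
      congr 1
      refine Finset.sum_congr rfl fun P _ => ?_
      by_cases h1 : P.parts.sup = 0 <;> by_cases h2 : P.parts.count 1 = 0 <;>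
        simp [h1, h2, crank]
    · have h0 := HasSum.mul_left (x ^ (L + 1)) ((hE (L + 1)).sub (hE L))
      simp only [hTdef, Nat.add_eq_zero_iff, one_ne_zero, and_false, if_false]
      refine HasSum.congr_fun h0 fun N => ?_
      rw [map_sub, hGc, hGc, Finset.sum_filter, ← Finset.sum_sub_distrib, ← mul_assoc,
        Finset.mul_sum]
      congr 1
      refine Finset.sum_congr rfl fun P _ => ?_
      by_cases h2 : P.parts.count 1 = 0
      · rcases lt_trichotomy P.parts.sup (L + 1) with h | h | h
        · simp [h2, h.ne, h.le, Nat.lt_succ_iff.mp h]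
        · simp [h2, h, crank]
          norm_cast
        · have h3 : ¬ P.parts.sup ≤ L := by omega
          simp [h2, h.ne', not_le.mpr h, h3]
      · simp [h2]
  obtain ⟨v, hv1, hv2⟩ := hasSum_partition_fiber (fun N P => P.parts.sup)
    (fun N P => if P.parts.count 1 = 0 then x ^ crank P else 0) (fun N P => by
      split_ifs
      · simp [hx]
      · simp) hq T hT
  simp_rw [← Finset.sum_filter] at hv2
  convert hv2 using 1
  refine HasSum.unique ?_ hv1
  -- Euler's expansion of 1/(xq; q)_∞. From index 2 on, T agrees with (1 - q) times its terms; the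
  -- first two terms differ and account for the correction q - xq.
  have hEu := hasSum_qBinomial 0 hq hxq
  simp only [zero_mul] at hEu
  have h1q : (1 - q) ≠ 0 := by
    intro h
    rw [sub_eq_zero] at h
    rw [← h, norm_one] at hq
    exact lt_irrefl _ hq
  have hone : qinf 0 q = 1 := by simp [qinf]
  have hfone : ∀ n, qfin 0 q n = 1 := fun n => by simp [qfin]
  rw [hone] at hEu
  simp_rw [hfone] at hEu
  have hEu2 := (hasSum_nat_add_iff' 2).mpr (hEu.mul_left (1 - q))
  rw [← hasSum_nat_add_iff' 2]
  refine hasSum_of_eq hEu2 (fun n => ?_) ?_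
  · have e1 : qfin q q (n + 2) = (1 - q) * qfin (q ^ 2) q (n + 1) := by
      rw [qfin_succ', ← sq]
    have e2 : qfin (q ^ 2) q (n + 1) = qfin (q ^ 2) q n * (1 - q ^ (n + 2)) := by
      rw [qfin_succ]; ring
    have h3 := hq2 (n + 1)
    have h4 := hq2 n
    simp only [hTdef, Nat.add_eq_zero_iff, OfNat.ofNat_ne_zero, and_false, if_false,
      Nat.add_sub_cancel, show n + 2 - 1 = n + 1 by omega]
    rw [e1]
    rw [e2] at h3 ⊢
    have h5 := right_ne_zero_of_mul h3
    field_simp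
    ring
  · simp [Finset.sum_range_succ, hTdef, qfin]
    field_simp
    ring

/-- The crank generating function of Andrews and Garvan (without the convention at `n = 1`). -/
theorem hasSum_crank (hq : ‖q‖ < 1) (hx : ‖x‖ = 1) :
    HasSum (fun N => (∑ P : N.Partition, x ^ crank P) * q ^ N)
      (qinf q q / (qinf (x * q) q * qinf (x⁻¹ * q) q) + q - x * q) := by
  have hxq : ‖x * q‖ < 1 := by rwa [norm_mul, hx, one_mul]
  have hxq' : ‖x⁻¹ * q‖ < 1 := by rwa [norm_mul, norm_inv, hx, inv_one, one_mul]
  have hx0 : x ≠ 0 := by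
    rintro rfl
    simp at hx
  have hn1 := qinf_ne_zero_of_norm_lt hq hxq
  have hn2 := qinf_ne_zero_of_norm_lt hq hxq'
  set T : ℕ → ℂ := fun j => if j = 0 then (1 - q) / qinf (x * q) q + q - x * q else
    (x⁻¹ * q) ^ j / (qfin (q ^ 2) q (j - 1) * qinf (x * q ^ (j + 1)) q) with hTdef
  obtain ⟨v, hv1, hv2⟩ := hasSum_partition_fiber (fun N P => P.parts.count 1)
    (fun N P => x ^ crank P) (fun N P => by simp [hx]) hq T (fun j => by
      rcases j with _ | j
      · exact hasSum_crank_no_ones hq hx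
      · exact hasSum_crank_ones hq hx (by omega))
  convert hv2 using 1
  refine HasSum.unique ?_ hv1
  -- The sum over the number j of ones is the q-binomial series with a = xq and t = x⁻¹q. Its term j
  -- = 0 is the generating function without ones, up to the correction q - xq.
  have hB := (hasSum_qBinomial (x * q) hq hxq').mul_left ((1 - q) / qinf (x * q) q)
  rw [show x * q * (x⁻¹ * q) = q * q by field_simp] at hB
  rw [← hasSum_nat_add_iff' 1]
  refine hasSum_of_eq ((hasSum_nat_add_iff' 1).mpr hB) (fun n => ?_) ?_
  · simp only [hTdef, Nat.add_eq_zero_iff, one_ne_zero, and_false, if_false, Nat.add_sub_cancel]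
    have h1 := qinf_eq_qfin_mul (x * q) hq (n + 1)
    rw [show x * q * q ^ (n + 1) = x * q ^ (n + 1 + 1) by ring] at h1
    have h2 : qfin q q (n + 1) = (1 - q) * qfin (q ^ 2) q n := by
      rw [qfin_succ', ← sq]
    have h3 := qfin_ne_zero_of_norm_lt hq hq (n + 1)
    rw [h1] at hn1 ⊢
    rw [h2] at h3 ⊢
    have h4 := left_ne_zero_of_mul hn1
    have h5 := right_ne_zero_of_mul hn1
    have h6 := left_ne_zero_of_mul h3
    have h7 := right_ne_zero_of_mul h3
    field_simp
  · rw [qinf_succ q hq]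
    simp [hTdef, qfin]
    field_simp

end CrankGF

/-! ### Crank counts in residue classes at a root of unity -/

section CrankCount

lemma card_parts_le {n : ℕ} (P : n.Partition) : P.parts.card ≤ n := by
  conv_rhs => rw [← P.parts_sum]
  have := Multiset.card_nsmul_le_sum (s := P.parts) (a := 1) fun x hx => P.parts_pos hx
  simpa using this

lemma crank_mem_Icc {n : ℕ} (P : n.Partition) : crank P ∈ Finset.Icc (-(n : ℤ)) n := by
  have h1 := card_parts_le P
  have h2 := Multiset.count_le_card 1 P.parts
  have h3 := Multiset.countP_le_card (p := fun x => P.parts.count 1 < x) P.parts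
  have h4 : P.parts.sup ≤ n := Multiset.sup_le.mpr fun i hi => by
    have := Multiset.le_sum_of_mem hi
    rwa [P.parts_sum] at this
  rw [Finset.mem_Icc, crank]
  split_ifs
  · omega
  · omega

lemma crank_partition_one (P : Nat.Partition 1) : crank P = -1 := by
  have : P = Nat.Partition.indiscrete 1 := Subsingleton.elim _ _
  subst this
  decide

variable {ω : ℂ}

/-- At N = 1 the convention gives ω - 1 + ω⁻¹ where the only partition has crank -1. The excess ω -
1 is exactly what cancels the term q - ωq in `hasSum_crank`. -/
lemma sum_crankCount (ω : ℂ) (N : ℕ) :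
    ∑ m ∈ Finset.Icc (-(N : ℤ)) N, (crankCount m N : ℂ) * ω ^ m =
      ∑ P : N.Partition, ω ^ crank P + if N = 1 then ω - 1 else 0 := by
  by_cases hN : N = 1
  · subst hN
    have : Finset.Icc (-((1 : ℕ) : ℤ)) (1 : ℕ) = {-1, 0, 1} := by decide
    rw [this]
    simp [crankCount, crank_partition_one]
    ring
  · simp only [crankCount, if_neg hN, add_zero]
    rw [← Finset.sum_fiberwise_of_maps_to (fun P _ => crank_mem_Icc P)]
    refine Finset.sum_congr rfl fun m _ => ?_
    rw [Finset.sum_congr rfl (g := fun _ => ω ^ m) fun P hP => by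
      rw [(Finset.mem_filter.mp hP).2]]
    simp

lemma sum_crankCountMod {p : ℕ} (hp : p ≠ 0) (hω : ω ^ p = 1) (N : ℕ) :
    ∑ k ∈ Finset.range p, (crankCountMod k p N : ℂ) * ω ^ k =
      ∑ P : N.Partition, ω ^ crank P + if N = 1 then ω - 1 else 0 := by
  have hω0 : ω ≠ 0 := by
    rintro rfl
    simp [hp] at hω
  have hp' : (0 : ℤ) < p := by omega
  rw [← sum_crankCount ω]
  simp only [crankCountMod, Finset.sum_filter]
  push_cast
  simp_rw [Finset.sum_mul]
  rw [Finset.sum_comm]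
  refine Finset.sum_congr rfl fun m _ => ?_
  have hr0 := Int.emod_nonneg m hp'.ne'
  have hr1 := Int.emod_lt_of_pos m hp'
  rw [Finset.sum_eq_single (m % p).toNat]
  · rw [if_pos]
    · congr 1
      conv_rhs => rw [← Int.emod_add_mul_ediv m p, zpow_add₀ hω0, zpow_mul]
      simp only [zpow_natCast, hω, one_zpow, mul_one]
      conv_rhs => rw [← Int.toNat_of_nonneg hr0, zpow_natCast]
    · rw [Int.toNat_of_nonneg hr0]
      exact (Int.mod_modEq m p).symm
  · intro k hk hne
    rw [if_neg, zero_mul]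
    intro h
    apply hne
    have h' : m % p = (k : ℤ) % p := h
    have hk' := Finset.mem_range.mp hk
    have hk2 : (k : ℤ) % p = k := Int.emod_eq_of_lt (by omega) (by omega)
    rw [hk2] at h'
    omega
  · intro h
    exact absurd (Finset.mem_range.mpr (by omega)) h

/-- The generating function of the crank counts at a root of unity. -/
theorem hasSum_crankCountMod {p : ℕ} (hp : p ≠ 0) (hω : ω ^ p = 1) {q : ℂ} (hq : ‖q‖ < 1) :
    HasSum (fun N => (∑ k ∈ Finset.range p, (crankCountMod k p N : ℂ) * ω ^ k) * q ^ N)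
      (qinf q q / (qinf (ω * q) q * qinf (ω⁻¹ * q) q)) := by
  have hx : ‖ω‖ = 1 := Complex.norm_eq_one_of_pow_eq_one hω hp
  have h1 := hasSum_crank hq hx
  have h2 : HasSum (fun N : ℕ => (if N = 1 then ω - 1 else 0) * q ^ N) ((ω - 1) * q) := by
    convert hasSum_single 1 _ using 1
    · simp
    · intro n hn
      simp [hn]
  refine hasSum_of_eq (h1.add h2) (fun N => ?_) (by ring)
  rw [sum_crankCountMod hp hω]
  ring

end CrankCount

/-! ### The Jacobi triple product -/

section TripleProduct

open Complex

/-- The Gaussian binomial coefficient at `q`, for `q` not a root of unity. -/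
noncomputable def qbinom (q : ℂ) (N k : ℕ) : ℂ :=
  if k ≤ N then qfin q q N / (qfin q q k * qfin q q (N - k)) else 0

variable {q : ℂ}

lemma qbinom_zero (hq : ‖q‖ < 1) (N : ℕ) : qbinom q N 0 = 1 := by
  have := qfin_ne_zero_of_norm_lt hq hq N
  simp [qbinom, qfin_zero, this]

lemma qbinom_succ (hq : ‖q‖ < 1) (N k : ℕ) :
    qbinom q (N + 1) (k + 1) = qbinom q N (k + 1) + q ^ (N - k) * qbinom q N k := by
  have hne := qfin_ne_zero_of_norm_lt hq hq
  rcases lt_trichotomy k N with h | h | h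
  · obtain ⟨d, rfl⟩ := Nat.exists_eq_add_of_lt h
    rw [qbinom, qbinom, qbinom, if_pos (by omega), if_pos (by omega), if_pos (by omega),
      show k + d + 1 + 1 - (k + 1) = d + 1 by omega, show k + d + 1 - (k + 1) = d by omega,
      show k + d + 1 - k = d + 1 by omega, qfin_succ q q (k + d + 1)]
    have h1 := hne (k + d + 1)
    have h2 := hne k
    have h3 := hne d
    have h4 := hne (k + 1)
    have h5 := hne (d + 1)
    rw [qfin_succ q q k] at h4 ⊢
    rw [qfin_succ q q d] at h5 ⊢
    have h6 := right_ne_zero_of_mul h4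
    have h7 := right_ne_zero_of_mul h5
    field_simp
    ring
  · subst h
    have h1 := hne k
    have h2 := hne (k + 1)
    simp [qbinom, qfin_zero, h1, h2]
  · simp [qbinom, show ¬ k + 1 ≤ N + 1 by omega, show ¬ k + 1 ≤ N by omega, show ¬ k ≤ N by omega]

/-- The finite `q`-binomial theorem. -/
lemma qfin_eq_sum_qbinom (hq : ‖q‖ < 1) (y : ℂ) (N : ℕ) :
    qfin y q N = ∑ k ∈ Finset.range (N + 1), (-1) ^ k * q ^ (k.choose 2) * y ^ k * qbinom q N k := by
  induction N with
  | zero => simp [qfin_zero, qbinom_zero hq]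
  | succ N ih =>
    rw [Finset.sum_range_succ', qfin_succ, ih]
    simp only [qbinom_succ hq, mul_add, Finset.sum_add_distrib]
    have e1 : ∑ k ∈ Finset.range (N + 1), (-1) ^ (k + 1) * q ^ ((k + 1).choose 2) * y ^ (k + 1) *
        qbinom q N (k + 1) + (-1) ^ 0 * q ^ (Nat.choose 0 2) * y ^ 0 * qbinom q (N + 1) 0 =
        ∑ k ∈ Finset.range (N + 1), (-1) ^ k * q ^ (k.choose 2) * y ^ k * qbinom q N k := by
      rw [Finset.sum_range_succ, Finset.sum_range_succ' _ N, qbinom_zero hq, qbinom_zero hq]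
      simp [qbinom]
    have e2 : ∑ k ∈ Finset.range (N + 1), (-1) ^ (k + 1) * q ^ ((k + 1).choose 2) * y ^ (k + 1) *
        (q ^ (N - k) * qbinom q N k) = -(y * q ^ N) *
        ∑ k ∈ Finset.range (N + 1), (-1) ^ k * q ^ (k.choose 2) * y ^ k * qbinom q N k := by
      rw [Finset.mul_sum]
      refine Finset.sum_congr rfl fun k hk => ?_
      have hk' : k ≤ N := Nat.lt_succ_iff.mp (Finset.mem_range.mp hk)
      obtain ⟨d, rfl⟩ := Nat.exists_eq_add_of_le hk'
      rw [Nat.choose_succ_succ, Nat.choose_one_right, Nat.add_sub_cancel_left]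
      ring
    rw [add_right_comm, e1, e2]
    ring

lemma norm_exp_two_pi_I_mul_lt_one {τ : ℂ} (hτ : 0 < τ.im) :
    ‖exp (2 * Real.pi * I * τ)‖ < 1 :=
  UpperHalfPlane.norm_exp_two_pi_I_lt_one ⟨τ, hτ⟩

lemma neg_one_pow_eq_exp (k : ℕ) : (-1 : ℂ) ^ k = exp (Real.pi * I * k) := by
  rw [← exp_pi_mul_I, ← exp_nat_mul]
  ring_nf

/-- The finite q-binomial theorem with 2n factors at y = w q^{1-n}. The last n factors form (wq;
q)_n. The first n, read backwards, are 1 - w q^{-i}, and pulling out -w q^{-i} from each leaves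
(w⁻¹; q)_n and the monomial A = (-1)^n w^n q^{-n(n-1)/2}. -/
lemma finite_tripleProduct (z τ : ℂ) (hτ : 0 < τ.im) (n : ℕ) :
    qfin (exp (2 * Real.pi * I * z) * exp (2 * Real.pi * I * τ)) (exp (2 * Real.pi * I * τ)) n *
      qfin (exp (2 * Real.pi * I * z))⁻¹ (exp (2 * Real.pi * I * τ)) n =
    ∑ k ∈ Finset.range (2 * n + 1), jacobiTheta₂_term ((k : ℤ) - n) (z + 1 / 2 + τ / 2) τ *
      qbinom (exp (2 * Real.pi * I * τ)) (2 * n) k := by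
  set q := exp (2 * Real.pi * I * τ) with hqdef
  set w := exp (2 * Real.pi * I * z) with hwdef
  have hq : ‖q‖ < 1 := norm_exp_two_pi_I_mul_lt_one hτ
  set y := exp (2 * Real.pi * I * (z + (1 - n) * τ)) with hy
  set A := exp (Real.pi * I * n + 2 * Real.pi * I * n * z - Real.pi * I * τ * (n * (n - 1))) with hA
  have h1 := qfin_eq_sum_qbinom hq y (2 * n)
  have h2 : qfin y q (2 * n) = A * (qfin (w * q) q n * qfin w⁻¹ q n) := by
    have hfirst : ∀ m : ℕ, ∏ i ∈ Finset.range m, (1 - w * exp (-(2 * Real.pi * I * τ * i))) =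
        exp (Real.pi * I * m + 2 * Real.pi * I * m * z - Real.pi * I * τ * (m * (m - 1))) *
          qfin w⁻¹ q m := by
      intro m
      induction m with
      | zero => simp [qfin_zero]
      | succ m ih =>
        rw [Finset.prod_range_succ, ih, qfin_succ]
        have : 1 - w * exp (-(2 * Real.pi * I * τ * m)) =
            exp (Real.pi * I + 2 * Real.pi * I * z - 2 * Real.pi * I * τ * m) * (1 - w⁻¹ * q ^ m) := by
          rw [mul_sub, hwdef, hqdef, ← exp_neg, ← exp_nat_mul, ← exp_add, ← exp_add, ← exp_add]
          have e1 : (Real.pi * I + 2 * Real.pi * I * z - 2 * Real.pi * I * τ * m) =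
            Real.pi * I + (2 * Real.pi * I * z + -(2 * Real.pi * I * τ * m)) := by ring
          have e2 : (Real.pi * I + 2 * Real.pi * I * z - 2 * Real.pi * I * τ * m) +
            (-(2 * Real.pi * I * z) + m * (2 * Real.pi * I * τ)) = Real.pi * I := by ring
          rw [e2, e1, exp_add (Real.pi * I), exp_pi_mul_I]
          ring
        rw [this]
        have e3 : (Real.pi * I * (m + 1 : ℕ) + 2 * Real.pi * I * (m + 1 : ℕ) * z -
            Real.pi * I * τ * ((m + 1 : ℕ) * ((m + 1 : ℕ) - 1))) =
            (Real.pi * I * m + 2 * Real.pi * I * m * z - Real.pi * I * τ * (m * (m - 1))) +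
            (Real.pi * I + 2 * Real.pi * I * z - 2 * Real.pi * I * τ * m) := by
          push_cast; ring
        rw [e3, exp_add]
        ring
    rw [qfin, two_mul, Finset.prod_range_add, ← Finset.prod_range_reflect]
    rw [mul_comm (qfin _ _ _), ← mul_assoc, ← hfirst n]
    congr 1
    · refine Finset.prod_congr rfl fun i hi => ?_
      have hi' := Finset.mem_range.mp hi
      rw [hy, hwdef, hqdef, ← exp_nat_mul, ← exp_add, ← exp_add]
      congr 2
      rw [Nat.sub_sub, Nat.cast_sub (by omega)]
      push_cast
      ring
    · refine Finset.prod_congr rfl fun i _ => ?_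
      rw [hy, hwdef, hqdef, ← exp_nat_mul, ← exp_nat_mul, ← exp_add, ← exp_add, ← exp_add]
      congr 2
      push_cast
      ring
  have hA0 : A ≠ 0 := exp_ne_zero _
  apply mul_left_cancel₀ hA0
  rw [← h2, h1, Finset.mul_sum]
  refine Finset.sum_congr rfl fun k _ => ?_
  rw [← mul_assoc]
  congr 1
  rw [neg_one_pow_eq_exp, hqdef, hy, ← exp_nat_mul, ← exp_nat_mul, jacobiTheta₂_term, hA,
    ← exp_add, ← exp_add, ← exp_add, Nat.cast_choose_two]
  congr 1
  push_cast
  ring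

/-- The Jacobi triple product identity. -/
theorem jacobiTheta₂_eq_qinf (z τ : ℂ) (hτ : 0 < τ.im) :
    jacobiTheta₂ (z + 1 / 2 + τ / 2) τ =
      qinf (exp (2 * Real.pi * I * τ)) (exp (2 * Real.pi * I * τ)) *
      (qinf (exp (2 * Real.pi * I * z) * exp (2 * Real.pi * I * τ)) (exp (2 * Real.pi * I * τ)) *
        qinf (exp (2 * Real.pi * I * z))⁻¹ (exp (2 * Real.pi * I * τ))) := by
  have hfin := finite_tripleProduct z τ hτ
  set q := exp (2 * Real.pi * I * τ) with hqdef
  set w := exp (2 * Real.pi * I * z) with hwdef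
  have hq : ‖q‖ < 1 := norm_exp_two_pi_I_mul_lt_one hτ
  obtain ⟨B₁, hB₁⟩ := exists_norm_qfin_le q hq
  obtain ⟨B₂, hB₂⟩ := exists_norm_inv_qfin_le hq hq
  have hB₁0 := (norm_nonneg _).trans (hB₁ 0)
  have hB₂0 := (norm_nonneg _).trans (hB₂ 0)
  set J : ℤ → ℂ := fun m => jacobiTheta₂_term m (z + 1 / 2 + τ / 2) τ with hJ
  have hJs : Summable J := (summable_jacobiTheta₂_term_iff _ _).mpr hτ
  have hbin : ∀ N k, ‖qbinom q N k‖ ≤ B₁ * (B₂ * B₂) := fun N k => by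
    unfold qbinom
    split_ifs
    · rw [div_eq_mul_inv, mul_inv, norm_mul, norm_mul]
      exact mul_le_mul (hB₁ _) (mul_le_mul (hB₂ _) (hB₂ _) (norm_nonneg _) hB₂0)
        (by positivity) hB₁0
    · rw [norm_zero]; positivity
  set f : ℕ → ℤ → ℂ := fun n m => if 0 ≤ m + n then J m * qbinom q (2 * n) (m + n).toNat else 0
    with hf
  have hfs : ∀ n, ∑' m, f n m = qfin (w * q) q n * qfin w⁻¹ q n := fun n => by
    rw [hfin n]
    set e : ℕ ↪ ℤ := ⟨fun k => (k : ℤ) - n, fun a b h => by simpa using h⟩ with he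
    rw [tsum_eq_sum (s := (Finset.range (2 * n + 1)).map e)]
    · rw [Finset.sum_map]
      refine Finset.sum_congr rfl fun k _ => ?_
      have hek : e k = (k : ℤ) - n := rfl
      simp only [hf, hJ]
      rw [hek, sub_add_cancel, if_pos (by omega), Int.toNat_natCast]
    · intro m hm
      simp only [hf]
      split_ifs with h0
      · have : ¬ (m + n).toNat ≤ 2 * n := fun hle => hm (by
          rw [Finset.mem_map]
          exact ⟨(m + n).toNat, Finset.mem_range.mpr (by omega), by
            change (((m + n).toNat : ℕ) : ℤ) - n = m
            omega⟩)
        simp [qbinom, this]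
      · rfl
  have hq0 := qinf_ne_zero_of_norm_lt hq hq
  have hqf := tendsto_qfin q hq
  -- The Gaussian binomials are uniformly bounded and the middle ones tend to 1/(q; q)_∞, while the
  -- theta terms are summable, so the finite identities pass to the limit.
  have hlim := tendsto_tsum_of_dominated_convergence (𝓕 := Filter.atTop) (f := f)
    (g := fun m => J m * (qinf q q / (qinf q q * qinf q q)))
    (bound := fun m => ‖J m‖ * (B₁ * (B₂ * B₂))) (hJs.norm.mul_right _) (fun m => by
      have t1 : Filter.Tendsto (fun n : ℕ => 2 * n) Filter.atTop Filter.atTop :=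
        Filter.tendsto_id.const_mul_atTop' (by norm_num)
      have t2 : Filter.Tendsto (fun n : ℕ => (m + n).toNat) Filter.atTop Filter.atTop := by
        refine Filter.tendsto_atTop_atTop.mpr fun b => ⟨b + m.natAbs, fun n hn => by omega⟩
      have t3 : Filter.Tendsto (fun n : ℕ => 2 * n - (m + n).toNat) Filter.atTop Filter.atTop := by
        refine Filter.tendsto_atTop_atTop.mpr fun b => ⟨b + m.natAbs, fun n hn => by omega⟩
      refine (((hqf.comp t1).div ((hqf.comp t2).mul (hqf.comp t3))
        (mul_ne_zero hq0 hq0)).const_mul (J m)).congr' ?_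
      filter_upwards [Filter.eventually_ge_atTop m.natAbs] with n hn
      simp only [hf, Function.comp, qbinom, Pi.div_apply]
      rw [if_pos (by omega), if_pos (by omega)]) (Filter.Eventually.of_forall fun n m => by
      simp only [hf]
      split_ifs
      · rw [norm_mul]
        gcongr
        exact hbin _ _
      · rw [norm_zero]; positivity)
  simp_rw [hfs] at hlim
  have h3 := tendsto_nhds_unique hlim ((tendsto_qfin (w * q) hq).mul (tendsto_qfin w⁻¹ hq))
  rw [tsum_mul_right] at h3
  rw [← h3, mul_left_comm, div_mul_cancel_left₀ hq0, mul_inv_cancel₀ hq0, mul_one]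
  rfl

end TripleProduct

/-! ### Theta functions, Klein forms and η² under SL₂(ℤ) -/

section KleinForms

open Complex

/-- The odd Jacobi theta function (up to the factor `-i`). -/
noncomputable def thetaOne (z τ : ℂ) : ℂ :=
  exp (Real.pi * I * τ / 4 + Real.pi * I * z) * jacobiTheta₂ (z + 1 / 2 + τ / 2) τ

lemma thetaOne_add_one (z τ : ℂ) : thetaOne (z + 1) τ = -thetaOne z τ := by
  rw [thetaOne, thetaOne, show z + 1 + 1 / 2 + τ / 2 = z + 1 / 2 + τ / 2 + 1 by ring,
    jacobiTheta₂_add_left, show Real.pi * I * τ / 4 + Real.pi * I * (z + 1) =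
      Real.pi * I * τ / 4 + Real.pi * I * z + Real.pi * I by ring, exp_add _ (Real.pi * I),
    exp_pi_mul_I]
  ring

lemma thetaOne_add_right (z τ : ℂ) :
    thetaOne (z + τ) τ = -exp (-(Real.pi * I * τ) - 2 * Real.pi * I * z) * thetaOne z τ := by
  rw [thetaOne, thetaOne, show z + τ + 1 / 2 + τ / 2 = z + 1 / 2 + τ / 2 + τ by ring,
    jacobiTheta₂_add_left']
  have : exp (Real.pi * I * τ / 4 + Real.pi * I * (z + τ)) *
      exp (-Real.pi * I * (τ + 2 * (z + 1 / 2 + τ / 2))) =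
      -(exp (-(Real.pi * I * τ) - 2 * Real.pi * I * z) *
        exp (Real.pi * I * τ / 4 + Real.pi * I * z)) := by
    rw [← exp_add, ← exp_add, show Real.pi * I * τ / 4 + Real.pi * I * (z + τ) +
      -Real.pi * I * (τ + 2 * (z + 1 / 2 + τ / 2)) = -(Real.pi * I * τ) - 2 * Real.pi * I * z +
      (Real.pi * I * τ / 4 + Real.pi * I * z) - Real.pi * I by ring, exp_sub _ (Real.pi * I),
      exp_pi_mul_I]
    ring
  linear_combination jacobiTheta₂ (z + 1 / 2 + τ / 2) τ * this

lemma thetaOne_neg (z τ : ℂ) : thetaOne (-z) τ = -thetaOne z τ := by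
  have h1 : jacobiTheta₂ (z + 1 / 2 + τ / 2) τ =
      exp (-Real.pi * I * (τ + 2 * (z + 1 / 2 - τ / 2))) * jacobiTheta₂ (-z + 1 / 2 + τ / 2) τ := by
    rw [show z + 1 / 2 + τ / 2 = z + 1 / 2 - τ / 2 + τ by ring, jacobiTheta₂_add_left',
      ← jacobiTheta₂_neg_left (-z + 1 / 2 + τ / 2), ← jacobiTheta₂_add_left (-(-z + 1 / 2 + τ / 2))]
    congr 2
    ring
  rw [thetaOne, thetaOne, h1, ← mul_assoc, ← exp_add,
    show Real.pi * I * τ / 4 + Real.pi * I * z + -Real.pi * I * (τ + 2 * (z + 1 / 2 - τ / 2)) =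
      Real.pi * I * τ / 4 + Real.pi * I * -z - Real.pi * I by ring, exp_sub _ (Real.pi * I),
    exp_pi_mul_I]
  ring

lemma thetaOne_T (z τ : ℂ) : thetaOne z (τ + 1) = exp (Real.pi * I / 4) * thetaOne z τ := by
  have h : jacobiTheta₂ (z + 1 / 2 + (τ + 1) / 2) (τ + 1) = jacobiTheta₂ (z + 1 / 2 + τ / 2) τ := by
    refine tsum_congr fun n => ?_
    rw [jacobiTheta₂_term, jacobiTheta₂_term]
    obtain ⟨k, hk⟩ := Int.even_mul_succ_self n
    have hk' : (n : ℂ) * (n + 1) = k + k := by exact_mod_cast hk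
    rw [show 2 * Real.pi * I * n * (z + 1 / 2 + (τ + 1) / 2) + Real.pi * I * (n : ℂ) ^ 2 * (τ + 1) =
      2 * Real.pi * I * n * (z + 1 / 2 + τ / 2) + Real.pi * I * (n : ℂ) ^ 2 * τ +
      Real.pi * I * (n * (n + 1)) by ring, hk', show Real.pi * I * ((k : ℂ) + k) =
      k * (2 * Real.pi * I) by ring, exp_add _ (k * (2 * Real.pi * I)), exp_int_mul_two_pi_mul_I, mul_one]
  rw [thetaOne, thetaOne, h, ← mul_assoc, ← exp_add]
  congr 2
  ring

lemma thetaOne_S (z : ℂ) {τ : ℂ} (hτ : 0 < τ.im) :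
    thetaOne (z / τ) (-1 / τ) =
      -I * (-I * τ) ^ (1 / 2 : ℂ) * exp (Real.pi * I * z ^ 2 / τ) * thetaOne z τ := by
  have hτ0 : τ ≠ 0 := by
    rintro rfl
    simp at hτ
  have hr : (-I * τ) ^ (1 / 2 : ℂ) ≠ 0 := by
    rw [Ne, cpow_eq_zero_iff]
    simp [hτ0]
  -- The argument is moved by the period 1 beforehand, so that division by τ lands on z/τ + 1/2 +
  -- (-1/τ)/2, the shape in the definition of `thetaOne`.
  have h := jacobiTheta₂_functional_equation (z - 1 / 2 + τ / 2) τ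
  have h2 : jacobiTheta₂ (z - 1 / 2 + τ / 2) τ = jacobiTheta₂ (z + 1 / 2 + τ / 2) τ := by
    rw [← jacobiTheta₂_add_left]
    congr 1
    ring
  have h3 : (z - 1 / 2 + τ / 2) / τ = z / τ + 1 / 2 + -1 / τ / 2 := by
    field_simp
    ring
  rw [h2, h3] at h
  rw [thetaOne, thetaOne, h]
  have e1 : exp (Real.pi * I * (-1 / τ) / 4 + Real.pi * I * (z / τ)) =
      -I * exp (Real.pi * I * z ^ 2 / τ) * (exp (Real.pi * I * τ / 4 + Real.pi * I * z) *
        exp (-Real.pi * I * (z - 1 / 2 + τ / 2) ^ 2 / τ)) := by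
    have : -I = exp (-(Real.pi / 2 * I)) := by
      rw [exp_neg, exp_pi_div_two_mul_I, inv_I]
    rw [this, ← exp_add, ← exp_add, ← exp_add]
    congr 1
    field_simp
    ring
  rw [e1]
  field_simp

/-- The Klein form with characteristic `(r, s)`. -/
noncomputable def klein (r s τ : ℂ) : ℂ :=
  exp (Real.pi * I * (r * (r * τ + s))) * thetaOne (r * τ + s) τ / ModularForm.eta τ ^ 3

lemma klein_neg (r s τ : ℂ) : klein (-r) (-s) τ = -klein r s τ := by
  rw [klein, klein, show -r * τ + -s = -(r * τ + s) by ring, thetaOne_neg]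
  rw [show -r * -(r * τ + s) = r * (r * τ + s) by ring]
  ring

lemma klein_add_one_right (r s τ : ℂ) :
    klein r (s + 1) τ = -exp (Real.pi * I * r) * klein r s τ := by
  rw [klein, klein, ← add_assoc, thetaOne_add_one,
    show Real.pi * I * (r * (r * τ + s + 1)) = Real.pi * I * r + Real.pi * I * (r * (r * τ + s))
    by ring, exp_add]
  ring

lemma klein_add_one_left (r s τ : ℂ) :
    klein (r + 1) s τ = -exp (-(Real.pi * I * s)) * klein r s τ := by
  rw [klein, klein, show (r + 1) * τ + s = r * τ + s + τ by ring, thetaOne_add_right]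
  have : exp (Real.pi * I * ((r + 1) * (r * τ + s + τ))) *
      exp (-(Real.pi * I * τ) - 2 * Real.pi * I * (r * τ + s)) =
      exp (-(Real.pi * I * s)) * exp (Real.pi * I * (r * (r * τ + s))) := by
    rw [← exp_add, ← exp_add]
    congr 1
    ring
  linear_combination (-thetaOne (r * τ + s) τ / ModularForm.eta τ ^ 3) * this

lemma klein_add_int_right (r s τ : ℂ) (n : ℤ) :
    klein r (s + n) τ = (-exp (Real.pi * I * r)) ^ n * klein r s τ := by
  have h0 : -exp (Real.pi * I * r) ≠ 0 := neg_ne_zero.mpr (exp_ne_zero _)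
  induction n using Int.induction_on with
  | zero => simp
  | succ n ih =>
    rw [Int.cast_add, Int.cast_one, ← add_assoc, klein_add_one_right, ih, zpow_add_one₀ h0]
    ring
  | pred n ih =>
    have h := klein_add_one_right r (s + (-(n : ℤ) - 1 : ℤ)) τ
    rw [show s + ((-(n : ℤ) - 1 : ℤ) : ℂ) + 1 = s + ((-(n : ℤ) : ℤ) : ℂ) by push_cast; ring, ih] at h
    rw [zpow_sub_one₀ h0]
    field_simp
    rw [h]
    ring

lemma klein_add_int_left (r s τ : ℂ) (n : ℤ) :
    klein (r + n) s τ = (-exp (-(Real.pi * I * s))) ^ n * klein r s τ := by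
  have h0 : -exp (-(Real.pi * I * s)) ≠ 0 := neg_ne_zero.mpr (exp_ne_zero _)
  induction n using Int.induction_on with
  | zero => simp
  | succ n ih =>
    rw [Int.cast_add, Int.cast_one, ← add_assoc, klein_add_one_left, ih, zpow_add_one₀ h0]
    ring
  | pred n ih =>
    have h := klein_add_one_left (r + (-(n : ℤ) - 1 : ℤ)) s τ
    rw [show r + ((-(n : ℤ) - 1 : ℤ) : ℂ) + 1 = r + ((-(n : ℤ) : ℤ) : ℂ) by push_cast; ring, ih] at h
    rw [zpow_sub_one₀ h0]
    field_simp
    rw [h]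
    ring

lemma eta_T (τ : ℂ) : ModularForm.eta (τ + 1) = exp (Real.pi * I / 12) * ModularForm.eta τ := by
  have h : ∀ n, ModularForm.eta_q n (τ + 1) = ModularForm.eta_q n τ := fun n => by
    rw [ModularForm.eta_q_eq_pow, ModularForm.eta_q_eq_pow, mul_add, exp_add, mul_one,
      exp_two_pi_mul_I, mul_one]
  rw [ModularForm.eta, ModularForm.eta, ← mul_assoc]
  simp_rw [h]
  congr 1
  rw [Function.Periodic.qParam, Function.Periodic.qParam, ← exp_add]
  congr 1
  push_cast
  ring

lemma eta_S {τ : ℂ} (hτ : 0 < τ.im) :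
    ModularForm.eta (-1 / τ) = (-I * τ) ^ (1 / 2 : ℂ) * ModularForm.eta τ := by
  have h := ModularForm.eta_comp_eq_csqrt_I_inv (x := τ) hτ
  have hτ0 : τ ≠ 0 := by
    rintro rfl
    simp at hτ
  simp only [Function.comp, Pi.smul_apply, Pi.mul_apply, smul_eq_mul] at h
  rw [h, ← mul_assoc]
  congr 1
  -- No branch is crossed: one argument is -π/2, the other lies in [0, π], so the principal square
  -- root of the product splits.
  have harg : arg (-I) + arg τ ∈ Set.Ioc (-Real.pi) Real.pi := by
    rw [arg_neg_I]
    have h1 := arg_nonneg_iff.mpr hτ.le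
    have h2 := arg_le_pi τ
    constructor <;> linarith [Real.pi_pos]
  rw [sqrt, sqrt, cpow_def_of_ne_zero I_ne_zero, cpow_def_of_ne_zero hτ0,
    cpow_def_of_ne_zero (mul_ne_zero (neg_ne_zero.mpr I_ne_zero) hτ0),
    (log_mul_eq_add_log_iff (neg_ne_zero.mpr I_ne_zero) hτ0).mpr harg, ← exp_neg, ← exp_add, log_I,
    log_neg_I]
  congr 1
  ring

lemma sq_cpow_half (x : ℂ) : (x ^ (1 / 2 : ℂ)) ^ 2 = x := by
  rw [one_div]
  exact_mod_cast cpow_nat_inv_pow x two_ne_zero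

lemma klein_T (r s τ : ℂ) : klein r s (τ + 1) = klein r (r + s) τ := by
  rw [klein, klein, thetaOne_T, eta_T, show r * (τ + 1) + s = r * τ + (r + s) by ring, mul_pow,
    ← exp_nat_mul, show ((3 : ℕ) : ℂ) * (Real.pi * I / 12) = Real.pi * I / 4 by push_cast; ring]
  have := exp_ne_zero (Real.pi * I / 4)
  field_simp

/-- Theta contributes -iρ and η³ contributes ρ³ = ρ · (-iτ), where ρ is the square root of -iτ;
their quotient is exactly τ⁻¹. The Gaussian factor of theta is absorbed by the exponential prefactor
of the Klein form. -/
lemma klein_S (r s : ℂ) {τ : ℂ} (hτ : 0 < τ.im) : klein r s (-1 / τ) = τ⁻¹ * klein s (-r) τ := by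
  have hτ0 : τ ≠ 0 := by
    rintro rfl
    simp at hτ
  have hr : (-I * τ) ^ (1 / 2 : ℂ) ≠ 0 := by
    rw [Ne, cpow_eq_zero_iff]
    simp [hτ0]
  have hsq := sq_cpow_half (-I * τ)
  rw [klein, klein, eta_S hτ, show r * (-1 / τ) + s = (s * τ + -r) / τ by field_simp; ring,
    thetaOne_S _ hτ]
  have e : exp (Real.pi * I * (r * ((s * τ + -r) / τ))) * exp (Real.pi * I * (s * τ + -r) ^ 2 / τ) =
      exp (Real.pi * I * (s * (s * τ + -r))) := by
    rw [← exp_add]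
    congr 1
    field_simp
    ring
  set ρ := (-I * τ) ^ (1 / 2 : ℂ)
  rw [← e]
  have h3 : (ρ * ModularForm.eta τ) ^ 3 = ρ * (-I * τ) * ModularForm.eta τ ^ 3 := by
    rw [← hsq]
    ring
  rw [h3]
  have := I_ne_zero
  field_simp

open ModularGroup MatrixGroups

lemma coe_S_smul (τ : ℍ) : ((S • τ : ℍ) : ℂ) = -1 / (τ : ℂ) := by
  rw [UpperHalfPlane.modular_S_smul]
  simp [neg_div, inv_neg]

lemma coe_T_smul (τ : ℍ) : ((T • τ : ℍ) : ℂ) = (τ : ℂ) + 1 := by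
  rw [UpperHalfPlane.modular_T_smul, UpperHalfPlane.coe_vadd]
  simp [add_comm]

lemma coe_SL_smul (γ : SL(2, ℤ)) (τ : ℍ) :
    ((γ • τ : ℍ) : ℂ) = ((γ 0 0 : ℤ) * (τ : ℂ) + (γ 0 1 : ℤ)) / ((γ 1 0 : ℤ) * (τ : ℂ) + (γ 1 1 : ℤ)) := by
  rw [UpperHalfPlane.coe_specialLinearGroup_apply]
  simp

lemma int_denom_ne_zero {c d : ℤ} (h : c ≠ 0 ∨ d ≠ 0) (τ : ℍ) : (c : ℂ) * τ + d ≠ 0 := by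
  intro h0
  have him := congrArg Complex.im h0
  have hre := congrArg Complex.re h0
  simp at him hre
  rcases him with hc | hc
  · simp [hc] at hre
    rcases h with h | h
    · exact h hc
    · exact h hre
  · exact τ.im_pos.ne' hc

lemma SL_denom_ne_zero (γ : SL(2, ℤ)) (τ : ℍ) :
    ((γ 1 0 : ℤ) : ℂ) * τ + (γ 1 1 : ℤ) ≠ 0 := by
  refine int_denom_ne_zero ?_ τ
  by_contra h
  push Not at h
  have := γ.det_coe
  rw [Matrix.det_fin_two, h.1, h.2] at this
  simp at this

/-- S and T generate, and S⁻¹ = S³, so only T needs a separate step for its inverse. -/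
lemma SL_induction {P : SL(2, ℤ) → Prop} (one : P 1) (hS : ∀ γ, P γ → P (S * γ))
    (hT : ∀ γ, P γ → P (T * γ)) (hT' : ∀ γ, P γ → P (T⁻¹ * γ)) (γ : SL(2, ℤ)) : P γ := by
  have hγ : γ ∈ Subgroup.closure {S, T} := by
    simp [SpecialLinearGroup.SL2Z_generators]
  have hS' : S⁻¹ = S * (S * S) := by decide
  induction hγ using Subgroup.closure_induction_left with
  | one => exact one
  | mul_left x hx y _ ih =>
    rcases hx with rfl | rfl
    · exact hS _ ih
    · exact hT _ ih
  | inv_mul_cancel x hx y _ ih =>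
    rcases hx with rfl | rfl
    · rw [hS', mul_assoc, mul_assoc]
      exact hS _ (hS _ (hS _ ih))
    · exact hT' _ ih

lemma S_mul_apply (γ : SL(2, ℤ)) : (S * γ) 0 0 = -γ 1 0 ∧ (S * γ) 0 1 = -γ 1 1 ∧
    (S * γ) 1 0 = γ 0 0 ∧ (S * γ) 1 1 = γ 0 1 := by
  rw [Matrix.SpecialLinearGroup.coe_mul, coe_S]
  simp [Matrix.mul_apply, Fin.sum_univ_two]

lemma T_mul_apply (γ : SL(2, ℤ)) : (T * γ) 0 0 = γ 0 0 + γ 1 0 ∧ (T * γ) 0 1 = γ 0 1 + γ 1 1 ∧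
    (T * γ) 1 0 = γ 1 0 ∧ (T * γ) 1 1 = γ 1 1 := by
  rw [Matrix.SpecialLinearGroup.coe_mul, coe_T]
  simp [Matrix.mul_apply, Fin.sum_univ_two]

lemma T_inv_mul_apply (γ : SL(2, ℤ)) : (T⁻¹ * γ) 0 0 = γ 0 0 - γ 1 0 ∧
    (T⁻¹ * γ) 0 1 = γ 0 1 - γ 1 1 ∧ (T⁻¹ * γ) 1 0 = γ 1 0 ∧ (T⁻¹ * γ) 1 1 = γ 1 1 := by
  have h := T_mul_apply (T⁻¹ * γ)
  rw [mul_inv_cancel_left] at h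
  refine ⟨?_, ?_, h.2.2.1.symm, h.2.2.2.symm⟩
  · linarith [h.1, h.2.2.1]
  · linarith [h.2.1, h.2.2.2]

lemma coe_T_inv_smul (τ : ℍ) : ((T⁻¹ • τ : ℍ) : ℂ) = (τ : ℂ) - 1 := by
  have := coe_T_smul (T⁻¹ • τ)
  rw [smul_inv_smul] at this
  rw [this]
  ring

/-- Klein forms have weight -1 and no multiplier: the matrix acts only on the row vector (r, s) from
the right. The induction needs all r, s at once, since each generator changes them. -/
lemma klein_SL_smul (γ : SL(2, ℤ)) (r s : ℂ) (τ : ℍ) :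
    klein r s ((γ • τ : ℍ) : ℂ) = ((γ 1 0 : ℤ) * (τ : ℂ) + (γ 1 1 : ℤ))⁻¹ *
      klein (r * (γ 0 0 : ℤ) + s * (γ 1 0 : ℤ)) (r * (γ 0 1 : ℤ) + s * (γ 1 1 : ℤ)) τ := by
  revert r s
  refine SL_induction (P := fun γ => ∀ r s : ℂ, klein r s ((γ • τ : ℍ) : ℂ) =
    ((γ 1 0 : ℤ) * (τ : ℂ) + (γ 1 1 : ℤ))⁻¹ * klein (r * (γ 0 0 : ℤ) + s * (γ 1 0 : ℤ))
      (r * (γ 0 1 : ℤ) + s * (γ 1 1 : ℤ)) τ) ?_ ?_ ?_ ?_ γ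
  · intro r s
    simp
  · intro γ ih r s
    obtain ⟨h1, h2, h3, h4⟩ := S_mul_apply γ
    rw [h1, h2, h3, h4, mul_smul, coe_S_smul, klein_S _ _ (γ • τ).im_pos, ih, coe_SL_smul, ← mul_assoc,
      ← mul_inv, div_mul_cancel₀ _ (SL_denom_ne_zero γ τ)]
    congr 2 <;> push_cast <;> ring
  · intro γ ih r s
    obtain ⟨h1, h2, h3, h4⟩ := T_mul_apply γ
    rw [h1, h2, h3, h4, mul_smul, coe_T_smul, klein_T, ih]
    congr 2 <;> push_cast <;> ring
  · intro γ ih r s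
    obtain ⟨h1, h2, h3, h4⟩ := T_inv_mul_apply γ
    have := klein_T r (s - r) ((T⁻¹ • (γ • τ) : ℍ) : ℂ)
    rw [coe_T_inv_smul, sub_add_cancel, add_sub_cancel] at this
    rw [h1, h2, h3, h4, mul_smul, coe_T_inv_smul, ← this, ih]
    congr 2 <;> push_cast <;> ring

/-- The exponent of the multiplier of `η²`. -/
def etaSqExponent {R : Type*} [CommRing R] (a b c d : R) : R :=
  (1 - c ^ 2) * (b * d + 3 * (c - 1) * d + c + 3) + c * (a + d - 3)

/-- The exponent counts only mod 12, so its behaviour under S (subtract 3, the factor -i) and T (add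
1) is settled by finite checks mod 3 and mod 4. -/
lemma etaSqExponent_S_three : ∀ a b c d : ZMod 3, a * d - b * c = 1 →
    etaSqExponent (-c) (-d) a b = etaSqExponent a b c d - 3 := by
  unfold etaSqExponent
  decide

lemma etaSqExponent_S_four : ∀ a b c d : ZMod 4, a * d - b * c = 1 →
    etaSqExponent (-c) (-d) a b = etaSqExponent a b c d - 3 := by
  unfold etaSqExponent
  decide

lemma etaSqExponent_T_three : ∀ a b c d : ZMod 3, a * d - b * c = 1 →
    etaSqExponent (a + c) (b + d) c d = etaSqExponent a b c d + 1 := by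
  unfold etaSqExponent
  decide

lemma etaSqExponent_T_four : ∀ a b c d : ZMod 4, a * d - b * c = 1 →
    etaSqExponent (a + c) (b + d) c d = etaSqExponent a b c d + 1 := by
  unfold etaSqExponent
  decide

lemma exp_div_twelve_congr {m n : ℤ} (h3 : (m : ZMod 3) = n) (h4 : (m : ZMod 4) = n) :
    exp (2 * Real.pi * I * m / 12) = exp (2 * Real.pi * I * n / 12) := by
  have d3 := (ZMod.intCast_eq_intCast_iff_dvd_sub m n 3).mp h3
  have d4 := (ZMod.intCast_eq_intCast_iff_dvd_sub m n 4).mp h4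
  obtain ⟨k, hk⟩ : (12 : ℤ) ∣ n - m := by omega
  have hk' : (n : ℂ) = m + 12 * k := by
    have : n = m + 12 * k := by omega
    rw [this]
    push_cast
    ring
  rw [hk', show 2 * Real.pi * I * (m + 12 * k : ℂ) / 12 =
    2 * Real.pi * I * m / 12 + k * (2 * Real.pi * I) by ring, exp_add, exp_int_mul_two_pi_mul_I,
    mul_one]

lemma intCast_etaSqExponent {n : ℕ} (a b c d : ℤ) :
    ((etaSqExponent a b c d : ℤ) : ZMod n) = etaSqExponent (a : ZMod n) b c d := by
  simp [etaSqExponent]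

lemma SL_det (γ : SL(2, ℤ)) : γ 0 0 * γ 1 1 - γ 0 1 * γ 1 0 = 1 := by
  rw [← Matrix.det_fin_two]
  exact γ.det_coe

/-- Squaring η gives integral weight, so no square root of cτ + d has to be chosen; the multiplier
is a 12th root of unity. -/
lemma eta_sq_SL_smul (γ : SL(2, ℤ)) (τ : ℍ) :
    ModularForm.eta ((γ • τ : ℍ) : ℂ) ^ 2 =
      exp (2 * Real.pi * I * (etaSqExponent (γ 0 0) (γ 0 1) (γ 1 0) (γ 1 1) : ℤ) / 12) *
      ((γ 1 0 : ℤ) * (τ : ℂ) + (γ 1 1 : ℤ)) * ModularForm.eta τ ^ 2 := by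
  have hdet : ∀ (γ : SL(2, ℤ)) (n : ℕ), ((γ 0 0 : ℤ) : ZMod n) * (γ 1 1 : ℤ) -
      (γ 0 1 : ℤ) * (γ 1 0 : ℤ) = 1 := fun γ n => by
    exact_mod_cast congrArg (Int.cast : ℤ → ZMod n) (SL_det γ)
  have hstepT : ∀ γ : SL(2, ℤ),
      exp (2 * Real.pi * I * (etaSqExponent (γ 0 0 + γ 1 0) (γ 0 1 + γ 1 1) (γ 1 0) (γ 1 1) : ℤ) / 12) =
      exp (Real.pi * I / 12) ^ 2 *
      exp (2 * Real.pi * I * (etaSqExponent (γ 0 0) (γ 0 1) (γ 1 0) (γ 1 1) : ℤ) / 12) := fun γ => by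
    rw [exp_div_twelve_congr (n := etaSqExponent (γ 0 0) (γ 0 1) (γ 1 0) (γ 1 1) + 1), ← exp_nat_mul,
      ← exp_add]
    · congr 1
      push_cast
      ring
    · push_cast [intCast_etaSqExponent]
      exact etaSqExponent_T_three _ _ _ _ (hdet γ 3)
    · push_cast [intCast_etaSqExponent]
      exact etaSqExponent_T_four _ _ _ _ (hdet γ 4)
  refine SL_induction (P := fun γ => ModularForm.eta ((γ • τ : ℍ) : ℂ) ^ 2 =
      exp (2 * Real.pi * I * (etaSqExponent (γ 0 0) (γ 0 1) (γ 1 0) (γ 1 1) : ℤ) / 12) *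
      ((γ 1 0 : ℤ) * (τ : ℂ) + (γ 1 1 : ℤ)) * ModularForm.eta τ ^ 2) ?_ ?_ ?_ ?_ γ
  · simp [etaSqExponent]
  · intro γ ih
    obtain ⟨h1, h2, h3, h4⟩ := S_mul_apply γ
    rw [h1, h2, h3, h4, mul_smul, coe_S_smul, eta_S (γ • τ).im_pos, mul_pow, ih, sq_cpow_half,
      coe_SL_smul, exp_div_twelve_congr (m := etaSqExponent (-γ 1 0) (-γ 1 1) (γ 0 0) (γ 0 1))
      (n := etaSqExponent (γ 0 0) (γ 0 1) (γ 1 0) (γ 1 1) - 3)]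
    · have e : exp (2 * Real.pi * I * ((etaSqExponent (γ 0 0) (γ 0 1) (γ 1 0) (γ 1 1) - 3 : ℤ) : ℂ) / 12)
          = -I * exp (2 * Real.pi * I * (etaSqExponent (γ 0 0) (γ 0 1) (γ 1 0) (γ 1 1) : ℤ) / 12) := by
        have : -I = exp (-(Real.pi / 2 * I)) := by
          rw [exp_neg, exp_pi_div_two_mul_I, inv_I]
        rw [this, ← exp_add]
        congr 1
        push_cast
        ring
      rw [e]
      have := SL_denom_ne_zero γ τ
      generalize ((γ 1 0 : ℤ) : ℂ) * τ + (γ 1 1 : ℤ) = D at this ⊢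
      field_simp
    · push_cast [intCast_etaSqExponent]
      exact etaSqExponent_S_three _ _ _ _ (hdet γ 3)
    · push_cast [intCast_etaSqExponent]
      exact etaSqExponent_S_four _ _ _ _ (hdet γ 4)
  · intro γ ih
    obtain ⟨h1, h2, h3, h4⟩ := T_mul_apply γ
    rw [h1, h2, h3, h4, mul_smul, coe_T_smul, eta_T, mul_pow, ih, hstepT]
    ring
  · intro γ ih
    obtain ⟨h1, h2, h3, h4⟩ := T_inv_mul_apply γ
    have h := eta_T ((T⁻¹ • (γ • τ) : ℍ) : ℂ)
    rw [coe_T_inv_smul, sub_add_cancel] at h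
    have h5 := hstepT (T⁻¹ * γ)
    rw [h1, h2, h3, h4] at h5
    simp only [sub_add_cancel] at h5
    rw [h, mul_pow, h5] at ih
    rw [h1, h2, h3, h4, mul_smul, coe_T_inv_smul]
    have h6 := exp_ne_zero (Real.pi * I / 12)
    apply mul_left_cancel₀ (pow_ne_zero 2 h6)
    rw [ih]
    ring

end KleinForms

/-! ### Transformation laws for explicit integer matrices -/

section Mobius

open Complex MatrixGroups

/-- The Möbius relation is stated without division, so that it can be verified by linear algebra
when the points are pz or (z + 24j)/p and the matrix is a conjugate of the original one. -/
lemma klein_mobius {a b c d : ℤ} (h : a * d - b * c = 1) (r s : ℂ) {τ τ' : ℍ}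
    (hτ : (τ' : ℂ) * (c * τ + d) = a * τ + b) :
    klein r s τ' = ((c : ℂ) * τ + d)⁻¹ * klein (r * a + s * c) (r * b + s * d) τ := by
  set γ : SL(2, ℤ) := ⟨!![a, b; c, d], by rw [Matrix.det_fin_two_of, h]⟩ with hγ
  have hD : (c : ℂ) * τ + d ≠ 0 := SL_denom_ne_zero γ τ
  have h1 : ((γ • τ : ℍ) : ℂ) = τ' := by
    rw [coe_SL_smul, div_eq_iff (SL_denom_ne_zero γ τ)]
    exact hτ.symm
  have h2 := klein_SL_smul γ r s τ
  rw [h1] at h2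
  exact h2

lemma eta_sq_mobius {a b c d : ℤ} (h : a * d - b * c = 1) (ha : 24 ∣ a - 1) (hb : 24 ∣ b)
    (hc : 24 ∣ c) (hd : 24 ∣ d - 1) {τ τ' : ℍ} (hτ : (τ' : ℂ) * (c * τ + d) = a * τ + b) :
    ModularForm.eta τ' ^ 2 = ((c : ℂ) * τ + d) * ModularForm.eta τ ^ 2 := by
  set γ : SL(2, ℤ) := ⟨!![a, b; c, d], by rw [Matrix.det_fin_two_of, h]⟩ with hγ
  have h1 : ((γ • τ : ℍ) : ℂ) = τ' := by
    rw [coe_SL_smul, div_eq_iff (SL_denom_ne_zero γ τ)]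
    exact hτ.symm
  have h2 := eta_sq_SL_smul γ τ
  rw [h1] at h2
  have h3 : ∀ n : ℕ, (n : ℤ) ∣ 24 → ((etaSqExponent a b c d : ℤ) : ZMod n) = ((0 : ℤ) : ZMod n) := by
    intro n hn
    have ea : ((a : ℤ) : ZMod n) = 1 := by
      have := (ZMod.intCast_zmod_eq_zero_iff_dvd (a - 1) n).mpr (hn.trans ha)
      push_cast at this
      exact sub_eq_zero.mp this
    have ed : ((d : ℤ) : ZMod n) = 1 := by
      have := (ZMod.intCast_zmod_eq_zero_iff_dvd (d - 1) n).mpr (hn.trans hd)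
      push_cast at this
      exact sub_eq_zero.mp this
    have eb := (ZMod.intCast_zmod_eq_zero_iff_dvd b n).mpr (hn.trans hb)
    have ec := (ZMod.intCast_zmod_eq_zero_iff_dvd c n).mpr (hn.trans hc)
    rw [intCast_etaSqExponent, ea, eb, ec, ed, etaSqExponent]
    push_cast
    ring
  have h4 : exp (2 * Real.pi * I * (etaSqExponent a b c d : ℤ) / 12) = 1 := by
    rw [exp_div_twelve_congr (h3 3 (by norm_num)) (h3 4 (by norm_num))]
    simp
  have h5 : ModularForm.eta τ' ^ 2 = exp (2 * Real.pi * I * (etaSqExponent a b c d : ℤ) / 12) *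
      ((c : ℂ) * τ + d) * ModularForm.eta τ ^ 2 := h2
  rw [h5, h4, one_mul]

/-- The Möbius transformation of an integral matrix of determinant one. -/
lemma exists_mobius {a b c d : ℤ} (h : a * d - b * c = 1) (τ : ℍ) :
    ∃ τ' : ℍ, (τ' : ℂ) * (c * τ + d) = a * τ + b := by
  set γ : SL(2, ℤ) := ⟨!![a, b; c, d], by rw [Matrix.det_fin_two_of, h]⟩ with hγ
  refine ⟨γ • τ, ?_⟩
  rw [coe_SL_smul]
  exact div_mul_cancel₀ _ (SL_denom_ne_zero γ τ)

end Mobius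

/-! ### Folding indices mod ±1 and the permutation π_a -/

section FoldIndex

variable {p : ℕ} [Fact p.Prime]

lemma foldIndex_neg (x : ZMod p) : foldIndex p (-x) = foldIndex p x := by
  simp only [foldIndex, ZMod.natAbs_valMinAbs_neg]

lemma foldIndex_natCast {k : ℕ} (hk : k ≤ p / 2) : (foldIndex p (k : ZMod p) : ℕ) = k := by
  simp [foldIndex, ZMod.valMinAbs_natCast_of_le_half hk]

lemma cast_foldIndex (x : ZMod p) :
    (((foldIndex p x : ℕ) : ℕ) : ZMod p) = x ∨ (((foldIndex p x : ℕ) : ℕ) : ZMod p) = -x := by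
  have h := ZMod.natCast_natAbs_valMinAbs x
  simp only [foldIndex]
  rw [h]
  split_ifs
  · exact Or.inl rfl
  · exact Or.inr rfl

lemma foldIndex_mul_cast_foldIndex (y x : ZMod p) :
    foldIndex p (y * ((foldIndex p x : ℕ) : ZMod p)) = foldIndex p (y * x) := by
  rcases cast_foldIndex x with h | h
  · rw [h]
  · rw [h, mul_neg, foldIndex_neg]

lemma foldIndex_eq_zero_iff (x : ZMod p) : foldIndex p x = 0 ↔ x = 0 := by
  simp [foldIndex, Fin.ext_iff]

/-- Reduction of k to its remainder r costs one sign per period, hence (-1)^⌊k/p⌋. Replacing r by p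
- r costs nothing, because oddness and antiperiodicity each give a minus sign. -/
lemma antiperiodic_eq_foldIndex (hp : 3 < p) {G : ℤ → ℂ} (h1 : ∀ k, G (k + p) = -G k)
    (h2 : ∀ k, G (-k) = -G k) (k : ℤ) :
    G k = (-1) ^ (k / (p : ℤ)) * G ((foldIndex p (k : ZMod p) : ℕ) : ℤ) := by
  have hmul : ∀ n k : ℤ, G (k + p * n) = (-1) ^ n * G k := fun n k => by
    have h0 : (-1 : ℂ) ≠ 0 := by norm_num
    induction n using Int.induction_on with
    | zero => simp
    | succ n ih =>
      rw [mul_add, mul_one, ← add_assoc, h1, ih, zpow_add_one₀ h0]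
      ring
    | pred n ih =>
      have := h1 (k + p * (-(n : ℤ) - 1))
      rw [show k + p * (-(n : ℤ) - 1) + p = k + p * -(n : ℤ) by ring, ih] at this
      rw [zpow_sub_one₀ h0]
      field_simp
      rw [this]
      ring
  have hp' : (0 : ℤ) < p := by omega
  have hr0 := Int.emod_nonneg k hp'.ne'
  have hr1 := Int.emod_lt_of_pos k hp'
  have hk := Int.emod_add_mul_ediv k p
  have hG : G k = (-1) ^ (k / (p : ℤ)) * G (k % p) := by
    conv_lhs => rw [← hk]
    exact hmul _ _
  rw [hG]
  congr 1
  obtain ⟨r, hr⟩ := Int.eq_ofNat_of_zero_le hr0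
  have hcast : ((k : ℤ) : ZMod p) = (r : ZMod p) := by
    have : ((k : ℤ) : ZMod p) = ((k % p : ℤ) : ZMod p) := by simp
    rw [this, hr]
    simp
  rw [hcast, hr]
  rw [hr] at hr1
  by_cases hle : r ≤ p / 2
  · rw [foldIndex_natCast hle]
  · have hodd : p % 2 = 1 := by
      rcases (Fact.out : p.Prime).eq_two_or_odd with h | h
      · omega
      · exact h
    have hlt : r < p := by omega
    have : (r : ZMod p) = -((p - r : ℕ) : ZMod p) := by
      rw [Nat.cast_sub hlt.le]
      simp
    rw [this, foldIndex_neg, foldIndex_natCast (by omega), Nat.cast_sub hlt.le]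
    have e := h1 (-(r : ℤ))
    rw [h2, neg_neg] at e
    rw [← e]
    congr 1
    ring

lemma permVec_zero (r : ℕ) (n : ExpVec p) : permVec p r n 0 = n 0 := by
  have : foldIndex p (0 : ZMod p) = 0 := (foldIndex_eq_zero_iff 0).mpr rfl
  simp [permVec, this]

lemma natCast_ne_zero_of_le_half {k : ℕ} (h0 : 0 < k) (hk : k ≤ p / 2) : (k : ZMod p) ≠ 0 := by
  rw [Ne, ZMod.natCast_eq_zero_iff]
  intro h
  have := Nat.le_of_dvd h0 h
  have := (Fact.out : p.Prime).pos
  omega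

/-- The permutation `k ↦ ± r k` of `1, …, (p - 1) / 2` and its effect on exponent vectors. -/
lemma exists_perm {r : ℕ} (hr : (r : ZMod p) ≠ 0) :
    ∃ σ : Equiv.Perm (Fin (p / 2)), (∀ k, (σ k).succ = foldIndex p (r * ((k : ℕ) + 1 : ℕ))) ∧
      ∀ (n : ExpVec p) k, permVec p r n (σ k).succ = n k.succ := by
  have hne : ∀ k : Fin (p / 2), foldIndex p ((r : ZMod p) * ((k : ℕ) + 1 : ℕ)) ≠ 0 := fun k => by
    rw [Ne, foldIndex_eq_zero_iff]
    exact mul_ne_zero hr (natCast_ne_zero_of_le_half (Nat.succ_pos _) k.2)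
  set σ : Fin (p / 2) → Fin (p / 2) := fun k => (foldIndex p ((r : ZMod p) * ((k : ℕ) + 1 : ℕ))).pred (hne k) with hσ
  have h1 : ∀ k, (σ k).succ = foldIndex p (r * ((k : ℕ) + 1 : ℕ)) := fun k => Fin.succ_pred _ _
  have h2 : ∀ k : Fin (p / 2), foldIndex p ((r : ZMod p)⁻¹ * (((σ k).succ : ℕ) : ZMod p)) = k.succ := by
    intro k
    rw [h1, foldIndex_mul_cast_foldIndex, ← mul_assoc, inv_mul_cancel₀ hr, one_mul, Fin.ext_iff,
      foldIndex_natCast k.2]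
    simp
  have hinj : Function.Injective σ := fun k l h => by
    have := h2 k
    rw [h, h2 l] at this
    exact Fin.succ_injective _ this.symm
  refine ⟨Equiv.ofBijective σ (Finite.injective_iff_bijective.mp hinj), h1, fun n k => ?_⟩
  change n _ = _
  congr 1
  exact h2 k

/-- Used for both kinds of characteristic, (k/p, 0) and (0, k/p). The permutation depends on α only
mod p, but the sign depends on the integer α itself. -/
lemma prod_antiperiodic (hp : 3 < p) {G : ℤ → ℂ} (h1 : ∀ k, G (k + p) = -G k)
    (h2 : ∀ k, G (-k) = -G k) {r : ℕ} {α : ℤ} (hα : (α : ZMod p) = r) (hr : (r : ZMod p) ≠ 0)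
    (n : ExpVec p) :
    ∏ k : Fin (p / 2), G (α * ((k : ℤ) + 1)) ^ n k.succ =
      (-1) ^ (∑ k : Fin (p / 2), (α * ((k : ℤ) + 1)) / (p : ℤ) * n k.succ) *
        ∏ k : Fin (p / 2), G ((k : ℤ) + 1) ^ permVec p r n k.succ := by
  obtain ⟨σ, hσ1, hσ2⟩ := exists_perm (p := p) hr
  rw [← Equiv.prod_comp σ fun k : Fin (p / 2) => G ((k : ℤ) + 1) ^ permVec p r n k.succ]
  have hs : ∀ (s : Finset (Fin (p / 2))) (f : Fin (p / 2) → ℤ),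
      (-1 : ℂ) ^ (∑ k ∈ s, f k) = ∏ k ∈ s, (-1 : ℂ) ^ f k := fun s f => by
    classical
    induction s using Finset.induction_on with
    | empty => simp
    | insert a s ha ih => rw [Finset.sum_insert ha, Finset.prod_insert ha, zpow_add₀ (by norm_num), ih]
  rw [hs, ← Finset.prod_mul_distrib]
  refine Finset.prod_congr rfl fun k _ => ?_
  rw [antiperiodic_eq_foldIndex hp h1 h2, hσ2, mul_zpow, ← zpow_mul]
  congr 2
  have : (((σ k : Fin (p / 2)) : ℕ) : ℤ) + 1 = (((σ k).succ : ℕ) : ℤ) := by simp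
  rw [this, hσ1]
  congr 4
  push_cast
  rw [hα]

end FoldIndex

/-! ### The transfer matrix -/

section TransferMatrix

/-- A matrix of `Γ₀(p)`, close to the identity modulo `24` and with upper left entry congruent
to `a` modulo `p`. -/
structure TransferMatrix (p a : ℕ) where
  α : ℤ
  β : ℤ
  γ : ℤ
  δ : ℤ
  x : ℤ
  det : α * δ - β * γ = 1
  α_eq : α = a + p * x
  α_mod : 24 ∣ α - 1
  δ_mod : 24 ∣ δ - 1
  β_mod : 24 * (p : ℤ) ^ 3 ∣ β
  γ_mod : 24 * (p : ℤ) ^ 3 ∣ γ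
  γ_ne : γ ≠ 0

lemma coprime_twentyfour {p : ℕ} [Fact p.Prime] (hp : 3 < p) : Nat.Coprime p 24 := by
  rw [(Fact.out : p.Prime).coprime_iff_not_dvd]
  intro h
  rw [show 24 = 2 ^ 3 * 3 by norm_num, (Fact.out : p.Prime).dvd_mul] at h
  rcases h with h | h
  · have := Nat.le_of_dvd (by norm_num) ((Fact.out : p.Prime).dvd_of_dvd_pow h)
    omega
  · have := Nat.le_of_dvd (by norm_num) h
    omega

/-- The Chinese remainder theorem gives α ≡ a mod p and α ≡ 1 mod 24. Then α is prime to 24p, and a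
Bézout relation αu + (24p³)²v = 1 supplies δ = u, β = 24p³, γ = -24p³v. The summand 24p in α forces
α > 1, hence v ≠ 0 and γ ≠ 0. -/
lemma exists_transferMatrix {p a : ℕ} [Fact p.Prime] (hp : 3 < p) (ha1 : 1 ≤ a) (hap : a < p) :
    Nonempty (TransferMatrix p a) := by
  have hpp : p.Prime := Fact.out
  obtain ⟨k, hk1, hk2⟩ := Nat.chineseRemainder (coprime_twentyfour hp) a 1
  set α : ℕ := k + 24 * p with hα
  have hcp : Nat.Coprime α p := by
    rw [Nat.coprime_comm, hpp.coprime_iff_not_dvd]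
    intro h
    have h1 : p ∣ k := by
      rw [hα] at h
      exact (Nat.dvd_add_left (Dvd.intro_left 24 rfl)).mp h
    have h2 : p ∣ a := (Nat.ModEq.dvd_iff hk1 dvd_rfl).mp h1
    have := Nat.le_of_dvd ha1 h2
    omega
  have hc24 : Nat.Coprime α 24 := by
    have : α % 24 = 1 := by
      have : k % 24 = 1 := hk2
      omega
    rw [Nat.Coprime, Nat.gcd_comm, Nat.gcd_rec, this]
    simp
  have hcop : IsCoprime (α : ℤ) ((24 * (p : ℤ) ^ 3) ^ 2) := by
    refine IsCoprime.pow_right (IsCoprime.mul_right ?_ (IsCoprime.pow_right ?_))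
    · exact_mod_cast Nat.isCoprime_iff_coprime.mpr hc24
    · exact Nat.isCoprime_iff_coprime.mpr hcp
  obtain ⟨u, v, huv⟩ := hcop
  have hα24 : (24 : ℤ) ∣ (α : ℤ) - 1 := by
    have : k % 24 = 1 := hk2
    omega
  obtain ⟨x, hx⟩ : (p : ℤ) ∣ (α : ℤ) - a := by
    have h1 := (Nat.modEq_iff_dvd.mp hk1.symm)
    rw [hα]
    push_cast
    obtain ⟨y, hy⟩ := h1
    exact ⟨y + 24, by linear_combination hy⟩
  refine ⟨⟨α, 24 * (p : ℤ) ^ 3, 24 * (p : ℤ) ^ 3 * -v, u, x, by linear_combination huv,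
    by linear_combination hx, hα24, ?_, dvd_rfl, dvd_mul_right _ _, ?_⟩⟩
  · obtain ⟨y, hy⟩ := hα24
    exact ⟨-(y * u) - 24 * p ^ 6 * v, by linear_combination huv - u * hy⟩
  · refine mul_ne_zero (by have := hpp.pos; positivity) (neg_ne_zero.mpr fun hv => ?_)
    rw [hv, zero_mul, add_zero] at huv
    have := Int.isUnit_iff.mp (IsUnit.of_mul_eq_one_right u huv)
    omega

end TransferMatrix

/-! ### Eta products in terms of Klein forms -/

section ProductFormulas

open Complex

lemma norm_nome_lt_one (z : ℍ) : ‖nome z‖ < 1 := norm_exp_two_pi_I_mul_lt_one z.im_pos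

lemma nome_ne_zero (z : ℍ) : nome z ≠ 0 := exp_ne_zero _

lemma eta_eq_qinf (τ : ℂ) : ModularForm.eta τ =
    exp (2 * Real.pi * I * τ / 24) * qinf (exp (2 * Real.pi * I * τ)) (exp (2 * Real.pi * I * τ)) := by
  rw [ModularForm.eta, Function.Periodic.qParam, qinf]
  simp_rw [ModularForm.eta_q_eq_pow, pow_succ']
  norm_num

lemma eta_ne_zero (τ : ℍ) : ModularForm.eta τ ≠ 0 := ModularForm.eta_ne_zero τ.im_pos

lemma thetaOne_eq_qinf (z τ : ℂ) (hτ : 0 < τ.im) :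
    thetaOne z τ = exp (Real.pi * I * τ / 4 + Real.pi * I * z) * (1 - (exp (2 * Real.pi * I * z))⁻¹) *
      qinf (exp (2 * Real.pi * I * τ)) (exp (2 * Real.pi * I * τ)) *
      (qinf (exp (2 * Real.pi * I * z) * exp (2 * Real.pi * I * τ)) (exp (2 * Real.pi * I * τ)) *
        qinf ((exp (2 * Real.pi * I * z))⁻¹ * exp (2 * Real.pi * I * τ))
          (exp (2 * Real.pi * I * τ))) := by
  rw [thetaOne, jacobiTheta₂_eq_qinf z τ hτ,
    qinf_succ (exp (2 * Real.pi * I * z))⁻¹ (norm_exp_two_pi_I_mul_lt_one hτ)]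
  ring

variable {p : ℕ}

/-- The theta function `f_{p,k}` as a function of `τ = p z`, for all integers `k`. -/
noncomputable def kleinTheta (p : ℕ) (k : ℤ) (τ : ℂ) : ℂ :=
  -klein ((k : ℂ) / p) 0 τ * ModularForm.eta τ ^ 3

lemma kleinTheta_add (hp : p ≠ 0) (k : ℤ) (τ : ℂ) : kleinTheta p (k + p) τ = -kleinTheta p k τ := by
  have : ((k + p : ℤ) : ℂ) / p = (k : ℂ) / p + 1 := by
    push_cast
    field_simp
  rw [kleinTheta, kleinTheta, this, klein_add_one_left]
  simp

lemma kleinTheta_neg (k : ℤ) (τ : ℂ) : kleinTheta p (-k) τ = -kleinTheta p k τ := by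
  have h := klein_neg ((k : ℂ) / p) 0 τ
  rw [neg_zero] at h
  rw [kleinTheta, kleinTheta, Int.cast_neg, neg_div, h]
  ring

/-- The triple product at the point kz with period pz. The theta function carries 1 - q^{-k} where
f_{p,k} has 1 - q^k; this is the source of the minus sign in `kleinTheta`. -/
lemma biagioli_eq_kleinTheta {k : ℤ} (hk0 : 0 < k) (hkp : k < p) (z : ℍ) :
    biagioli p k z = kleinTheta p k (p * z) := by
  have hp0 : (p : ℂ) ≠ 0 := by
    have : p ≠ 0 := by omega
    exact_mod_cast this
  have hpos : (0 : ℝ) < p := by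
    have : 0 < p := by omega
    exact_mod_cast this
  have hτ : 0 < ((p : ℂ) * z).im := by
    rw [← ofReal_natCast, im_ofReal_mul]
    exact mul_pos hpos z.im_pos
  have hη : ModularForm.eta (p * z) ≠ 0 := ModularForm.eta_ne_zero hτ
  have hq : exp (2 * Real.pi * I * (p * z)) = nome z ^ (p : ℤ) := by
    rw [nome, ← exp_int_mul]
    congr 1
    push_cast
    ring
  have hw : exp (2 * Real.pi * I * (k * z)) = nome z ^ k := by
    rw [nome, ← exp_int_mul]
    congr 1
    ring
  have hn := nome_ne_zero z
  have e0 : ∀ ρ : ℤ, ∏' j : ℕ, (1 - nome z ^ (ρ + (p : ℤ) * j)) =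
      qinf (nome z ^ ρ) (nome z ^ (p : ℤ)) := fun ρ => by
    rw [qinf]
    refine tprod_congr fun j => ?_
    rw [zpow_add₀ hn, zpow_mul, zpow_natCast (nome z ^ (p : ℤ)) j]
  have hq1 : ‖nome z ^ (p : ℤ)‖ < 1 := by
    rw [← hq]
    exact norm_exp_two_pi_I_mul_lt_one hτ
  rw [biagioli, e0, e0, e0, Int.ediv_eq_zero_of_lt hk0.le hkp, kleinTheta, klein, neg_mul,
    div_mul_cancel₀ _ (pow_ne_zero 3 hη), show (k : ℂ) / p * (p * z) + 0 = k * z by field_simp; ring,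
    thetaOne_eq_qinf _ _ hτ, hq, hw, qinf_succ (nome z ^ k) hq1, ← zpow_add₀ hn, ← zpow_neg, ← zpow_add₀ hn,
    show -k + (p : ℤ) = p - k by ring]
  have e1 : exp (2 * Real.pi * I * z * (((p : ℂ) - 2 * k) ^ 2 / (8 * p))) * (1 - nome z ^ k) =
      -(exp (Real.pi * I * ((k : ℂ) / p * (k * z))) * (exp (Real.pi * I * (p * z) / 4 +
        Real.pi * I * (k * z)) * (1 - nome z ^ (-k)))) := by
    have e2 : exp (2 * Real.pi * I * z * (((p : ℂ) - 2 * k) ^ 2 / (8 * p))) =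
        exp (Real.pi * I * ((k : ℂ) / p * (k * z))) * (exp (Real.pi * I * (p * z) / 4 +
        Real.pi * I * (k * z)) * nome z ^ (-k)) := by
      rw [nome, ← exp_int_mul, ← exp_add, ← exp_add]
      congr 1
      field_simp
      push_cast
      ring
    have e3 : nome z ^ (-k) * nome z ^ k = 1 := by
      rw [← zpow_add₀ hn]
      simp
    rw [e2]
    linear_combination (-exp (Real.pi * I * ((k : ℂ) / p * (k * z))) *
      exp (Real.pi * I * (p * z) / 4 + Real.pi * I * (k * z))) * e3
  rw [zpow_zero, one_mul]
  linear_combination (qinf (nome z ^ (k + (p : ℤ))) (nome z ^ (p : ℤ)) *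
    qinf (nome z ^ ((p : ℤ) - k)) (nome z ^ (p : ℤ)) *
    qinf (nome z ^ (p : ℤ)) (nome z ^ (p : ℤ))) * e1

lemma etaProduct_eq (n : ExpVec p) (z : ℍ) :
    etaProduct p n z = ModularForm.eta (p * z) ^ n 0 *
      ∏ k : Fin (p / 2), kleinTheta p ((k : ℤ) + 1) (p * z) ^ n k.succ := by
  rw [etaProduct]
  congr 1
  refine Finset.prod_congr rfl fun k _ => ?_
  rw [biagioli_eq_kleinTheta (by positivity)]
  have := k.2
  omega

end ProductFormulas

/-! ### Action of the transfer matrix on eta products -/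

section EtaProductTransfer

open Complex

variable {p a : ℕ}

/-- The point `p z` of the upper half-plane. -/
noncomputable def scale (p : ℕ) [NeZero p] (z : ℍ) : ℍ :=
  ⟨p * z, by
    rw [← ofReal_natCast, im_ofReal_mul]
    exact mul_pos (by exact_mod_cast Nat.pos_of_ne_zero (NeZero.ne p)) z.im_pos⟩

lemma coe_scale [NeZero p] (z : ℍ) : (scale p z : ℂ) = p * z := rfl

/-- The weight (times two) of an eta product. -/
def expWeight (n : ExpVec p) : ℤ := n 0 + ∑ k : Fin (p / 2), n k.succ

namespace TransferMatrix

variable (A : TransferMatrix p a)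

lemma denom_ne_zero (z : ℍ) : (A.γ : ℂ) * z + A.δ ≠ 0 := int_denom_ne_zero (Or.inl A.γ_ne) z

/-- `z'` is the image of `z` under the matrix. -/
def Maps (z z' : ℍ) : Prop := (z' : ℂ) * (A.γ * z + A.δ) = A.α * z + A.β

/-- The automorphy factor of weight `1/2`, with the multiplier system of `η`. -/
noncomputable def factor (z z' : ℍ) : ℂ := ModularForm.eta (p * z') / ModularForm.eta (p * z)

lemma exists_gamma_eq : ∃ c, A.γ = p * (24 * p ^ 2 * c) := by
  obtain ⟨c, hc⟩ := A.γ_mod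
  exact ⟨c, by rw [hc]; ring⟩

variable {A} [Fact p.Prime]

lemma Maps.scale {z z' : ℍ} (h : A.Maps z z') {γ' : ℤ} (hγ : A.γ = p * γ') :
    (scale p z' : ℂ) * (γ' * scale p z + A.δ) = A.α * scale p z + (p * A.β : ℤ) := by
  rw [Maps] at h
  rw [coe_scale, coe_scale]
  have : (A.γ : ℂ) = p * γ' := by exact_mod_cast hγ
  rw [this] at h
  push_cast
  linear_combination (p : ℂ) * h

lemma eta_scale_ne_zero (z : ℍ) : ModularForm.eta (p * z) ≠ 0 := by
  have := eta_ne_zero (CrankDissection.scale p z)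
  rwa [coe_scale] at this

lemma factor_ne_zero (z z' : ℍ) : (factor (p := p) z z') ≠ 0 :=
  div_ne_zero (eta_scale_ne_zero z') (eta_scale_ne_zero z)

/-- On pz the matrix acts as (α, pβ; γ/p, δ), still congruent to the identity mod 24, so η² has
trivial multiplier there. -/
lemma Maps.factor_sq {z z' : ℍ} (h : A.Maps z z') :
    factor (p := p) z z' ^ 2 = A.γ * z + A.δ := by
  obtain ⟨c, hc⟩ := A.exists_gamma_eq
  have h1 := eta_sq_mobius (a := A.α) (b := p * A.β) (c := 24 * p ^ 2 * c) (d := A.δ)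
    (by linear_combination A.det + A.β * hc) A.α_mod
    (Dvd.dvd.mul_left ((Dvd.intro _ rfl).trans A.β_mod) _) ⟨p ^ 2 * c, by ring⟩ A.δ_mod (h.scale hc)
  have h2 : (A.γ : ℂ) * z = ((24 * p ^ 2 * c : ℤ) : ℂ) * CrankDissection.scale p z := by
    rw [hc, coe_scale]
    push_cast
    ring
  rw [factor, div_pow, div_eq_iff (pow_ne_zero 2 (eta_scale_ne_zero z)), h2]
  exact h1

/-- The characteristic (k/p, 0) goes to (αk/p, kβ), and the integer kβ can be dropped without a root
of unity since β is divisible by 24p³. The Klein form contributes factor⁻² and η³ contributes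
factor³. -/
lemma Maps.kleinTheta {z z' : ℍ} (h : A.Maps z z') (k : ℤ) :
    kleinTheta p k (p * z') = factor (p := p) z z' * kleinTheta p (A.α * k) (p * z) := by
  obtain ⟨c, hc⟩ := A.exists_gamma_eq
  obtain ⟨b, hb⟩ := A.β_mod
  have hp0 : (p : ℂ) ≠ 0 := by exact_mod_cast (Fact.out : p.Prime).ne_zero
  have h1 := klein_mobius (a := A.α) (b := p * A.β) (c := 24 * p ^ 2 * c) (d := A.δ)
    (by linear_combination A.det + A.β * hc) ((k : ℂ) / p) 0 (h.scale hc)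
  have h2 : (A.γ : ℂ) * z = ((24 * p ^ 2 * c : ℤ) : ℂ) * CrankDissection.scale p z := by
    rw [hc, coe_scale]
    push_cast
    ring
  rw [← h2, ← h.factor_sq] at h1
  have h3 : klein ((k : ℂ) / p * A.α + 0 * (24 * p ^ 2 * c : ℤ))
      ((k : ℂ) / p * (p * A.β : ℤ) + 0 * A.δ) (CrankDissection.scale p z) =
      klein ((A.α * k : ℤ) / p) 0 (CrankDissection.scale p z) := by
    have e1 : (k : ℂ) / p * (p * A.β : ℤ) + 0 * A.δ = 0 + (k * A.β : ℤ) := by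
      push_cast
      field_simp
      ring
    have e2 : (k : ℂ) / p * A.α + 0 * (24 * p ^ 2 * c : ℤ) = (A.α * k : ℤ) / p := by
      push_cast
      ring
    rw [e1, e2, klein_add_int_right]
    have e3 : (-exp (Real.pi * I * ((A.α * k : ℤ) / p))) ^ (k * A.β) = 1 := by
      have : k * A.β = 2 * (12 * p ^ 3 * b * k) := by rw [hb]; ring
      rw [this, zpow_mul, zpow_ofNat, neg_sq, ← exp_nat_mul, ← exp_int_mul,
        show ((12 * p ^ 3 * b * k : ℤ) : ℂ) * (((2 : ℕ) : ℂ) * (Real.pi * I * ((A.α * k : ℤ) / p))) =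
          (12 * p ^ 2 * b * k * A.α * k : ℤ) * (2 * Real.pi * I) by
            push_cast; field_simp, exp_int_mul_two_pi_mul_I]
    rw [e3, one_mul]
  rw [h3] at h1
  have hf := factor_ne_zero (p := p) z z'
  have h4 : ModularForm.eta (p * z') = factor (p := p) z z' * ModularForm.eta (p * z) :=
    (div_mul_cancel₀ _ (eta_scale_ne_zero z)).symm
  rw [coe_scale, coe_scale] at h1
  rw [CrankDissection.kleinTheta, CrankDissection.kleinTheta, h1, h4]
  field_simp

lemma natCast_ne_zero (ha1 : 1 ≤ a) (hap : a < p) : (a : ZMod p) ≠ 0 := by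
  rw [Ne, ZMod.natCast_eq_zero_iff]
  intro h
  have := Nat.le_of_dvd ha1 h
  omega

lemma alpha_cast (A : TransferMatrix p a) : ((A.α : ℤ) : ZMod p) = a := by
  rw [A.α_eq]
  simp

/-- In α = a + px both α and p are odd. This parity turns the sign built from ⌊αk/p⌋ into the one
built from (a + 1)k + ⌊ak/p⌋, which no longer depends on the matrix. -/
lemma even_x_add (A : TransferMatrix p a) (hp : 3 < p) : Even (A.x + a + 1) := by
  have hodd : p % 2 = 1 := by
    rcases (Fact.out : p.Prime).eq_two_or_odd with h | h
    · omega
    · exact h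
  obtain ⟨u, hu⟩ := A.α_mod
  rw [A.α_eq] at hu
  obtain ⟨t, ht⟩ : ∃ t : ℤ, (p : ℤ) = 2 * t + 1 := ⟨p / 2, by omega⟩
  rw [ht] at hu
  exact ⟨12 * u + 1 - t * A.x, by linear_combination hu⟩

lemma Maps.etaProduct (hp : 3 < p) (ha1 : 1 ≤ a) (hap : a < p) {z z' : ℍ} (h : A.Maps z z')
    (n : ExpVec p) :
    etaProduct p n z' = factor (p := p) z z' ^ expWeight n * transferSign p a n *
      etaProduct p (permVec p a n) z := by
  have hf := factor_ne_zero (p := p) z z'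
  have hp0 : p ≠ 0 := by omega
  have h4 : ModularForm.eta (p * z') = factor (p := p) z z' * ModularForm.eta (p * z) :=
    (div_mul_cancel₀ _ (eta_scale_ne_zero z)).symm
  rw [etaProduct_eq, etaProduct_eq, h4, permVec_zero]
  simp_rw [h.kleinTheta, mul_zpow]
  rw [Finset.prod_mul_distrib, prod_antiperiodic (r := a) (G := fun k => CrankDissection.kleinTheta p k (p * z)) hp
    (fun k => kleinTheta_add hp0 k _) (fun k => kleinTheta_neg k _) A.alpha_cast
    (natCast_ne_zero ha1 hap)]
  have hpow : ∀ (s : Finset (Fin (p / 2))) (y : ℂ) (f : Fin (p / 2) → ℤ), y ≠ 0 →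
      y ^ (∑ k ∈ s, f k) = ∏ k ∈ s, y ^ f k := fun s y f hy => by
    classical
    induction s using Finset.induction_on with
    | empty => simp
    | insert a s ha ih => rw [Finset.sum_insert ha, Finset.prod_insert ha, zpow_add₀ hy, ih]
  have hsign : (-1 : ℂ) ^ (∑ k : Fin (p / 2), (A.α * ((k : ℤ) + 1)) / (p : ℤ) * n k.succ) =
      transferSign p a n := by
    have hm1 : (-1 : ℂ) ≠ 0 := by norm_num
    rw [transferSign, hpow _ _ _ hm1, hpow _ _ _ hm1]
    refine Finset.prod_congr rfl fun k _ => ?_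
    rw [zpow_mul, zpow_mul]
    congr 1
    have e1 : (A.α * ((k : ℤ) + 1)) / (p : ℤ) = A.x * ((k : ℤ) + 1) + (a * ((k : ℤ) + 1)) / (p : ℤ) := by
      rw [A.α_eq, show ((a : ℤ) + p * A.x) * ((k : ℤ) + 1) =
        a * ((k : ℤ) + 1) + p * (A.x * ((k : ℤ) + 1)) by ring,
        Int.add_mul_ediv_left _ _ (by exact_mod_cast hp0)]
      ring
    rw [e1]
    obtain ⟨y, hy⟩ := A.even_x_add hp
    have e2 : A.x = -((a : ℤ) + 1) + 2 * y := by omega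
    rw [e2, show (-((a : ℤ) + 1) + 2 * y) * ((k : ℤ) + 1) + a * ((k : ℤ) + 1) / (p : ℤ) =
      ((a : ℤ) + 1) * ((k : ℤ) + 1) + a * ((k : ℤ) + 1) / (p : ℤ) +
        2 * (y * ((k : ℤ) + 1) - (a + 1) * (k + 1)) by ring, zpow_add₀ hm1, zpow_mul _ 2]
    norm_num
  rw [hsign, ← hpow _ _ _ hf, expWeight, zpow_add₀ hf]
  ring

end TransferMatrix

end EtaProductTransfer

/-! ### The eta quotients η(pw)/η(w) and η(p²w)/η(w) -/

section EtaQuotient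

open Complex

variable {p : ℕ}

lemma zeta_isPrimitiveRoot (hp : p ≠ 0) : IsPrimitiveRoot (zeta p) p :=
  Complex.isPrimitiveRoot_exp p hp

lemma zeta_pow (p l : ℕ) : zeta p ^ l = exp (2 * Real.pi * I * ((l : ℂ) / p)) := by
  rw [zeta, ← exp_nat_mul]
  congr 1
  ring

lemma prime_two_mul_half_add_one [Fact p.Prime] (hp : 3 < p) : p = p / 2 + p / 2 + 1 := by
  rcases (Fact.out : p.Prime).eq_two_or_odd with h | h <;> omega

lemma prod_one_sub_root_mul {ζ : ℂ} (hp : 0 < p) (h : IsPrimitiveRoot ζ p) (x : ℂ) :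
    ∏ k ∈ Finset.range p, (1 - ζ ^ k * x) = 1 - x ^ p := by
  have := h.pow_sub_pow_eq_prod_sub_mul 1 x hp
  rw [one_pow] at this
  rw [this]
  refine Finset.prod_nbij (fun k => ζ ^ k) (fun k _ => ?_) (fun k hk l hl hkl => ?_)
    (fun y hy => ?_) fun _ _ => rfl
  · rw [Polynomial.mem_nthRootsFinset hp, ← pow_mul, mul_comm, pow_mul, h.pow_eq_one, one_pow]
  · exact h.pow_inj (by simpa using hk) (by simpa using hl) hkl
  · have hy' : y ^ p = 1 := (Polynomial.mem_nthRootsFinset hp _).mp hy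
    have : NeZero p := ⟨hp.ne'⟩
    obtain ⟨i, hi, rfl⟩ := h.eq_pow_of_pow_eq_one hy'
    exact ⟨i, by simpa using hi, rfl⟩

lemma prod_qinf_root {ζ Q : ℂ} (hp : 0 < p) (h : IsPrimitiveRoot ζ p) (hQ : ‖Q‖ < 1) :
    ∏ k ∈ Finset.range p, qinf (ζ ^ k * Q) Q = qinf (Q ^ p) (Q ^ p) := by
  have hQp : ‖Q ^ p‖ < 1 := by
    rw [norm_pow]
    exact pow_lt_one₀ (norm_nonneg _) hQ hp.ne'
  have h1 := tendsto_finsetProd (Finset.range p) fun k _ => tendsto_qfin (ζ ^ k * Q) hQ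
  refine tendsto_nhds_unique h1 ((tendsto_qfin (Q ^ p) hQp).congr fun n => ?_)
  simp only [qfin]
  rw [Finset.prod_comm]
  refine Finset.prod_congr rfl fun i _ => ?_
  have := prod_one_sub_root_mul hp h (Q ^ (i + 1))
  rw [show Q ^ p * (Q ^ p) ^ i = (Q ^ (i + 1)) ^ p by ring, ← this]
  refine Finset.prod_congr rfl fun k _ => ?_
  ring

/-- The function `(ω q)_∞ (ω⁻¹ q)_∞`. -/
noncomputable def qinfPair (ω Q : ℂ) : ℂ := qinf (ω * Q) Q * qinf (ω⁻¹ * Q) Q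

/-- In the product over all p-th roots of unity, k and p - k have inverse roots and form one pair; k
= 0 is left alone. -/
lemma prod_qinfPair_root [Fact p.Prime] {ζ Q : ℂ} (hp : 3 < p) (h : IsPrimitiveRoot ζ p) (hQ : ‖Q‖ < 1) :
    qinf Q Q * ∏ k : Fin (p / 2), qinfPair (ζ ^ ((k : ℕ) + 1)) Q = qinf (Q ^ p) (Q ^ p) := by
  have hp0 : 0 < p := by omega
  rw [← prod_qinf_root hp0 h hQ]
  have e := prime_two_mul_half_add_one hp
  conv_rhs => rw [e]
  rw [Finset.prod_range_succ', Finset.prod_range_add, mul_comm (qinf Q Q)]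
  simp only [qinfPair]
  rw [Finset.prod_mul_distrib, Fin.prod_univ_eq_prod_range (fun k => qinf (ζ ^ (k + 1) * Q) Q),
    Fin.prod_univ_eq_prod_range (fun k => qinf ((ζ ^ (k + 1))⁻¹ * Q) Q),
    ← Finset.prod_range_reflect (fun k => qinf (ζ ^ (p / 2 + k + 1) * Q) Q)]
  congr 1
  · congr 1
    refine Finset.prod_congr rfl fun k hk => ?_
    have hk' := Finset.mem_range.mp hk
    congr 2
    refine inv_eq_of_mul_eq_one_right ?_
    rw [← pow_add]
    convert h.pow_eq_one using 2
    omega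
  · simp

/-- The constants relating Klein forms and `q`-products. -/
noncomputable def sinConst (s : ℂ) : ℂ := 2 * I * sin (Real.pi * s)

lemma klein_zero_left (s : ℂ) (w : ℍ) :
    klein 0 s w * ModularForm.eta w ^ 2 = sinConst s * exp (2 * Real.pi * I * w / 12) *
      qinfPair (exp (2 * Real.pi * I * s)) (nome w) := by
  have hη := eta_ne_zero w
  have h1 : exp (Real.pi * I * s) * (1 - (exp (2 * Real.pi * I * s))⁻¹) = sinConst s := by
    rw [sinConst, sin, mul_sub, ← exp_neg, ← exp_add, mul_one,
      show Real.pi * I * s + -(2 * Real.pi * I * s) = -(Real.pi * s) * I by ring,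
      show Real.pi * I * s = Real.pi * s * I by ring]
    have := I_sq
    linear_combination (-exp (-(Real.pi * s) * I) + exp (Real.pi * s * I)) * this
  have h2 : exp (Real.pi * I * w / 4 + Real.pi * I * s) = exp (2 * Real.pi * I * w / 12) *
      exp (2 * Real.pi * I * w / 24) * exp (Real.pi * I * s) := by
    rw [← exp_add, ← exp_add]
    congr 1
    ring
  rw [klein, show (0 : ℂ) * w + s = s by ring, zero_mul, mul_zero, exp_zero, one_mul, thetaOne_eq_qinf _ _ w.im_pos,
    h2, qinfPair, ← h1, nome]
  have h3 := eta_eq_qinf w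
  field_simp
  rw [h3]
  ring

/-- The eta quotient `η(pτ) / η(τ)`. -/
noncomputable def etaQuot (p : ℕ) (w : ℂ) : ℂ := ModularForm.eta (p * w) / ModularForm.eta w

lemma sinConst_ne_zero {l : ℕ} (h0 : 0 < l) (hl : l < p) : sinConst ((l : ℂ) / p) ≠ 0 := by
  have hp : (0 : ℝ) < p := by exact_mod_cast h0.trans hl
  have hl' : (l : ℝ) < p := by exact_mod_cast hl
  have hl0 : (0 : ℝ) < l := by exact_mod_cast h0
  have h1 : Real.sin (Real.pi * (l / p)) ≠ 0 := by
    refine (Real.sin_pos_of_pos_of_lt_pi (by positivity) ?_).ne'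
    have : (l : ℝ) / p < 1 := (div_lt_one hp).mpr hl'
    nlinarith [Real.pi_pos]
  have h2 : sin (Real.pi * ((l : ℂ) / p)) ≠ 0 := by
    rw [show (Real.pi : ℂ) * ((l : ℂ) / p) = ((Real.pi * (l / p) : ℝ) : ℂ) by push_cast; ring,
      ← ofReal_sin]
    exact_mod_cast h1
  exact mul_ne_zero (mul_ne_zero two_ne_zero I_ne_zero) h2

/-- This writes η(pw)/η(w) through Klein forms, whose transformation merely permutes them up to
sign. The multiplier of the quotient is thus obtained without Dedekind sums. -/
lemma prod_klein_zero [Fact p.Prime] (hp : 3 < p) (w : ℍ) :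
    ∏ k : Fin (p / 2), (klein 0 (((k : ℤ) + 1 : ℤ) / p) w * ModularForm.eta w ^ 2) =
      (∏ k : Fin (p / 2), sinConst (((k : ℕ) + 1 : ℕ) / p)) * etaQuot p w := by
  have hp0 : p ≠ 0 := by omega
  have hQ := norm_nome_lt_one w
  have hQ0 : qinf (nome w) (nome w) ≠ 0 := qinf_ne_zero_of_norm_lt hQ hQ
  have h1 : ∀ k : Fin (p / 2), klein 0 (((k : ℤ) + 1 : ℤ) / p) w * ModularForm.eta w ^ 2 =
      sinConst (((k : ℕ) + 1 : ℕ) / p) * exp (2 * Real.pi * I * w / 12) *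
      qinfPair (zeta p ^ ((k : ℕ) + 1)) (nome w) := fun k => by
    rw [klein_zero_left, zeta_pow]
    push_cast
    rfl
  simp_rw [h1]
  rw [Finset.prod_mul_distrib, Finset.prod_mul_distrib, mul_assoc]
  congr 1
  have h2 := prod_qinfPair_root hp (zeta_isPrimitiveRoot hp0) hQ
  have h3 : exp (2 * Real.pi * I * (p * w)) = nome w ^ p := by
    rw [nome, ← exp_nat_mul]
    congr 1
    ring
  rw [etaQuot, eta_eq_qinf, eta_eq_qinf, h3, ← h2, Finset.prod_const, Finset.card_univ,
    Fintype.card_fin, ← exp_nat_mul]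
  have e := prime_two_mul_half_add_one hp
  have e' : (p : ℂ) = 2 * ((p / 2 : ℕ) : ℂ) + 1 := by
    have : ((p : ℕ) : ℂ) = ((p / 2 + p / 2 + 1 : ℕ) : ℂ) := by rw [← e]
    rw [this]
    push_cast
    ring
  have h4 : exp (2 * Real.pi * I * (p * w) / 24) = exp ((p / 2 : ℕ) * (2 * Real.pi * I * w / 12)) *
      exp (2 * Real.pi * I * w / 24) := by
    rw [← exp_add, e']
    congr 1
    ring
  rw [h4]
  have h5 := exp_ne_zero (2 * Real.pi * I * w / 24)
  have h6 : exp (2 * Real.pi * I * w) = nome w := rfl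
  rw [h6]
  field_simp

lemma klein_zero_antiperiodic_add (hp : p ≠ 0) (w : ℂ) (k : ℤ) :
    klein 0 ((k + p : ℤ) / p) w = -klein 0 ((k : ℂ) / p) w := by
  have : ((k + p : ℤ) : ℂ) / p = (k : ℂ) / p + 1 := by
    push_cast
    have : (p : ℂ) ≠ 0 := by exact_mod_cast hp
    field_simp
  rw [this, klein_add_one_right]
  simp

lemma klein_zero_antiperiodic_neg (w : ℂ) (k : ℤ) :
    klein 0 ((-k : ℤ) / p) w = -klein 0 ((k : ℂ) / p) w := by
  have h := klein_neg 0 ((k : ℂ) / p) w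
  rw [neg_zero] at h
  rw [Int.cast_neg, neg_div, h]

variable [Fact p.Prime]

lemma klein_zero_mobius {a b c d : ℤ} (h : a * d - b * c = 1) (hc : 2 * (p : ℤ) ^ 2 ∣ c)
    {w w' : ℍ} (hw : (w' : ℂ) * (c * w + d) = a * w + b) (k : ℤ) :
    klein 0 ((k : ℂ) / p) w' = ((c : ℂ) * w + d)⁻¹ * klein 0 ((d * k : ℤ) / p) w := by
  obtain ⟨e, he⟩ := hc
  have hp0 : (p : ℂ) ≠ 0 := by exact_mod_cast (Fact.out : p.Prime).ne_zero
  rw [klein_mobius h 0 _ hw]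
  congr 1
  have e1 : 0 * (a : ℂ) + k / p * c = 0 + (2 * (p * e * k) : ℤ) := by
    rw [he]
    push_cast
    field_simp
    ring
  have e2 : 0 * (b : ℂ) + k / p * d = (d * k : ℤ) / p := by
    push_cast
    ring
  rw [e1, e2, klein_add_int_left, zpow_mul, zpow_ofNat, neg_sq, ← exp_nat_mul, ← exp_int_mul,
    show ((p * e * k : ℤ) : ℂ) * (((2 : ℕ) : ℂ) * -(Real.pi * I * ((d * k : ℤ) / p))) =
      (-(e * k * (d * k)) : ℤ) * (2 * Real.pi * I) by push_cast; field_simp,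
    exp_int_mul_two_pi_mul_I, one_mul]

lemma etaQuot_mobius (hp : 3 < p) {a b c d : ℤ} (h : a * d - b * c = 1) (ha : 24 ∣ a - 1)
    (hb : 24 ∣ b) (hc : 24 * (p : ℤ) ^ 2 ∣ c) (hd : 24 ∣ d - 1)
    {w w' : ℍ} (hw : (w' : ℂ) * (c * w + d) = a * w + b) :
    etaQuot p w' = (-1) ^ (∑ k : Fin (p / 2), (d * ((k : ℤ) + 1)) / (p : ℤ)) * etaQuot p w := by
  have hp0 : p ≠ 0 := by omega
  have hc24 : 24 ∣ c := (Dvd.intro _ rfl).trans hc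
  have hc2 : 2 * (p : ℤ) ^ 2 ∣ c := (mul_dvd_mul_right (by norm_num) _).trans hc
  have hpc : (p : ℤ) ∣ c := (Dvd.intro_left (24 * (p : ℤ)) (by ring)).trans hc
  have hη := eta_sq_mobius h ha hb hc24 hd hw
  have hD : (c : ℂ) * w + d ≠ 0 := by
    refine int_denom_ne_zero ?_ w
    by_contra hcon
    push Not at hcon
    rw [hcon.1, hcon.2] at h
    simp at h
  have hd0 : ((d : ℤ) : ZMod p) ≠ 0 := by
    intro h0
    have h1 := congrArg (Int.cast : ℤ → ZMod p) h
    have h2 : ((c : ℤ) : ZMod p) = 0 := (ZMod.intCast_zmod_eq_zero_iff_dvd c p).mpr hpc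
    push_cast at h1
    rw [h0, h2] at h1
    simp at h1
  have hr : ((d : ℤ) : ZMod p) = ((((d : ℤ) : ZMod p).val : ℕ) : ZMod p) :=
    (ZMod.natCast_zmod_val _).symm
  have hprod := prod_antiperiodic hp (G := fun k => klein 0 ((k : ℂ) / p) w)
    (klein_zero_antiperiodic_add hp0 w) (klein_zero_antiperiodic_neg w) hr (hr ▸ hd0) (fun _ => 1)
  have h1 := prod_klein_zero hp w
  have h2 := prod_klein_zero hp w'
  simp only [permVec, zpow_one, mul_one] at hprod
  have h3 : ∀ k : Fin (p / 2), klein 0 (((k : ℤ) + 1 : ℤ) / p) w' * ModularForm.eta w' ^ 2 =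
      klein 0 ((d * ((k : ℤ) + 1) : ℤ) / p) w * ModularForm.eta w ^ 2 := fun k => by
    rw [klein_zero_mobius h hc2 hw, hη]
    field_simp
  have hκ : (∏ k : Fin (p / 2), sinConst (((k : ℕ) + 1 : ℕ) / p)) ≠ 0 :=
    Finset.prod_ne_zero_iff.mpr fun k _ => sinConst_ne_zero (Nat.succ_pos _) (by have := k.2; omega)
  apply mul_left_cancel₀ hκ
  rw [← h2, Finset.prod_congr rfl fun k _ => h3 k, Finset.prod_mul_distrib, hprod, mul_left_comm, ← h1,
    Finset.prod_mul_distrib]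
  ring

/-- The eta quotient `η(p²τ) / η(τ)` is invariant. -/
lemma etaQuot_mul_mobius (hp : 3 < p) {a b c d : ℤ} (h : a * d - b * c = 1) (ha : 24 ∣ a - 1)
    (hb : 24 ∣ b) (hc : 24 * (p : ℤ) ^ 3 ∣ c) (hd : 24 ∣ d - 1)
    {w w' : ℍ} (hw : (w' : ℂ) * (c * w + d) = a * w + b) :
    etaQuot p w' * etaQuot p (scale p w') = etaQuot p w * etaQuot p (scale p w) := by
  obtain ⟨e, he⟩ := hc
  have hw2 : (scale p w' : ℂ) * ((24 * p ^ 2 * e : ℤ) * scale p w + d) =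
      a * scale p w + (p * b : ℤ) := by
    rw [coe_scale, coe_scale]
    rw [he] at hw
    push_cast at hw ⊢
    linear_combination (p : ℂ) * hw
  -- The sign of the quotient depends only on d, which is the same for the matrices acting on w and
  -- on pw, so it occurs twice and cancels. Passing to pw divides c by p, hence the cube of p in the
  -- hypothesis.
  rw [etaQuot_mobius hp h ha hb ⟨p * e, by rw [he]; ring⟩ hd hw,
    etaQuot_mobius hp (by rw [he] at h; linear_combination h) ha (hb.mul_left _)
      (Dvd.intro _ rfl) hd hw2, mul_mul_mul_comm, ← zpow_add₀ (by norm_num), ← two_mul, zpow_mul]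
  norm_num

end EtaQuotient

/-! ### Dissection elements as Fourier sums, and their transformation -/

section DissectionTransfer

open Complex

variable {p : ℕ} [Fact p.Prime]

/-- The point `(z + 24 j) / p` of the upper half-plane. -/
noncomputable def shift (p : ℕ) [NeZero p] (z : ℍ) (j : ℤ) : ℍ :=
  ⟨(z + 24 * j) / p, by
    rw [← ofReal_natCast, div_ofReal_im]
    refine div_pos ?_ (by exact_mod_cast Nat.pos_of_ne_zero (NeZero.ne p))
    have : ((24 : ℂ) * j).im = 0 := by simp
    rw [add_im, this, add_zero]
    exact z.im_pos⟩

lemma coe_shift (z : ℍ) (j : ℤ) : (shift p z j : ℂ) = (z + 24 * j) / p := rfl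

lemma nome_shift_pow (z : ℍ) (j : ℤ) : nome (shift p z j) ^ p = nome z := by
  have hp0 : (p : ℂ) ≠ 0 := by exact_mod_cast (Fact.out : p.Prime).ne_zero
  rw [nome, coe_shift, ← exp_nat_mul, nome, show (p : ℂ) * (2 * Real.pi * I * ((z + 24 * j) / p)) =
    2 * Real.pi * I * z + (24 * j : ℤ) * (2 * Real.pi * I) by push_cast; field_simp, exp_add,
    exp_int_mul_two_pi_mul_I, mul_one]

lemma nome_shift (z : ℍ) (j : ℤ) :
    nome (shift p z j) = exp (2 * Real.pi * I * z / p) * zeta p ^ (24 * j) := by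
  rw [nome, coe_shift, zeta, ← exp_int_mul, ← exp_add]
  congr 1
  push_cast
  ring

/-- The crank generating function at a root of unity, times `(q^{p²})_∞` and a power of `q`. -/
noncomputable def crankForm (p : ℕ) (ω : ℂ) (w : ℍ) : ℂ :=
  nome w ^ ((p ^ 2 - 1) / 24) * qinf (nome w ^ p ^ 2) (nome w ^ p ^ 2) *
    (qinf (nome w) (nome w) / qinfPair ω (nome w))

lemma qinfPair_ne_zero {ω Q : ℂ} (hω : ‖ω‖ = 1) (hQ : ‖Q‖ < 1) : qinfPair ω Q ≠ 0 :=
  mul_ne_zero (qinf_ne_zero_of_norm_lt hQ (by rwa [norm_mul, hω, one_mul]))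
    (qinf_ne_zero_of_norm_lt hQ (by rwa [norm_mul, norm_inv, hω, inv_one, one_mul]))

lemma norm_zeta_pow (l : ℕ) : ‖zeta p ^ l‖ = 1 := by
  rw [norm_pow, (zeta_isPrimitiveRoot (Fact.out : p.Prime).ne_zero).norm'_eq_one
    (Fact.out : p.Prime).ne_zero, one_pow]

lemma twentyfour_dvd_sq_sub_one (hp : 3 < p) : 24 * ((p ^ 2 - 1) / 24) + 1 = p ^ 2 := by
  have h2 : p % 2 = 1 := by
    rcases (Fact.out : p.Prime).eq_two_or_odd with h | h
    · omega
    · exact h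
  have h3 : p % 3 ≠ 0 := by
    intro h
    have := (Nat.prime_dvd_prime_iff_eq Nat.prime_three Fact.out).mp (Nat.dvd_of_mod_eq_zero h)
    omega
  have h24 : p ^ 2 % 24 = 1 := by
    have : p % 24 < 24 := Nat.mod_lt _ (by norm_num)
    rw [Nat.pow_mod]
    have h2' : p % 24 % 2 = 1 := by omega
    have h3' : p % 24 % 3 ≠ 0 := by omega
    generalize p % 24 = r at *
    interval_cases r <;> simp_all
  omega

/-- Since 24 s_p + 1 = p², the power q^{s_p} together with q^{1/24} completes (q^{p²})_∞ to η(p²w).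
The quotient η(p²w)/η(w) is then split at pw into two invariant-up-to-sign quotients. -/
lemma crankForm_zeta (hp : 3 < p) {l : ℕ} (hl0 : 0 < l) (hl : l < p) (w : ℍ) :
    crankForm p (zeta p ^ l) w = sinConst ((l : ℂ) / p) *
      (etaQuot p w * etaQuot p (scale p w)) / klein 0 ((l : ℂ) / p) w := by
  have hQ := norm_nome_lt_one w
  have hη := eta_ne_zero w
  have hηp := eta_ne_zero (scale p w)
  have hP := qinfPair_ne_zero (norm_zeta_pow (p := p) l) hQ
  have hs := sinConst_ne_zero (p := p) hl0 hl
  have hq0 := qinf_ne_zero_of_norm_lt hQ hQ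
  have h1 := klein_zero_left ((l : ℂ) / p) w
  rw [← zeta_pow] at h1
  have hk : klein 0 ((l : ℂ) / p) w ≠ 0 := by
    intro h0
    rw [h0, zero_mul] at h1
    exact mul_ne_zero (mul_ne_zero hs (exp_ne_zero _)) hP h1.symm
  have h2 : ModularForm.eta (p * scale p w) = exp (2 * Real.pi * I * w / 24) *
      nome w ^ ((p ^ 2 - 1) / 24) * qinf (nome w ^ p ^ 2) (nome w ^ p ^ 2) := by
    have e := twentyfour_dvd_sq_sub_one hp
    have e' : (p : ℂ) ^ 2 = 24 * ((p ^ 2 - 1) / 24 : ℕ) + 1 := by exact_mod_cast e.symm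
    rw [eta_eq_qinf, coe_scale]
    have h3 : exp (2 * Real.pi * I * (p * (p * w))) = nome w ^ p ^ 2 := by
      rw [nome, ← exp_nat_mul]
      congr 1
      push_cast
      ring
    rw [h3]
    congr 1
    rw [nome, ← exp_nat_mul, ← exp_add]
    congr 1
    linear_combination (2 * Real.pi * I * w / 24) * e'
  have h4 := eta_eq_qinf w
  have h5 : exp (2 * Real.pi * I * w) = nome w := rfl
  have h6 : exp (2 * Real.pi * I * w / 12) = exp (2 * Real.pi * I * w / 24) ^ 2 := by
    rw [← exp_nat_mul]
    congr 1
    push_cast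
    ring
  have h7 : etaQuot p w * etaQuot p (scale p w) =
      ModularForm.eta (p * scale p w) / ModularForm.eta w := by
    rw [etaQuot, etaQuot, coe_scale]
    rw [coe_scale] at hηp
    field_simp
  rw [h5] at h4
  have hE := exp_ne_zero (2 * Real.pi * I * w / 24)
  have hk' : klein 0 ((l : ℂ) / p) w = sinConst ((l : ℂ) / p) *
      qinfPair (zeta p ^ l) (nome w) / qinf (nome w) (nome w) ^ 2 := by
    rw [h6, h4] at h1
    rw [eq_div_iff (pow_ne_zero 2 hq0)]
    apply mul_right_cancel₀ (pow_ne_zero 2 hE)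
    linear_combination h1
  rw [h7, crankForm, h2, h4, hk']
  field_simp

lemma sum_range_eq_of_periodic {F : ℤ → ℂ} (hF : ∀ j, F (j + p) = F j) {u : ℤ}
    (hu : (u : ZMod p) ≠ 0) :
    ∑ j ∈ Finset.range p, F (u * j) = ∑ j ∈ Finset.range p, F j := by
  have hmod : ∀ j : ℤ, F j = F ((j : ZMod p).val : ℤ) := fun j => by
    have hk : ∀ (n : ℤ) (k : ℤ), F (k + n * p) = F k := fun n k => by
      induction n using Int.induction_on with
      | zero => simp
      | succ n ih => rw [add_mul, one_mul, ← add_assoc, hF, ih]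
      | pred n ih => rw [← ih, ← hF (k + (-(n : ℤ) - 1) * p)]; ring_nf
    have := Int.emod_add_mul_ediv j p
    rw [ZMod.val_intCast, ← hk (j / p) (j % p)]
    congr 1
    linarith
  have hsum : ∀ G : ℕ → ℂ, ∑ j ∈ Finset.range p, G j = ∑ x : ZMod p, G x.val := fun G => by
    refine Finset.sum_nbij' (fun j => (j : ZMod p)) ZMod.val (by simp)
      (fun x _ => Finset.mem_range.mpr (ZMod.val_lt x)) (fun j hj => ?_) (by simp) (fun j hj => ?_)
    · exact ZMod.val_cast_of_lt (Finset.mem_range.mp hj)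
    · rw [ZMod.val_cast_of_lt (Finset.mem_range.mp hj)]
  rw [hsum (fun j => F (u * j)), hsum (fun j => F j)]
  refine Fintype.sum_equiv (Equiv.mulLeft₀ (u : ZMod p) hu) _ _ fun x => ?_
  rw [hmod]
  congr 2
  simp

/-- The series of the dissection element, as a combination of the crank generating functions at
shifted arguments. -/
lemma hasSum_dissection (hp : 3 < p) {m : ℕ} (hm : m < p) (l : ℕ) (z : ℍ) :
    HasSum (fun n : ℕ => if (p ^ 2 - 1) / 24 ≤ p * n + m then
      (∑ k ∈ Finset.range p, (crankCountMod k p (p * n + m - (p ^ 2 - 1) / 24) : ℂ) *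
        zeta p ^ (k * l)) * nome z ^ n else 0)
      (((p : ℂ) * exp (2 * Real.pi * I * z / p) ^ m)⁻¹ *
        ∑ j ∈ Finset.range p, zeta p ^ (-(24 * (j : ℤ) * m)) *
          (nome (shift p z j) ^ ((p ^ 2 - 1) / 24) *
            (qinf (nome (shift p z j)) (nome (shift p z j)) /
              qinfPair (zeta p ^ l) (nome (shift p z j))))) := by
  have hp0 : p ≠ 0 := by omega
  have hpc : (p : ℂ) ≠ 0 := by exact_mod_cast hp0
  have hζ := zeta_isPrimitiveRoot hp0
  have hζ0 : zeta p ≠ 0 := hζ.ne_zero hp0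
  set s := (p ^ 2 - 1) / 24 with hs
  set c : ℕ → ℂ := fun N => ∑ k ∈ Finset.range p, (crankCountMod k p N : ℂ) * (zeta p ^ l) ^ k
    with hc
  set x : ℂ := exp (2 * Real.pi * I * z / p) with hx
  have hω : (zeta p ^ l) ^ p = 1 := by rw [← pow_mul, mul_comm, pow_mul, hζ.pow_eq_one, one_pow]
  have h1 : ∀ j : ℤ, HasSum (fun M => if s ≤ M then c (M - s) * nome (shift p z j) ^ M else 0)
      (nome (shift p z j) ^ s * (qinf (nome (shift p z j)) (nome (shift p z j)) /
        qinfPair (zeta p ^ l) (nome (shift p z j)))) := fun j => by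
    have h := (hasSum_crankCountMod hp0 hω (norm_nome_lt_one (shift p z j))).mul_left
      (nome (shift p z j) ^ s)
    refine (Function.Injective.hasSum_iff (add_left_injective s) fun M hM => ?_).mp
      (hasSum_of_eq h (fun N => ?_) rfl)
    · rw [if_neg]
      intro hle
      exact hM ⟨M - s, by simp [hle]⟩
    · simp only [Function.comp, Nat.le_add_left, if_true, Nat.add_sub_cancel]
      rw [pow_add, hc]
      ring
  have h2 := hasSum_sum fun j (_ : j ∈ Finset.range p) =>
    (h1 j).mul_left (zeta p ^ (-(24 * (j : ℤ) * m)))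
  -- Orthogonality of characters mod p. Steps of 24 serve as well as steps of 1, because 24 is prime
  -- to p, and they keep all later matrices congruent to the identity mod 24.
  have horth : ∀ M : ℕ, ∑ j ∈ Finset.range p, zeta p ^ (-(24 * (j : ℤ) * m)) *
      nome (shift p z j) ^ M = if M ≡ m [MOD p] then p * x ^ M else 0 := fun M => by
    have e : ∀ j : ℕ, zeta p ^ (-(24 * (j : ℤ) * m)) * nome (shift p z j) ^ M =
        x ^ M * (zeta p ^ (24 * ((M : ℤ) - m))) ^ j := fun j => by
      rw [nome_shift, ← hx, mul_pow, ← zpow_natCast (zeta p ^ (24 * (j : ℤ))), ← zpow_mul, mul_left_comm,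
        ← zpow_add₀ hζ0, ← zpow_natCast (zeta p ^ (24 * ((M : ℤ) - m))), ← zpow_mul]
      congr 2
      ring
    rw [Finset.sum_congr rfl fun j _ => e j, ← Finset.mul_sum]
    have hiff : zeta p ^ (24 * ((M : ℤ) - m)) = 1 ↔ M ≡ m [MOD p] := by
      rw [hζ.zpow_eq_one_iff_dvd, Nat.ModEq.comm, Nat.modEq_iff_dvd]
      have hcop : IsCoprime (p : ℤ) 24 := by exact_mod_cast (coprime_twentyfour hp).isCoprime
      exact ⟨fun h => hcop.dvd_of_dvd_mul_left h, fun h => h.mul_left _⟩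
    split_ifs with h
    · rw [hiff.mpr h]
      simp [mul_comm]
    · have hne := mt hiff.mp h
      have h1p : (zeta p ^ (24 * ((M : ℤ) - m))) ^ p = 1 := by
        rw [← zpow_natCast, ← zpow_mul, mul_comm _ (p : ℤ), zpow_mul, zpow_natCast, hζ.pow_eq_one,
          one_zpow]
      have hg := mul_geom_sum (zeta p ^ (24 * ((M : ℤ) - m))) p
      rw [h1p, sub_self] at hg
      rw [(mul_eq_zero.mp hg).resolve_left (sub_ne_zero.mpr hne), mul_zero]
  have h3 : HasSum (fun n => if s ≤ p * n + m then c (p * n + m - s) * (p * x ^ (p * n + m)) else 0)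
      (∑ j ∈ Finset.range p, zeta p ^ (-(24 * (j : ℤ) * m)) * (nome (shift p z j) ^ s *
        (qinf (nome (shift p z j)) (nome (shift p z j)) /
        qinfPair (zeta p ^ l) (nome (shift p z j))))) := by
    have hinj : Function.Injective fun n : ℕ => p * n + m := fun a b hab => by
      have : p * a = p * b := by simpa using hab
      exact Nat.eq_of_mul_eq_mul_left (by omega) this
    have e : ∀ M : ℕ, ∑ j ∈ Finset.range p, zeta p ^ (-(24 * (j : ℤ) * m)) *
        (if s ≤ M then c (M - s) * nome (shift p z j) ^ M else 0) =
        if s ≤ M then c (M - s) * (if M ≡ m [MOD p] then p * x ^ M else 0) else 0 := fun M => by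
      by_cases ha : s ≤ M
      · simp only [if_pos ha]
        rw [← horth, Finset.mul_sum]
        exact Finset.sum_congr rfl fun j _ => by ring
      · simp [ha]
    refine hasSum_of_eq ((Function.Injective.hasSum_iff hinj fun M hM => ?_).mpr h2)
      (fun n => ?_) rfl
    · rw [e, if_neg (c := M ≡ m [MOD p]), mul_zero, ite_self]
      intro hMm
      refine hM ⟨M / p, ?_⟩
      have : M % p = m := by rw [hMm, Nat.mod_eq_of_lt hm]
      have h' := Nat.div_add_mod M p
      rw [this] at h'
      exact h'
    · simp only [Function.comp]
      rw [e, if_pos (c := p * n + m ≡ m [MOD p])]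
      simp [Nat.ModEq]
  have hxp : x ^ p = nome z := by
    rw [hx, ← exp_nat_mul, nome]
    congr 1
    field_simp
  have hx0 : x ≠ 0 := exp_ne_zero _
  refine hasSum_of_eq (h3.mul_left ((p : ℂ) * x ^ m)⁻¹) (fun n => ?_) rfl
  split_ifs with ha
  · rw [hc, ← hxp, ← pow_mul, pow_add]
    simp only [mul_comm _ l, pow_mul]
    field_simp
  · simp

/-- The factor (q^{p²})_∞ has the same value at all shifted points, namely the prefactor of the
dissection element, so it can be moved into the Fourier sum. -/
lemma dissection_eq_sum (hp : 3 < p) {m : ℕ} (hm : m < p) (l : ℕ) (z : ℍ) :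
    dissection p m l z = (p : ℂ)⁻¹ * ∑ j ∈ Finset.range p,
      zeta p ^ (-(24 * j * m) : ℤ) * crankForm p (zeta p ^ l) (shift p z j) := by
  have hpc : (p : ℂ) ≠ 0 := by exact_mod_cast (Fact.out : p.Prime).ne_zero
  have hpre : ∏' n : ℕ, (1 - nome z ^ (p * (n + 1))) = qinf (nome z ^ p) (nome z ^ p) := by
    rw [qinf]
    exact tprod_congr fun n => by ring
  have hxm : exp (2 * Real.pi * I * m * z / p) = exp (2 * Real.pi * I * z / p) ^ m := by
    rw [← exp_nat_mul]
    congr 1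
    ring
  have hx0 := exp_ne_zero (2 * Real.pi * I * z / p)
  rw [dissection, (hasSum_dissection hp hm l z).tsum_eq, hpre, hxm, Finset.mul_sum,
    Finset.mul_sum, Finset.mul_sum]
  refine Finset.sum_congr rfl fun j _ => ?_
  have hpp : nome (shift p z j) ^ p ^ 2 = nome z ^ p := by
    rw [pow_two, pow_mul, nome_shift_pow]
  rw [crankForm, hpp]
  field_simp

namespace TransferMatrix

variable {a : ℕ} {A : TransferMatrix p a}

/-- Conjugating A by the shifts j and δ²j gives the integral matrix (α + 24jγ, B2; pγ, d). It fixes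
η(p²w)/η(w), and da ≡ 1 mod p sends the Klein form at a/p to the one at 1/p, so only the sine
constants and a sign differ. -/
lemma Maps.crankForm (hp : 3 < p) (ha1 : 1 ≤ a) (hap : a < p) {z z' : ℍ} (h : A.Maps z z') (j : ℤ) :
    crankForm p (zeta p ^ a) (shift p z' j) = factor (p := p) z z' ^ 2 * ((-1) ^ (a + 1) *
      (sinConst ((a : ℂ) / p) / sinConst ((1 : ℂ) / p))) *
        CrankDissection.crankForm p (zeta p) (shift p z (A.δ ^ 2 * j)) := by
  have hp0 : (p : ℂ) ≠ 0 := by exact_mod_cast (Fact.out : p.Prime).ne_zero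
  obtain ⟨b, hb⟩ := A.β_mod
  obtain ⟨c, hc⟩ := A.γ_mod
  obtain ⟨u, hu⟩ := A.α_mod
  obtain ⟨v, hv⟩ := A.δ_mod
  -- The upper right entry, already divided by p. The index δ²j makes this possible: 24jδ(1 - αδ) =
  -- -24jδβγ by the determinant, and p divides β and γ.
  set B2 : ℤ := 24 * p ^ 2 * b - 24 * j * A.δ * (24 * p ^ 2 * b) * A.γ -
    (24 * j * A.δ) ^ 2 * (24 * p ^ 2 * c) with hB2
  have hB2' : p * B2 = A.β + 24 * j * A.δ - 24 * (A.δ ^ 2 * j) * (A.α + 24 * j * A.γ) := by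
    rw [hB2]
    linear_combination (-1 + 24 * j * A.δ * A.γ) * hb + (24 * j * A.δ) ^ 2 * hc +
      24 * j * A.δ * A.det
  set d : ℤ := A.δ - A.γ * (24 * (A.δ ^ 2 * j)) with hd
  have hdet : (A.α + 24 * j * A.γ) * d - B2 * (p * A.γ) = 1 := by
    rw [hd]
    linear_combination A.det - A.γ * hB2'
  rw [Maps] at h
  have hw : (shift p z' j : ℂ) * ((p * A.γ : ℤ) * shift p z (A.δ ^ 2 * j) + d) =
      (A.α + 24 * j * A.γ : ℤ) * shift p z (A.δ ^ 2 * j) + B2 := by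
    have hB : (p : ℂ) * B2 = A.β + 24 * j * A.δ - 24 * (A.δ ^ 2 * j) * (A.α + 24 * j * A.γ) := by
      exact_mod_cast hB2'
    rw [coe_shift, coe_shift, hd]
    push_cast
    field_simp
    linear_combination h - hB
  have hden : ((p * A.γ : ℤ) : ℂ) * shift p z (A.δ ^ 2 * j) + d = factor (p := p) z z' ^ 2 := by
    rw [Maps.factor_sq h, coe_shift, hd]
    push_cast
    field_simp
    ring
  have hg := etaQuot_mul_mobius hp hdet ⟨u + j * A.γ, by linear_combination hu⟩
    ⟨p ^ 2 * b - 24 * j * A.δ * (p ^ 2 * b) * A.γ - 24 * (j * A.δ) ^ 2 * (24 * p ^ 2 * c),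
      by rw [hB2]; ring⟩ (A.γ_mod.mul_left _)
    ⟨v - A.γ * (A.δ ^ 2 * j), by rw [hd]; linear_combination hv⟩ hw
  have hk := klein_zero_mobius hdet ⟨12 * p ^ 2 * c, by rw [hc]; ring⟩ hw a
  obtain ⟨y, hy⟩ : ∃ y : ℤ, d * a = 1 + y * p :=
    ⟨A.β * (24 * p ^ 2 * c) - A.δ * A.x - 24 * p ^ 2 * c * 24 * A.δ ^ 2 * j * a, by
      rw [hd, hc]
      linear_combination A.det + A.β * hc - A.δ * A.α_eq⟩
  -- Both d and p are odd, so da = 1 + yp fixes the parity of y, and with it the sign (-1)^(a+1).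
  have hy2 : Even (y - (a + 1)) := by
    have h2 : p % 2 = 1 := by
      rcases (Fact.out : p.Prime).eq_two_or_odd with h | h
      · omega
      · exact h
    obtain ⟨t, ht⟩ : ∃ t : ℤ, (p : ℤ) = 2 * t + 1 := ⟨p / 2, by omega⟩
    refine ⟨12 * v * a - 12 * A.γ * A.δ ^ 2 * j * a - y * t - 1, ?_⟩
    rw [hd, ht] at hy
    linear_combination -hy + a * hv
  have hkk : klein 0 ((d * a : ℤ) / p) (shift p z (A.δ ^ 2 * j)) =
      (-1) ^ (a + 1) * klein 0 (1 / p) (shift p z (A.δ ^ 2 * j)) := by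
    have e : ((d * a : ℤ) : ℂ) / p = 1 / p + y := by
      rw [hy]
      push_cast
      field_simp
    rw [e, klein_add_int_right, mul_zero, exp_zero]
    congr 1
    obtain ⟨t, ht⟩ := hy2
    rw [show y = ((a + 1 : ℕ) : ℤ) + 2 * t by push_cast; omega, zpow_add₀ (by norm_num), zpow_mul,
      zpow_natCast]
    norm_num
  have hf := factor_ne_zero (p := p) z z'
  have hs := sinConst_ne_zero (p := p) (l := 1) one_pos (by omega)
  have hone := crankForm_zeta hp one_pos (by omega) (shift p z (A.δ ^ 2 * j))
  rw [pow_one] at hone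
  rw [crankForm_zeta hp ha1 hap, hone, hg]
  rw [hden, hkk] at hk
  push_cast at hk hs
  rw [hk, Nat.cast_one]
  have hm1 : ((-1 : ℂ) ^ (a + 1))⁻¹ = (-1) ^ (a + 1) := by rw [← inv_pow]; norm_num
  have hm0 : ((-1 : ℂ) ^ (a + 1)) ≠ 0 := pow_ne_zero _ (by norm_num)
  set κ := klein 0 (1 / p) (shift p z (A.δ ^ 2 * j))
  rw [div_eq_mul_inv, mul_inv, mul_inv, hm1, inv_inv]
  field_simp

end TransferMatrix

end DissectionTransfer

/-! ### Transfer of identities and removal of the automorphy factor -/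

section Transfer

open Complex

variable {p : ℕ}

/-- The point `z + 24 p t` of the upper half-plane. -/
noncomputable def translate (p : ℕ) (z : ℍ) (t : ℕ) : ℍ :=
  ⟨z + (24 * p * t : ℕ), by
    rw [add_im, natCast_im, add_zero]
    exact z.im_pos⟩

lemma coe_translate (z : ℍ) (t : ℕ) : (translate p z t : ℂ) = z + (24 * p * t : ℕ) := rfl

lemma nome_translate (z : ℍ) (t : ℕ) : nome (translate p z t) = nome z := by
  rw [nome, nome, coe_translate, mul_add, exp_add, mul_comm (2 * Real.pi * I : ℂ) ((_ : ℕ) : ℂ),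
    exp_nat_mul_two_pi_mul_I, mul_one]

/-- The quotient of sines by which the transfer multiplies. -/
noncomputable def transferConst (p a : ℕ) : ℂ :=
  (-1) ^ (a + 1) * (sinConst ((a : ℂ) / p) / sinConst ((1 : ℂ) / p))

lemma transferConst_ne_zero (hp : 3 < p) {a : ℕ} (ha1 : 1 ≤ a) (hap : a < p) :
    transferConst p a ≠ 0 := by
  have h1 := sinConst_ne_zero (p := p) (l := 1) one_pos (by omega)
  rw [Nat.cast_one] at h1
  exact mul_ne_zero (pow_ne_zero _ (by norm_num)) (div_ne_zero (sinConst_ne_zero ha1 hap) h1)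

lemma TransferMatrix.exists_maps {a : ℕ} (A : TransferMatrix p a) (z : ℍ) : ∃ z', A.Maps z z' := exists_mobius A.det z

lemma TransferMatrix.exists_maps_inv {a : ℕ} (A : TransferMatrix p a) (z' : ℍ) : ∃ z, A.Maps z z' := by
  obtain ⟨z, hz⟩ := exists_mobius (a := A.δ) (b := -A.β) (c := -A.γ) (d := A.α)
    (by linear_combination A.det) z'
  refine ⟨z, ?_⟩
  rw [TransferMatrix.Maps]
  push_cast at hz
  linear_combination -hz

variable [Fact p.Prime]

/-- The map j ↦ δ²j permutes the residues mod p. Since aδ ≡ 1, the relation m ≡ m₀a² reads δ²m ≡ m₀,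
so the Fourier character for m₀ at j equals the one for m at δ²j. This is where the square enters.
-/
lemma TransferMatrix.Maps.dissection {a : ℕ} {A : TransferMatrix p a} (hp : 3 < p) (ha1 : 1 ≤ a)
    (hap : a < p) {m m₀ : ℕ} (hm : m < p) (hm₀ : m₀ < p) (hmm : m ≡ m₀ * a ^ 2 [MOD p])
    {z z' : ℍ} (h : A.Maps z z') :
    dissection p m₀ a z' = factor (p := p) z z' ^ 2 * transferConst p a *
      CrankDissection.dissection p m 1 z := by
  have hp0 : p ≠ 0 := by omega
  have hζ := zeta_isPrimitiveRoot hp0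
  have hδ : ((A.α : ℤ) : ZMod p) * ((A.δ : ℤ) : ZMod p) = 1 := by
    obtain ⟨c, hc⟩ := A.exists_gamma_eq
    have h1 := congrArg (Int.cast : ℤ → ZMod p) A.det
    rw [hc] at h1
    push_cast at h1
    simpa using h1
  have hδ0 : (((A.δ ^ 2 : ℤ)) : ZMod p) ≠ 0 := by
    push_cast
    refine pow_ne_zero 2 fun h0 => ?_
    rw [h0, mul_zero] at hδ
    exact zero_ne_one hδ
  rw [A.alpha_cast] at hδ
  have hper : ∀ (j : ℤ) (m : ℕ), zeta p ^ (-(24 * (j + p) * m)) = zeta p ^ (-(24 * j * m)) :=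
    fun j m => by
    rw [show -(24 * (j + p) * (m : ℤ)) = -(24 * j * m) + p * (-(24 * m)) by ring,
      zpow_add₀ (hζ.ne_zero hp0), zpow_mul _ (p : ℤ), zpow_natCast, hζ.pow_eq_one, one_zpow, mul_one]
  have hF : ∀ j : ℤ, zeta p ^ (-(24 * (j + p) * (m : ℤ))) * CrankDissection.crankForm p (zeta p) (shift p z (j + p)) =
      zeta p ^ (-(24 * j * (m : ℤ))) * CrankDissection.crankForm p (zeta p) (shift p z j) := fun j => by
    have e : nome (shift p z (j + p)) = nome (shift p z j) := by
      have := hper (-j - p) 1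
      rw [nome_shift, nome_shift, show 24 * (j + (p : ℤ)) = -(24 * (-j - p) * ((1 : ℕ) : ℤ)) by
        push_cast; ring, ← this]
      congr 2
      push_cast
      ring
    rw [hper, CrankDissection.crankForm, CrankDissection.crankForm, e]
  have hsum := sum_range_eq_of_periodic (F := fun j => zeta p ^ (-(24 * j * (m : ℤ))) *
    CrankDissection.crankForm p (zeta p) (shift p z j)) hF hδ0
  rw [dissection_eq_sum hp hm₀, dissection_eq_sum hp hm, pow_one, ← hsum, mul_left_comm]
  congr 1
  rw [Finset.mul_sum]
  refine Finset.sum_congr rfl fun j _ => ?_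
  rw [TransferMatrix.Maps.crankForm hp ha1 hap h, transferConst]
  have e : zeta p ^ (-(24 * (j : ℤ) * m₀)) = zeta p ^ (-(24 * (A.δ ^ 2 * j) * (m : ℤ))) := by
    obtain ⟨y, hy⟩ : (p : ℤ) ∣ A.δ ^ 2 * m - m₀ := by
      rw [← ZMod.intCast_zmod_eq_zero_iff_dvd]
      have := (ZMod.natCast_eq_natCast_iff _ _ _).mpr hmm
      push_cast at this ⊢
      rw [this]
      linear_combination ((m₀ : ZMod p)) * ((a : ZMod p) * (A.δ : ZMod p) + 1) * hδ
    rw [show -(24 * (A.δ ^ 2 * (j : ℤ)) * (m : ℤ)) = -(24 * (j : ℤ) * m₀) + p * (-(24 * j * y)) by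
      linear_combination (-24 * (j : ℤ)) * hy, zpow_add₀ (hζ.ne_zero hp0), zpow_mul _ (p : ℤ),
      zpow_natCast, hζ.pow_eq_one, one_zpow, mul_one]
  rw [e]
  ring

/-- Times a large power of h the sum is a polynomial in h with infinitely many zeros, hence zero;
its value at 1 is the claim. It strips automorphy factors of unequal weights. -/
lemma sum_eq_zero_of_infinite_zpow {ι : Type*} [Fintype ι] (w : ι → ℤ) (v : ι → ℂ) {S : Set ℂ}
    (hS : S.Infinite) (h0 : ∀ h ∈ S, h ≠ 0) (h : ∀ h ∈ S, ∑ i, h ^ w i * v i = 0) :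
    ∑ i, v i = 0 := by
  set N : ℤ := ∑ i, |w i| with hN
  have hw : ∀ i, 0 ≤ w i + N := fun i => by
    have h1 : |w i| ≤ N := Finset.single_le_sum (f := fun i => |w i|) (fun _ _ => abs_nonneg _)
      (Finset.mem_univ i)
    have := neg_abs_le (w i)
    omega
  set P : ℂ[X] := ∑ i, Polynomial.C (v i) * Polynomial.X ^ (w i + N).toNat with hP
  have hP0 : P = 0 := Polynomial.eq_zero_of_infinite_isRoot P (hS.mono fun x hx => by
    have hx0 := h0 x hx
    have : P.eval x = x ^ N * ∑ i, x ^ w i * v i := by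
      rw [hP, Polynomial.eval_finsetSum, Finset.mul_sum]
      refine Finset.sum_congr rfl fun i _ => ?_
      rw [Polynomial.eval_mul, Polynomial.eval_C, Polynomial.eval_pow, Polynomial.eval_X,
        ← zpow_natCast, Int.toNat_of_nonneg (hw i), zpow_add₀ hx0]
      ring
    simp only [Set.mem_ofPred_eq, Polynomial.IsRoot, this, h x hx, mul_zero])
  have h1 : P.eval 1 = 0 := by rw [hP0, Polynomial.eval_zero]
  rw [hP, Polynomial.eval_finsetSum] at h1
  simpa using h1

/-- All fractional exponents of q in dissection elements and eta products have denominator dividing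
24p, so 24p is a common period. -/
lemma exp_translate (z : ℍ) (t : ℕ) (k : ℤ) :
    exp (2 * Real.pi * I * translate p z t / (24 * p) * k) = exp (2 * Real.pi * I * z / (24 * p) * k) := by
  have hp0 : (p : ℂ) ≠ 0 := by exact_mod_cast (Fact.out : p.Prime).ne_zero
  rw [coe_translate, show 2 * Real.pi * I * (z + (24 * p * t : ℕ)) / (24 * p) * k =
    2 * Real.pi * I * z / (24 * p) * k + (t * k : ℤ) * (2 * Real.pi * I) by push_cast; field_simp,
    exp_add, exp_int_mul_two_pi_mul_I, mul_one]

lemma dissection_translate (m l : ℕ) (z : ℍ) (t : ℕ) :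
    dissection p m l (translate p z t) = dissection p m l z := by
  have hp0 : (p : ℂ) ≠ 0 := by exact_mod_cast (Fact.out : p.Prime).ne_zero
  have h := exp_translate (p := p) z t (24 * m)
  have e : ∀ w : ℂ, 2 * Real.pi * I * m * w / p = 2 * Real.pi * I * w / (24 * p) * (24 * m : ℤ) :=
    fun w => by push_cast; field_simp
  rw [dissection, dissection, nome_translate, e, e, h]

lemma biagioli_translate (k : ℤ) (z : ℍ) (t : ℕ) :
    biagioli p k (translate p z t) = biagioli p k z := by
  have hp0 : (p : ℂ) ≠ 0 := by exact_mod_cast (Fact.out : p.Prime).ne_zero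
  have h := exp_translate (p := p) z t (3 * (p - 2 * k) ^ 2)
  have e : ∀ w : ℂ, 2 * Real.pi * I * w * (((p : ℂ) - 2 * k) ^ 2 / (8 * p)) =
      2 * Real.pi * I * w / (24 * p) * (3 * (p - 2 * k) ^ 2 : ℤ) :=
    fun w => by push_cast; field_simp; ring
  rw [biagioli, biagioli, nome_translate, e, e, h]

lemma eta_translate (z : ℍ) (t : ℕ) :
    ModularForm.eta (p * translate p z t) = ModularForm.eta (p * z) := by
  have hp0 : (p : ℂ) ≠ 0 := by exact_mod_cast (Fact.out : p.Prime).ne_zero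
  have h := exp_translate (p := p) z t (p ^ 2)
  have e : ∀ w : ℂ, 2 * Real.pi * I * (p * w) / 24 =
      2 * Real.pi * I * w / (24 * p) * (p ^ 2 : ℤ) :=
    fun w => by push_cast; field_simp
  have e1 : ∀ w : ℍ, exp (2 * Real.pi * I * (p * w)) = nome w ^ p := fun w => by
    rw [nome, ← exp_nat_mul]
    congr 1
    ring
  rw [eta_eq_qinf, eta_eq_qinf, e1, e1, nome_translate, e, e, h]

lemma etaProduct_translate (n : ExpVec p) (z : ℍ) (t : ℕ) :
    etaProduct p n (translate p z t) = etaProduct p n z := by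
  simp only [etaProduct, eta_translate, biagioli_translate]

lemma translate_injective (z : ℍ) : Function.Injective fun t => (translate p z t : ℂ) := fun s t h => by
  have hp0 := (Fact.out : p.Prime).ne_zero
  have h1 : (z : ℂ) + (24 * p * s : ℕ) = z + (24 * p * t : ℕ) := h
  have h2 : 24 * p * s = 24 * p * t := by exact_mod_cast add_left_cancel h1
  exact Nat.eq_of_mul_eq_mul_left (by positivity) h2

namespace TransferMatrix

variable {a : ℕ}

/-- The transfer of an identity with conjugated coefficients. -/
lemma identity_iff (A : TransferMatrix p a) (hp : 3 < p) (ha1 : 1 ≤ a) (hap : a < p) {m m₀ : ℕ} (hm : m < p) (hm₀ : m₀ < p)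
    (hmm : m ≡ m₀ * a ^ 2 [MOD p]) {t : ℕ} (n : Fin t → ExpVec p) (v v' : Fin t → ℂ)
    (hv : ∀ i, v i * transferSign p a (n i) = transferConst p a * v' i) :
    (∀ z, dissection p m₀ a z = ∑ i, v i * etaProduct p (n i) z) ↔
      ∀ z, dissection p m 1 z = ∑ i, v' i * etaProduct p (permVec p a (n i)) z := by
  have hκ := transferConst_ne_zero hp ha1 hap
  -- The square of the factor is γu + δ with γ ≠ 0, so distinct points give distinct factors.
  have hinf : ∀ u u' : ℕ → ℍ, (∀ k, A.Maps (u k) (u' k)) → (Function.Injective fun k => (u k : ℂ)) →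
      (Set.range fun k => factor (p := p) (u k) (u' k)).Infinite := fun u u' h hu => by
    refine Set.infinite_range_of_injective fun k l hkl => hu ?_
    have h1 := congrArg (fun x => x ^ 2) hkl
    simp only [(h k).factor_sq, (h l).factor_sq] at h1
    exact mul_left_cancel₀ (Int.cast_ne_zero.mpr A.γ_ne) (add_right_cancel h1)
  refine ⟨fun H z => ?_, fun H z' => ?_⟩
  · choose u' hu' using fun k => A.exists_maps (translate p z k)
    have key := sum_eq_zero_of_infinite_zpow
      (fun i : Option (Fin t) => i.elim 2 fun i => expWeight (n i))
      (fun i => i.elim (-dissection p m 1 z) fun i => v' i * etaProduct p (permVec p a (n i)) z)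
      (hinf _ _ hu' (translate_injective z)) (by rintro _ ⟨k, rfl⟩; exact factor_ne_zero _ _) ?_
    · rw [Fintype.sum_option] at key
      simp only [Option.elim] at key
      linear_combination -key
    · rintro _ ⟨k, rfl⟩
      have h1 := H (u' k)
      simp only [(hu' k).etaProduct hp ha1 hap, etaProduct_translate] at h1
      rw [(hu' k).dissection hp ha1 hap hm hm₀ hmm, dissection_translate] at h1
      rw [Fintype.sum_option]
      simp only [Option.elim]
      apply mul_left_cancel₀ hκ
      have h2 : ∑ i, v i * (factor (p := p) (translate p z k) (u' k) ^ expWeight (n i) *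
          transferSign p a (n i) * CrankDissection.etaProduct p (permVec p a (n i)) z) =
          transferConst p a * ∑ i, factor (p := p) (translate p z k) (u' k) ^ expWeight (n i) *
            (v' i * CrankDissection.etaProduct p (permVec p a (n i)) z) := by
        rw [Finset.mul_sum]
        refine Finset.sum_congr rfl fun i _ => ?_
        linear_combination (factor (p := p) (translate p z k) (u' k) ^ expWeight (n i) *
          CrankDissection.etaProduct p (permVec p a (n i)) z) * hv i
      rw [h2] at h1
      have h3 : ∀ x : ℂ, x ^ (2 : ℤ) = x ^ 2 := fun x => zpow_ofNat x 2
      rw [mul_add, ← h1, h3]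
      ring
  · choose u hu using fun k => A.exists_maps_inv (translate p z' k)
    have hinj : Function.Injective fun k => (u k : ℂ) := fun k l hkl => by
      refine translate_injective (p := p) z' ?_
      have h1 := hu k
      have h2 := hu l
      rw [Maps] at h1 h2
      have hkl' : (u k : ℂ) = u l := hkl
      rw [hkl', ← h2] at h1
      exact mul_right_cancel₀ (A.denom_ne_zero _) h1
    -- Now z' is translated and the factor is attached to the preimages. Solving the transformation
    -- laws for the side at z' leaves exponent 0 for the dissection element and 2 - weight for each
    -- eta product.
    have key := sum_eq_zero_of_infinite_zpow
      (fun i : Option (Fin t) => i.elim 0 fun i => 2 - expWeight (n i))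
      (fun i => i.elim (-dissection p m₀ a z') fun i => v i * etaProduct p (n i) z')
      (hinf _ _ hu hinj) (by rintro _ ⟨k, rfl⟩; exact factor_ne_zero _ _) ?_
    · rw [Fintype.sum_option] at key
      simp only [Option.elim] at key
      linear_combination -key
    · rintro _ ⟨k, rfl⟩
      have h1 := (hu k).dissection hp ha1 hap hm hm₀ hmm
      rw [dissection_translate, H] at h1
      have hf := factor_ne_zero (p := p) (u k) (translate p z' k)
      rw [Fintype.sum_option]
      simp only [Option.elim]
      rw [zpow_zero, one_mul, h1, Finset.mul_sum, neg_add_eq_zero]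
      refine Finset.sum_congr rfl fun i _ => ?_
      have h2 := (hu k).etaProduct hp ha1 hap (n i)
      rw [etaProduct_translate] at h2
      rw [h2, zpow_sub₀ hf, zpow_ofNat]
      have hw := zpow_ne_zero (expWeight (n i)) hf
      field_simp
      linear_combination -CrankDissection.etaProduct p (permVec p a (n i)) (u k) * hv i

end TransferMatrix

end Transfer

/-! ### Power series with integral coefficients -/

section IntegralExpansion

open PowerSeries

/-- The function `f` is given on the unit disc by a power series with integral coefficients. -/
def HasIntegralExpansion (f : ℂ → ℂ) : Prop :=
  ∃ Φ : PowerSeries ℤ, ∀ x : ℂ, ‖x‖ < 1 → EvalsTo (Φ.map (Int.castRingHom ℂ)) x (f x)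

namespace HasIntegralExpansion

variable {f g : ℂ → ℂ}

lemma one : HasIntegralExpansion fun _ => 1 :=
  ⟨1, fun x _ => by rw [map_one]; exact EvalsTo.one x⟩

lemma mul (hf : HasIntegralExpansion f) (hg : HasIntegralExpansion g) :
    HasIntegralExpansion fun x => f x * g x := by
  obtain ⟨Φ, hΦ⟩ := hf
  obtain ⟨Ψ, hΨ⟩ := hg
  exact ⟨Φ * Ψ, fun x hx => by rw [map_mul]; exact (hΦ x hx).mul (hΨ x hx)⟩

lemma X_pow (k : ℕ) : HasIntegralExpansion fun x => x ^ k :=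
  ⟨X ^ k, fun x _ => by rw [map_pow, map_X]; exact EvalsTo.X_pow k x⟩

lemma pow (hf : HasIntegralExpansion f) (k : ℕ) : HasIntegralExpansion fun x => f x ^ k := by
  obtain ⟨Φ, hΦ⟩ := hf
  exact ⟨Φ ^ k, fun x hx => by rw [map_pow]; exact (hΦ x hx).pow k⟩

lemma genFun (w : ℕ → ℕ → ℤ) (hw : ∀ i c, |w i c| ≤ 1)
    (h : ∀ x : ℂ, ‖x‖ < 1 → Filter.Tendsto (fun K => ∏ i ∈ Finset.range K,
      (1 + ∑' j, (w (i + 1) (j + 1) : ℂ) * x ^ ((i + 1) * (j + 1)))) Filter.atTop (nhds (f x))) :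
    HasIntegralExpansion f := by
  refine ⟨Nat.Partition.genFun w, fun x hx => ?_⟩
  have e : (Nat.Partition.genFun w).map (Int.castRingHom ℂ) =
      Nat.Partition.genFun fun i c => (w i c : ℂ) := by
    ext n
    simp [Nat.Partition.coeff_genFun, Finsupp.prod]
  rw [e]
  refine hasProd_evalsTo_genFun _ (fun i c => ?_) hx (h x hx)
  rw [Complex.norm_intCast]
  exact_mod_cast hw i c

end HasIntegralExpansion

open Classical in
-- Trivial factors are inserted outside the arithmetic progression, so that the product runs over
-- all part sizes and matches a partition generating function.
lemma hasProd_qinf_pow {r N : ℕ} (hr : 0 < r) (hN : 0 < N) {x : ℂ} (hx : ‖x‖ < 1) :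
    HasProd (fun i : ℕ => 1 - (if ∃ n, i + 1 = r + N * n then x ^ (i + 1) else 0))
      (qinf (x ^ r) (x ^ N)) := by
  have hxN : ‖x ^ N‖ < 1 := by
    rw [norm_pow]
    exact pow_lt_one₀ (norm_nonneg _) hx hN.ne'
  have hinj : Function.Injective fun n : ℕ => r + N * n - 1 := fun a b hab => by
    have h1 : r + N * a - 1 = r + N * b - 1 := hab
    have h2 : N * a = N * b := by omega
    exact Nat.eq_of_mul_eq_mul_left hN h2
  refine (hinj.hasProd_iff fun i hi => ?_).mp
    ((multipliable_qinf (x ^ r) hxN).hasProd.congr_fun fun n => ?_)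
  · rw [if_neg, sub_zero]
    rintro ⟨n, hn⟩
    exact hi ⟨n, by simp only; omega⟩
  · have e : r + N * n - 1 + 1 = r + N * n := by omega
    simp only [Function.comp]
    rw [e, if_pos ⟨n, rfl⟩, pow_add, pow_mul]

/-- The function `f` is given on the unit disc by a power series with integral coefficients, and
so is its inverse. -/
def HasIntegralUnitExpansion (f : ℂ → ℂ) : Prop :=
  HasIntegralExpansion f ∧ HasIntegralExpansion fun x => (f x)⁻¹

namespace HasIntegralUnitExpansion

variable {f g : ℂ → ℂ}

/-- The product counts partitions into distinct parts from the progression with sign (-1) per part;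
its inverse counts partitions with arbitrary multiplicities. Both have integer weights bounded by 1.
-/
lemma qinf {r N : ℕ} (hr : 0 < r) (hN : 0 < N) :
    HasIntegralUnitExpansion fun x => qinf (x ^ r) (x ^ N) := by
  classical
  have ht := fun (x : ℂ) (hx : ‖x‖ < 1) => (hasProd_qinf_pow hr hN hx).tendsto_prod_nat
  refine ⟨HasIntegralExpansion.genFun
    (fun i c => if c = 1 ∧ ∃ n, i = r + N * n then -1 else 0) (fun i c => ?_) fun x hx => ?_,
    HasIntegralExpansion.genFun
    (fun i c => if ∃ n, i = r + N * n then 1 else 0) (fun i c => ?_) fun x hx => ?_⟩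
  · split_ifs <;> simp
  · refine (ht x hx).congr fun K => Finset.prod_congr rfl fun i _ => ?_
    rw [tsum_eq_single 0]
    · split_ifs <;> simp_all [sub_eq_add_neg]
    · intro j hj
      rw [if_neg (by simp [hj])]
      simp
  · split_ifs <;> simp
  · have hne : CrankDissection.qinf (x ^ r) (x ^ N) ≠ 0 := by
      refine qinf_ne_zero_of_norm_lt ?_ ?_ <;> rw [norm_pow] <;>
        exact pow_lt_one₀ (norm_nonneg _) hx (by omega)
    refine ((ht x hx).inv₀ hne).congr fun K => ?_
    rw [← Finset.prod_inv_distrib]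
    refine Finset.prod_congr rfl fun i _ => ?_
    split_ifs with hi
    · rw [← hasSum_pow_succ_mul (norm_pow_succ_lt_one hx i)]
      simp [pow_mul]
    · simp

lemma one : HasIntegralUnitExpansion fun _ => 1 :=
  ⟨.one, by simpa using HasIntegralExpansion.one⟩

lemma mul (hf : HasIntegralUnitExpansion f) (hg : HasIntegralUnitExpansion g) :
    HasIntegralUnitExpansion fun x => f x * g x :=
  ⟨hf.1.mul hg.1, by simpa only [mul_inv] using hf.2.mul hg.2⟩

lemma zpow (hf : HasIntegralUnitExpansion f) (k : ℤ) :
    HasIntegralUnitExpansion fun x => f x ^ k := by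
  obtain ⟨n, rfl | rfl⟩ := k.eq_nat_or_neg
  · exact ⟨by simpa using hf.1.pow n, by simpa using hf.2.pow n⟩
  · exact ⟨by simpa using hf.2.pow n, by simpa using hf.1.pow n⟩

lemma prod {ι : Type*} (s : Finset ι) {F : ι → ℂ → ℂ} (h : ∀ i ∈ s, HasIntegralUnitExpansion (F i)) :
    HasIntegralUnitExpansion fun x => ∏ i ∈ s, F i x := by
  classical
  induction s using Finset.induction_on with
  | empty => simpa using one
  | insert a s ha ih =>
    simp only [Finset.prod_insert ha]
    exact (h a (Finset.mem_insert_self a s)).mul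
      (ih fun i hi => h i (Finset.mem_insert_of_mem hi))

end HasIntegralUnitExpansion

/-- If the coefficients below n vanish, divide by x^n and let x tend to 0 along powers of 1/2. The
point x = 0 is excluded because the local parameter is never 0. -/
lemma eq_zero_of_evalsTo_zero {F : PowerSeries ℂ}
    (h : ∀ x : ℂ, x ≠ 0 → ‖x‖ < 1 → EvalsTo F x 0) : F = 0 := by
  ext n
  rw [map_zero]
  induction n using Nat.strong_induction_on with
  | _ n ih =>
  have hs : ∀ x : ℂ, x ≠ 0 → ‖x‖ < 1 → HasSum (fun k => F.coeff (k + n) * x ^ k) 0 :=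
      fun x hx0 hx => by
    have h1 := (hasSum_nat_add_iff' n).mpr (h x hx0 hx)
    rw [Finset.sum_eq_zero fun i hi => by rw [ih i (Finset.mem_range.mp hi), zero_mul],
      sub_zero] at h1
    refine hasSum_of_eq (h1.mul_right (x ^ n)⁻¹) (fun k => ?_) (by simp)
    rw [pow_add]
    field_simp
  set y : ℕ → ℂ := fun j => (1 / 2) ^ (j + 1) with hy
  have hynorm : ∀ j, ‖y j‖ ≤ 1 / 2 := fun j => by
    have h2 : ‖(1 / 2 : ℂ)‖ = 1 / 2 := by norm_num
    rw [hy, norm_pow, h2]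
    exact pow_le_of_le_one (by norm_num) (by norm_num) (Nat.succ_ne_zero j)
  have hy0 : ∀ j, y j ≠ 0 := fun j => pow_ne_zero _ (by norm_num)
  have hylim : Filter.Tendsto y Filter.atTop (nhds 0) :=
    (tendsto_pow_atTop_nhds_zero_of_norm_lt_one (by norm_num)).comp (Filter.tendsto_add_atTop_nat 1)
  have hb := (hs (1 / 2) (by norm_num) (by norm_num)).summable.norm
  have hlim := tendsto_tsum_of_dominated_convergence (𝓕 := Filter.atTop)
    (f := fun j k => F.coeff (k + n) * y j ^ k) (g := fun k => F.coeff (k + n) * (0 : ℂ) ^ k) hb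
    (fun k => (hylim.pow k).const_mul _) (Filter.Eventually.of_forall fun j k => by
      have h2 : ‖(1 / 2 : ℂ)‖ = 1 / 2 := by norm_num
      rw [norm_mul, norm_mul, norm_pow (y j) k, norm_pow _ k, h2]
      exact mul_le_mul_of_nonneg_left (pow_le_pow_left₀ (norm_nonneg _) (hynorm j) k)
        (norm_nonneg _))
  have h1 : ∀ j, ∑' k, F.coeff (k + n) * y j ^ k = 0 := fun j =>
    (hs (y j) (hy0 j) ((hynorm j).trans_lt (by norm_num))).tsum_eq
  simp only [h1] at hlim
  rw [tsum_eq_single 0 fun k hk => by simp [hk]] at hlim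
  simpa using tendsto_nhds_unique hlim tendsto_const_nhds

end IntegralExpansion

/-! ### Galois conjugation of identities through q-expansions -/

section Conjugation

open Complex

variable {p : ℕ}

lemma aeval_eq_zero_of_isPrimitiveRoot (hp : 0 < p) {μ ν : ℂ} (hμ : IsPrimitiveRoot μ p)
    (hν : IsPrimitiveRoot ν p) {P : ℚ[X]} (h : Polynomial.aeval μ P = 0) :
    Polynomial.aeval ν P = 0 := by
  have h1 := minpoly.dvd ℚ μ h
  rw [← Polynomial.cyclotomic_eq_minpoly_rat hμ hp, Polynomial.cyclotomic_eq_minpoly_rat hν hp] at h1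
  exact (minpoly.dvd_iff).mp h1

/-- The local parameter `exp(2 π i z / (24 p))`. -/
noncomputable def param (p : ℕ) (z : ℍ) : ℂ := exp (2 * Real.pi * I * z / (24 * p))

lemma param_ne_zero (z : ℍ) : param p z ≠ 0 := exp_ne_zero _

lemma norm_param_lt_one (hp : 0 < p) (z : ℍ) : ‖param p z‖ < 1 := by
  have : 2 * Real.pi * I * z / (24 * p) = 2 * Real.pi * I * (z / (24 * p : ℕ)) := by
    push_cast
    ring
  rw [param, this]
  refine norm_exp_two_pi_I_mul_lt_one ?_
  rw [← ofReal_natCast, div_ofReal_im]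
  exact div_pos z.im_pos (by positivity)

lemma exists_param_eq (hp : 0 < p) {x : ℂ} (hx0 : x ≠ 0) (hx : ‖x‖ < 1) : ∃ z, param p z = x := by
  have hpi := Real.pi_pos
  have hp' : (0 : ℝ) < p := by exact_mod_cast hp
  have hpc : (p : ℂ) ≠ 0 := by exact_mod_cast hp.ne'
  have him : 0 < (-(I * ((24 * p / (2 * Real.pi) : ℝ) : ℂ)) * log x).im := by
    have h1 := Real.log_neg (norm_pos_iff.mpr hx0) hx
    have h2 : (-(I * ((24 * p / (2 * Real.pi) : ℝ) : ℂ)) * log x).im =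
        (24 * p / (2 * Real.pi)) * -Real.log ‖x‖ := by
      rw [neg_mul, mul_assoc, neg_im, I_mul_im, re_ofReal_mul, log_re]
      ring
    rw [h2]
    exact mul_pos (by positivity) (neg_pos.mpr h1)
  refine ⟨⟨_, him⟩, ?_⟩
  rw [param]
  conv_rhs => rw [← exp_log hx0]
  congr 1
  have : (Real.pi : ℂ) ≠ 0 := by exact_mod_cast hpi.ne'
  change 2 * Real.pi * I * (-(I * ((24 * p / (2 * Real.pi) : ℝ) : ℂ)) * log x) / (24 * p) = log x
  push_cast
  field_simp
  rw [I_sq]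
  ring

lemma nome_eq_param_pow (hp : 0 < p) (z : ℍ) : nome z = param p z ^ (24 * p) := by
  have hpc : (p : ℂ) ≠ 0 := by exact_mod_cast hp.ne'
  rw [nome, param, ← exp_nat_mul]
  congr 1
  push_cast
  field_simp

/-- In x = q^{1/(24p)} the leading exponents are integers: p² for η(pz) and 3(p - 2k)² for f_{p,k}.
Exponents may be negative, hence the need for integrality of inverses. -/
lemma exists_etaProduct_expansion [Fact p.Prime] (n : ExpVec p) : ∃ (e : ℤ) (u : ℂ → ℂ),
    HasIntegralUnitExpansion u ∧ ∀ z, etaProduct p n z = param p z ^ e * u (param p z) := by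
  have hp : 0 < p := (Fact.out : p.Prime).pos
  have hpc : (p : ℂ) ≠ 0 := by exact_mod_cast hp.ne'
  have h1 : ∀ z : ℍ, ModularForm.eta (p * z) =
      param p z ^ (p ^ 2) * qinf (param p z ^ (24 * p * p)) (param p z ^ (24 * p * p)) := fun z => by
    have e : exp (2 * Real.pi * I * (p * z)) = param p z ^ (24 * p * p) := by
      rw [pow_mul, ← nome_eq_param_pow hp, nome, ← exp_nat_mul]
      congr 1
      ring
    rw [eta_eq_qinf, e]
    congr 1
    rw [param, ← exp_nat_mul]
    congr 1
    push_cast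
    field_simp
  have h2 : ∀ (k : Fin (p / 2)) (z : ℍ), biagioli p ((k : ℤ) + 1) z =
      param p z ^ (3 * ((p : ℤ) - 2 * (k + 1)) ^ 2) *
      (qinf (param p z ^ (24 * p * (k + 1))) (param p z ^ (24 * p * p)) *
        qinf (param p z ^ (24 * p * (p - (k + 1)))) (param p z ^ (24 * p * p)) *
        qinf (param p z ^ (24 * p * p)) (param p z ^ (24 * p * p))) := fun k z => by
    have hk := k.2
    have hn := nome_ne_zero z
    have e0 : ∀ r : ℕ, ∏' j : ℕ, (1 - nome z ^ ((r : ℤ) + (p : ℤ) * j)) =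
        qinf (param p z ^ (24 * p * r)) (param p z ^ (24 * p * p)) := fun r => by
      rw [qinf]
      refine tprod_congr fun j => ?_
      rw [zpow_add₀ hn, zpow_mul, pow_mul _ (24 * p) r, pow_mul _ (24 * p) p, ← nome_eq_param_pow hp]
      norm_cast
    have e1 := e0 ((k : ℕ) + 1)
    have e2 := e0 (p - ((k : ℕ) + 1))
    have e3 := e0 p
    rw [Nat.cast_sub (by omega)] at e2
    push_cast at e1 e2
    rw [biagioli, Int.ediv_eq_zero_of_lt (by positivity) (by omega), zpow_zero, one_mul, e1, e2, e3]
    congr 1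
    rw [param, ← exp_int_mul]
    congr 1
    push_cast
    field_simp
    ring
  refine ⟨p ^ 2 * n 0 + ∑ k : Fin (p / 2), 3 * ((p : ℤ) - 2 * (k + 1)) ^ 2 * n k.succ,
    fun x => qinf (x ^ (24 * p * p)) (x ^ (24 * p * p)) ^ n 0 * ∏ k : Fin (p / 2),
      (qinf (x ^ (24 * p * (k + 1))) (x ^ (24 * p * p)) *
        qinf (x ^ (24 * p * (p - (k + 1)))) (x ^ (24 * p * p)) *
        qinf (x ^ (24 * p * p)) (x ^ (24 * p * p))) ^ n k.succ, ?_, fun z => ?_⟩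
  · have hpp : 0 < 24 * p * p := by positivity
    refine ((HasIntegralUnitExpansion.qinf hpp hpp).zpow _).mul
      (HasIntegralUnitExpansion.prod _ fun k _ => ((HasIntegralUnitExpansion.mul
        (HasIntegralUnitExpansion.mul (.qinf (by positivity) hpp) (.qinf ?_ hpp))
        (.qinf hpp hpp)).zpow _))
    have : 0 < p - ((k : ℕ) + 1) := by
      have := k.2
      omega
    positivity
  · have hx := param_ne_zero (p := p) z
    have hpow : ∀ (s : Finset (Fin (p / 2))) (f : Fin (p / 2) → ℤ),
        param p z ^ (∑ k ∈ s, f k) = ∏ k ∈ s, param p z ^ f k := fun s f => by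
      classical
      induction s using Finset.induction_on with
      | empty => simp
      | insert a s ha ih => rw [Finset.sum_insert ha, Finset.prod_insert ha, zpow_add₀ hx, ih]
    rw [etaProduct, h1]
    simp only [h2, mul_zpow, Finset.prod_mul_distrib]
    rw [zpow_add₀ hx, hpow, zpow_mul]
    simp only [zpow_mul]
    norm_cast
    ring

/-- Evaluation of a polynomial with rational coefficients, as a ring homomorphism. -/
noncomputable def evalHom (ω : ℂ) : ℚ[X] →+* ℂ := (Polynomial.aeval ω).toRingHom

lemma evalHom_apply (ω : ℂ) (P : ℚ[X]) : evalHom ω P = Polynomial.aeval ω P := rfl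

lemma map_evalHom_map_int (ω : ℂ) (Φ : PowerSeries ℤ) :
    (Φ.map (Int.castRingHom ℚ[X])).map (evalHom ω) = Φ.map (Int.castRingHom ℂ) := by
  ext n
  simp

variable [Fact p.Prime]

/-- One series over ℚ[X] serves all l at once; X stands for the root of unity. -/
lemma exists_dissection_expansion (hp : 3 < p) {m : ℕ} (hm : m < p) :
    ∃ Θ : PowerSeries ℚ[X], ∀ (l : ℕ) (z : ℍ),
      EvalsTo (Θ.map (evalHom (zeta p ^ l))) (param p z) (dissection p m l z) := by
  have hp0 : 0 < p := by omega
  have hpc : (p : ℂ) ≠ 0 := by exact_mod_cast hp0.ne'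
  have hpp : 0 < 24 * p * p := by positivity
  obtain ⟨Φ, hΦ⟩ := ((HasIntegralUnitExpansion.qinf hpp hpp).1.mul (.X_pow (24 * m)))
  set S : PowerSeries ℚ[X] := PowerSeries.mk fun N => if 24 * p ∣ N then
    (if (p ^ 2 - 1) / 24 ≤ p * (N / (24 * p)) + m then ∑ k ∈ Finset.range p,
      (crankCountMod k p (p * (N / (24 * p)) + m - (p ^ 2 - 1) / 24) : ℚ[X]) * Polynomial.X ^ k
      else 0) else 0 with hS
  refine ⟨Φ.map (Int.castRingHom ℚ[X]) * S, fun l z => ?_⟩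
  obtain ⟨V, hV⟩ : ∃ V, HasSum _ V := ⟨_, hasSum_dissection hp hm l z⟩
  have h1 : EvalsTo (S.map (evalHom (zeta p ^ l))) (param p z) V := by
    have hinj : Function.Injective fun n : ℕ => 24 * p * n := fun a b hab =>
      Nat.eq_of_mul_eq_mul_left (by positivity) hab
    refine (hinj.hasSum_iff fun N hN => ?_).mp (hasSum_of_eq hV (fun n => ?_) rfl)
    · rw [PowerSeries.coeff_map, hS, PowerSeries.coeff_mk, if_neg, map_zero, zero_mul]
      rintro ⟨n, hn⟩
      exact hN ⟨n, hn.symm⟩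
    · simp only [Function.comp]
      rw [PowerSeries.coeff_map, hS, PowerSeries.coeff_mk, if_pos (Dvd.intro n rfl),
        Nat.mul_div_cancel_left n (by positivity), pow_mul, ← nome_eq_param_pow hp0]
      split_ifs with h
      · simp only [evalHom_apply, map_sum, map_mul, map_pow, Polynomial.aeval_X, map_intCast,
          ← pow_mul, mul_comm l]
      · simp
  have h2 := (hΦ _ (norm_param_lt_one hp0 z)).mul h1
  rw [map_mul, map_evalHom_map_int]
  have hpre : ∏' n : ℕ, (1 - nome z ^ (p * (n + 1))) =
      qinf (param p z ^ (24 * p * p)) (param p z ^ (24 * p * p)) := by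
    rw [qinf, pow_mul, ← nome_eq_param_pow hp0]
    exact tprod_congr fun n => by ring
  have hxm : exp (2 * Real.pi * I * m * z / p) = param p z ^ (24 * m) := by
    rw [param, ← exp_nat_mul]
    congr 1
    push_cast
    field_simp
  rw [dissection, hV.tsum_eq, hpre, hxm, mul_comm (param p z ^ (24 * m))]
  exact h2

lemma zeta_pow_isPrimitiveRoot {l : ℕ} (hl0 : 0 < l) (hl : l < p) :
    IsPrimitiveRoot (zeta p ^ l) p :=
  (zeta_isPrimitiveRoot (Fact.out : p.Prime).ne_zero).pow_of_coprime l
    (Nat.coprime_of_lt_prime hl0.ne' hl Fact.out).symm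

/-- An identity between dissection elements and eta products remains true when `ζ_p` is replaced
by a conjugate. -/
lemma identity_conj (hp : 3 < p) {m : ℕ} (hm : m < p) {l l' : ℕ} (hl0 : 0 < l) (hl : l < p)
    (hl0' : 0 < l') (hl' : l' < p) {t : ℕ} (n : Fin t → ExpVec p) (c : Fin t → ℚ[X])
    (H : ∀ z, dissection p m l z =
      ∑ i, Polynomial.aeval (zeta p ^ l) (c i) * etaProduct p (n i) z) (z : ℍ) :
    dissection p m l' z =
      ∑ i, Polynomial.aeval (zeta p ^ l') (c i) * etaProduct p (n i) z := by
  have hp0 : 0 < p := by omega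
  obtain ⟨Θ, hΘ⟩ := exists_dissection_expansion hp hm
  choose e u hu heu using fun i => exists_etaProduct_expansion (n i)
  -- Multiplication by x^L clears the negative powers in all eta products, so the identity becomes
  -- the vanishing of a power series Ω over ℚ[X] specialised at a root of unity.
  set L : ℕ := ∑ i, (e i).natAbs with hL
  have heL : ∀ i, 0 ≤ L + e i := fun i => by
    have h1 : (e i).natAbs ≤ L := Finset.single_le_sum (f := fun i => (e i).natAbs)
      (fun _ _ => Nat.zero_le _) (Finset.mem_univ i)
    omega
  choose Ψ hΨ using fun i => (hu i).1.mul (.X_pow (L + e i).toNat)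
  set Ω : PowerSeries ℚ[X] := PowerSeries.X ^ L * Θ - ∑ i, PowerSeries.C (c i) *
    (Ψ i).map (Int.castRingHom ℚ[X]) with hΩ
  have key : ∀ (k : ℕ) (z : ℍ), EvalsTo (Ω.map (evalHom (zeta p ^ k))) (param p z)
      (param p z ^ L * (dissection p m k z -
        ∑ i, Polynomial.aeval (zeta p ^ k) (c i) * etaProduct p (n i) z)) := fun k z => by
    have hx := param_ne_zero (p := p) z
    have h1 := ((EvalsTo.X_pow L (param p z)).mul (hΘ k z)).sub (EvalsTo.sum Finset.univ fun i _ =>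
      (EvalsTo.const (evalHom (zeta p ^ k) (c i)) (param p z)).mul
        (hΨ i _ (norm_param_lt_one hp0 z)))
    have h2 : Ω.map (evalHom (zeta p ^ k)) = PowerSeries.X ^ L * Θ.map (evalHom (zeta p ^ k)) -
        ∑ i, PowerSeries.C (evalHom (zeta p ^ k) (c i)) * (Ψ i).map (Int.castRingHom ℂ) := by
      rw [hΩ, map_sub, map_mul, map_pow, PowerSeries.map_X, map_sum]
      simp only [map_mul, PowerSeries.map_C, map_evalHom_map_int]
    rw [h2]
    convert h1 using 1
    rw [mul_sub, Finset.mul_sum]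
    congr 1
    refine Finset.sum_congr rfl fun i _ => ?_
    beta_reduce
    rw [heu, evalHom_apply, ← zpow_natCast (param p z) (L + e i).toNat, Int.toNat_of_nonneg (heL i),
      zpow_add₀ hx, zpow_natCast]
    ring
  have h0 : Ω.map (evalHom (zeta p ^ l)) = 0 := eq_zero_of_evalsTo_zero fun x hx0 hx => by
    obtain ⟨w, rfl⟩ := exists_param_eq hp0 hx0 hx
    have h1 := key l w
    rwa [H w, sub_self, mul_zero] at h1
  -- Each coefficient is a rational polynomial vanishing at one primitive p-th root of unity, hence
  -- at all of them.
  have h0' : Ω.map (evalHom (zeta p ^ l')) = 0 := by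
    ext N
    have h1 := congrArg (PowerSeries.coeff N) h0
    rw [PowerSeries.coeff_map, evalHom_apply, map_zero] at h1 ⊢
    exact aeval_eq_zero_of_isPrimitiveRoot hp0 (zeta_pow_isPrimitiveRoot hl0 hl)
      (zeta_pow_isPrimitiveRoot hl0' hl') h1
  have h1 := key l' z
  rw [h0'] at h1
  have h2 : EvalsTo 0 (param p z) 0 := by simpa using EvalsTo.const 0 (param p z)
  exact sub_eq_zero.mp ((mul_eq_zero.mp (h1.unique h2)).resolve_left
    (pow_ne_zero _ (param_ne_zero z)))

end Conjugation

/-! ### Coefficients in ℚ(ζ_p), bijectivity and square classes -/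

section Coefficients

open Complex IntermediateField

variable {p : ℕ}

/-- The cyclotomic field `ℚ(ζ_p)`. -/
noncomputable def cyclotomicField (p : ℕ) : IntermediateField ℚ ℂ := ℚ⟮zeta p⟯

lemma zeta_mem : zeta p ∈ cyclotomicField p := mem_adjoin_simple_self ℚ (zeta p)

lemma transferConst_inv (a : ℕ) : (transferConst p a)⁻¹ =
    (-1) ^ (a + 1) * ((Real.sin (Real.pi / p) / Real.sin (a * Real.pi / p) : ℝ) : ℂ) := by
  have h1 : ∀ k : ℕ, sinConst ((k : ℂ) / p) = 2 * I * ((Real.sin (k * Real.pi / p) : ℝ) : ℂ) :=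
      fun k => by
    rw [sinConst, ofReal_sin]
    push_cast
    ring_nf
  have h2 := h1 1
  rw [Nat.cast_one, Nat.cast_one, one_mul] at h2
  have hm1 : ((-1 : ℂ) ^ (a + 1))⁻¹ = (-1) ^ (a + 1) := by rw [← inv_pow]; norm_num
  rw [transferConst, mul_inv, hm1, inv_div, h1, h2, ofReal_div,
    mul_div_mul_left _ _ (mul_ne_zero two_ne_zero I_ne_zero)]

lemma transferSign_mul_self (a : ℕ) (n : ExpVec p) : transferSign p a n * transferSign p a n = 1 := by
  rw [transferSign, ← mul_zpow]
  norm_num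

lemma transferSign_mem (a : ℕ) (n : ExpVec p) : transferSign p a n ∈ cyclotomicField p :=
  zpow_mem (neg_mem (one_mem _)) _

lemma aeval_pow_mem (a : ℕ) (P : ℚ[X]) :
    Polynomial.aeval (zeta p ^ a) P ∈ cyclotomicField p := by
  have h : (Polynomial.aeval (⟨zeta p ^ a, pow_mem zeta_mem a⟩ : cyclotomicField p) P : ℂ) =
      Polynomial.aeval (zeta p ^ a) P := by
    rw [← IntermediateField.coe_val, ← Polynomial.aeval_algHom_apply]
    rfl
  rw [← h]
  exact Subtype.prop _

variable [Fact p.Prime]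

lemma exists_aeval_of_mem {x : ℂ} (hx : x ∈ cyclotomicField p) :
    ∃ P : ℚ[X], Polynomial.aeval (zeta p) P = x := by
  have hp := (Fact.out : p.Prime)
  have hint : IsIntegral ℚ (zeta p) :=
    (zeta_isPrimitiveRoot hp.ne_zero).isIntegral hp.pos |>.tower_top
  have h1 : x ∈ (cyclotomicField p).toSubalgebra := hx
  rw [cyclotomicField, adjoin_simple_toSubalgebra_of_isAlgebraic hint.isAlgebraic,
    Algebra.adjoin_singleton_eq_range_aeval] at h1
  exact h1

lemma sinConst_eq (s : ℂ) : sinConst s = exp (Real.pi * I * s) - (exp (Real.pi * I * s))⁻¹ := by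
  rw [sinConst, sin, ← exp_neg, show Real.pi * I * s = Real.pi * s * I by ring,
    show -(Real.pi * s * I) = -(Real.pi * s) * I by ring]
  linear_combination (exp (-(Real.pi * s) * I) - exp (Real.pi * s * I)) * I_sq

/-- As p is odd, e^{πi/p} = -ζ_p^{(p+1)/2} already lies in ℚ(ζ_p), and the constant is a difference
of a power of it and its inverse. -/
lemma sinConst_mem (hp : 3 < p) (a : ℕ) : sinConst ((a : ℂ) / p) ∈ cyclotomicField p := by
  have hpc : (p : ℂ) ≠ 0 := by exact_mod_cast (Fact.out : p.Prime).ne_zero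
  have e := prime_two_mul_half_add_one hp
  have e' : (p : ℂ) = 2 * ((p / 2 : ℕ) : ℂ) + 1 := by
    have : ((p : ℕ) : ℂ) = ((p / 2 + p / 2 + 1 : ℕ) : ℂ) := by rw [← e]
    rw [this]
    push_cast
    ring
  have h1 : exp (Real.pi * I * ((a : ℂ) / p)) = (-zeta p ^ (p / 2 + 1)) ^ a := by
    have h2 : zeta p ^ (p / 2 + 1) = -exp (Real.pi * I * (1 / p)) := by
      have : -exp (Real.pi * I * (1 / p)) = exp (Real.pi * I * (1 / p) + Real.pi * I) := by
        rw [exp_add, exp_pi_mul_I]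
        ring
      rw [this, zeta_pow]
      congr 1
      push_cast
      field_simp
      linear_combination -e'
    rw [h2, neg_neg, ← exp_nat_mul]
    congr 1
    ring
  have h3 : exp (Real.pi * I * ((a : ℂ) / p)) ∈ cyclotomicField p := by
    rw [h1]
    exact pow_mem (neg_mem (pow_mem zeta_mem _)) a
  rw [sinConst_eq]
  exact sub_mem h3 (inv_mem h3)

lemma transferConst_mem (hp : 3 < p) (a : ℕ) : transferConst p a ∈ cyclotomicField p := by
  have h := sinConst_mem hp 1
  rw [Nat.cast_one] at h
  exact mul_mem (pow_mem (neg_mem (one_mem _)) _) (div_mem (sinConst_mem hp a) h)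

lemma exists_mul_modEq_one {a : ℕ} (ha : (a : ZMod p) ≠ 0) :
    ∃ b : ℕ, ((a : ZMod p) * b = 1) :=
  ⟨((a : ZMod p)⁻¹).val, by rw [ZMod.natCast_zmod_val, mul_inv_cancel₀ ha]⟩

lemma permVec_permVec {a b : ℕ} (h : (a : ZMod p) * b = 1) (n : ExpVec p) :
    permVec p a (permVec p b n) = n := by
  funext i
  rw [permVec, permVec, foldIndex_mul_cast_foldIndex, ← mul_assoc, ← mul_inv, mul_comm (b : ZMod p), h,
    inv_one, one_mul]
  congr 1
  exact Fin.ext (foldIndex_natCast (Nat.lt_succ_iff.mp i.2))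

lemma isTransfer_iff {a t : ℕ} (hp : 3 < p) (ha1 : 1 ≤ a) (hap : a < p) (n n' : Fin t → ExpVec p)
    (c c' : Fin t → ℚ[X]) : IsTransfer p a n c n' c' ↔ ∀ i, n' i = permVec p a (n i) ∧
      Polynomial.aeval (zeta p ^ a) (c i) * transferSign p a (n i) =
        transferConst p a * Polynomial.aeval (zeta p) (c' i) := by
  have h0 := transferConst_ne_zero hp ha1 hap
  refine forall_congr' fun i => and_congr_right fun _ => ?_
  rw [← transferConst_inv, mul_assoc, ← div_eq_inv_mul, eq_div_iff h0, mul_comm (transferSign p a _),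
    mul_comm (transferConst p a)]
  exact eq_comm

lemma exists_isTransfer {a t : ℕ} (hp : 3 < p) (ha1 : 1 ≤ a) (hap : a < p) (n : Fin t → ExpVec p)
    (c : Fin t → ℚ[X]) : ∃ n' c', IsTransfer p a n c n' c' := by
  have h0 := transferConst_ne_zero hp ha1 hap
  choose c' hc' using fun i => exists_aeval_of_mem (mul_mem (inv_mem (transferConst_mem hp a))
    (mul_mem (aeval_pow_mem (p := p) a (c i)) (transferSign_mem a (n i))))
  refine ⟨fun i => permVec p a (n i), c', (isTransfer_iff hp ha1 hap _ _ _ _).mpr fun i => ⟨rfl, ?_⟩⟩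
  rw [hc', mul_inv_cancel_left₀ h0]

lemma exists_isTransfer_eq {a t : ℕ} (hp : 3 < p) (ha1 : 1 ≤ a) (hap : a < p)
    (n' : Fin t → ExpVec p) (c' : Fin t → ℚ[X]) : ∃ n c, IsTransfer p a n c n' c' := by
  obtain ⟨b, hb⟩ := exists_mul_modEq_one (TransferMatrix.natCast_ne_zero ha1 hap)
  have hζ := zeta_isPrimitiveRoot (Fact.out : p.Prime).ne_zero
  choose d hd using fun i => exists_aeval_of_mem (mul_mem (transferConst_mem hp a)
    (mul_mem (transferSign_mem a (permVec p b (n' i))) (aeval_pow_mem (p := p) 1 (c' i))))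
  -- With ab ≡ 1 mod p, substituting X^b undoes ζ_p ↦ ζ_p^a, and π_b undoes π_a.
  refine ⟨fun i => permVec p b (n' i), fun i => (d i).comp (Polynomial.X ^ b),
    (isTransfer_iff hp ha1 hap _ _ _ _).mpr fun i => ⟨(permVec_permVec hb _).symm, ?_⟩⟩
  have hab : (zeta p ^ a) ^ b = zeta p := by
    rw [← pow_mul]
    have h1 : a * b % p = 1 % p := (ZMod.natCast_eq_natCast_iff _ _ _).mp (by exact_mod_cast hb)
    rw [pow_eq_pow_mod _ hζ.pow_eq_one, h1, ← pow_eq_pow_mod _ hζ.pow_eq_one, pow_one]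
  rw [Polynomial.aeval_comp, map_pow, Polynomial.aeval_X, hab, hd, pow_one]
  linear_combination (transferConst p a * Polynomial.aeval (zeta p) (c' i)) *
    transferSign_mul_self a (permVec p b (n' i))

/-- If m and m₀ have the same nonzero Legendre symbol, m₀m is a square y² mod p, and a = y/m₀ gives
m₀a² = m. -/
lemma exists_sq_mul {mplus mminus m : ℕ} (hp : 3 < p) (hplus : legendreSym p (mplus : ℤ) = 1)
    (hminus : legendreSym p (mminus : ℤ) = -1) (hm : m < p) :
    ∃ m₀ ∈ ({0, mplus, mminus} : Set ℕ), ∃ a : ℕ, 1 ≤ a ∧ a < p ∧ m ≡ m₀ * a ^ 2 [MOD p] := by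
  by_cases hm0 : m = 0
  · exact ⟨0, by simp, 1, le_rfl, by omega, by simp [hm0, Nat.ModEq]⟩
  have hmz : ((m : ℤ) : ZMod p) ≠ 0 := by
    exact_mod_cast TransferMatrix.natCast_ne_zero (Nat.one_le_iff_ne_zero.mpr hm0) hm
  obtain ⟨m₀, hm₀, hl⟩ : ∃ m₀ ∈ ({0, mplus, mminus} : Set ℕ),
      legendreSym p (m₀ : ℤ) = legendreSym p m ∧ legendreSym p (m₀ : ℤ) ≠ 0 := by
    rcases legendreSym.eq_one_or_neg_one p hmz with h | h
    · exact ⟨mplus, by simp, by rw [h, hplus], by rw [hplus]; norm_num⟩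
    · exact ⟨mminus, by simp, by rw [h, hminus], by rw [hminus]; norm_num⟩
  have hmz0 : ((m₀ : ℤ) : ZMod p) ≠ 0 := fun h => hl.2 ((legendreSym.eq_zero_iff p _).mpr h)
  have hsq : legendreSym p (m₀ * m : ℤ) = 1 := by
    rw [legendreSym.mul, hl.1, ← pow_two, legendreSym.sq_one p hmz]
  obtain ⟨y, hy⟩ := (legendreSym.eq_one_iff p (by push_cast; exact_mod_cast mul_ne_zero hmz0 hmz)).mp hsq
  push_cast at hy hmz0 hmz
  have hy0 : y ≠ 0 := by
    rintro rfl
    exact mul_ne_zero hmz0 hmz (by simpa using hy)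
  have hx0 : y / (m₀ : ZMod p) ≠ 0 := div_ne_zero hy0 hmz0
  refine ⟨m₀, hm₀, (y / (m₀ : ZMod p)).val, Nat.one_le_iff_ne_zero.mpr fun h =>
    hx0 ((ZMod.val_eq_zero _).mp h), ZMod.val_lt _, ?_⟩
  rw [← ZMod.natCast_eq_natCast_iff]
  push_cast
  rw [ZMod.natCast_zmod_val]
  field_simp
  linear_combination hy

end Coefficients

end CrankDissection

/-! ### The main theorem -/

open CrankDissection in
theorem corollary1p9 (p : ℕ) [Fact p.Prime] (hp : 3 < p)
    (mplus mminus : ℕ) (hplus_lt : mplus < p) (hminus_lt : mminus < p)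
    (hplus : legendreSym p (mplus : ℤ) = 1) (hminus : legendreSym p (mminus : ℤ) = -1)
    (m : ℕ) (hm : m < p) :
    (∃ m₀ ∈ ({0, mplus, mminus} : Set ℕ), ∃ a : ℕ, 1 ≤ a ∧ a < p ∧ m ≡ m₀ * a ^ 2 [MOD p]) ∧
    (∀ m₀ ∈ ({0, mplus, mminus} : Set ℕ), ∀ a : ℕ, 1 ≤ a → a < p → m ≡ m₀ * a ^ 2 [MOD p] →
      (∀ (t : ℕ) (n : Fin t → ExpVec p) (c : Fin t → ℚ[X]),
        ∃ (n' : Fin t → ExpVec p) (c' : Fin t → ℚ[X]), IsTransfer p a n c n' c') ∧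
      (∀ (t : ℕ) (n' : Fin t → ExpVec p) (c' : Fin t → ℚ[X]),
        ∃ (n : Fin t → ExpVec p) (c : Fin t → ℚ[X]), IsTransfer p a n c n' c') ∧
      (∀ (t : ℕ) (n n' : Fin t → ExpVec p) (c c' : Fin t → ℚ[X]), IsTransfer p a n c n' c' →
        (IsEtaIdentity p m₀ n c ↔ IsEtaIdentity p m n' c'))) := by
  refine ⟨exists_sq_mul hp hplus hminus hm, fun m₀ hm₀ a ha1 hap hmm =>
    ⟨fun t n c => exists_isTransfer hp ha1 hap n c,
      fun t n' c' => exists_isTransfer_eq hp ha1 hap n' c', fun t n n' c c' h => ?_⟩⟩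
  have hm₀p : m₀ < p := by
    rcases hm₀ with rfl | rfl | rfl
    · omega
    · exact hplus_lt
    · exact hminus_lt
  obtain ⟨A⟩ := exists_transferMatrix hp ha1 hap
  rw [isTransfer_iff hp ha1 hap] at h
  obtain rfl : n' = fun i => permVec p a (n i) := funext fun i => (h i).1
  -- The modular half: it relates m at ζ_p to m₀ at ζ_p^a. The conjugation between ζ_p and ζ_p^a for
  -- m₀ then closes each direction.
  have key := A.identity_iff hp ha1 hap hm hm₀p hmm n (fun i => Polynomial.aeval (zeta p ^ a) (c i))
    (fun i => Polynomial.aeval (zeta p) (c' i)) fun i => (h i).2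
  rw [IsEtaIdentity, IsEtaIdentity, ← key]
  refine ⟨fun H => ?_, fun H => ?_⟩
  · exact identity_conj hp hm₀p one_pos (by omega) ha1 hap n c (by simpa only [pow_one] using H)
  · have := identity_conj hp hm₀p ha1 hap one_pos (by omega) n c H
    simpa only [pow_one] using this
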